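/- **Phase retrieval, arbitrary noise.** Fix $\kappa<\infty$ and $\mu>1$. There are constants $c_3,c_4,c_5>0$, depending only on $(\kappa,\mu)$, such that for every $c_4'\ge c_4$ there is $c_6>0$, depending only on $(\kappa,\mu,c_4')$, for which the following holds. Let $p\ge 1$, $n\ge c_3p$ and $\beta^*\in\mathbb R^p$. Let $x_1,\dots,x_n\in\mathbb R^p$ be random vectors whose entries $x_i(l)$ are i.i.d. (over $i$ and $l$) with zero mean, variance $1$, fourth moment $\mu$ and sub-Gaussian norm $\inf\{t>0:\mathbb E\exp(x_i(l)^2/t^2)\le 2\}\le\kappa$. Let $e\in\mathbb R^n$ be an arbitrary random noise vector, possibly depending on $x_1,\dots,x_n$, with $\|e\|_2\le c_5\sqrt n\,\|\beta^*\|_2$ almost surely, and observe $$z_i=|x_i^\top\beta^*+e_i|,\qquad i=1,\dots,n .$$ Generate independent Rademacher signs $\epsilon_1,\dots,\epsilon_n$, independent of $(x_1,\dots,x_n,e)$, set $y_i=\epsilon_iz_i$, and let $\eta$ (possibly random) satisfy $c_4\sqrt n\|e\|_2\|\beta^*\|_2\le\eta\le c_4'\sqrt n\|e\|_2\|\beta^*\|_2$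 almost surely. Consider the convex program $$\min_{K\in\mathbb R^{p\times p},\,g\in\mathbb R^p}\|K\|_*\quad\text{s.t.}\quad\sum_{i=1}^n\bigl|-\langle x_ix_i^\top,K\rangle+2y_i\langle x_i,g\rangle-y_i^2\bigr|\le\eta ,$$ where $\|\cdot\|_*$ is the nuclear norm. For an optimal solution $(\hat K,\hat g)$, let $\hat\lambda$ be the largest eigenvalue and $\hat v$ a corresponding unit eigenvector of $\hat J=\hat g\hat g^\top-\frac12(\hat K+\hat K^\top)$ (which is $\hat g\hat g^\top-\hat K$ if $\hat K$ is symmetric), and put $\hat\beta_{1},\hat\beta_2=\hat g\pm\sqrt{\max(\hat\lambda,0)}\,\hat v$. Then with probability at least $1-n^{-2}$ the program has an optimal solution, and every output $(\hat\beta_1,\hat\beta_2)$ obtained in this way (from any optimal solution and any choice of $\hat v$) satisfies $$\min_{b=1,2}\|\hat\beta_b-\beta^*\|_2\le c_6\,\frac{\|e\|_2}{\sqrt n}.$$ -/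

import Mathlib

open MeasureTheory ProbabilityTheory
open scoped ENNReal NNReal Matrix

noncomputable section

namespace PhaseRetrieval

/-! ### Probabilistic setting -/

/-- The sub-Gaussian (Orlicz `ψ₂`) norm `inf {t > 0 : 𝔼 exp (X² / t²) ≤ 2}`, with value `∞` if `X` is
not sub-Gaussian. -/
def psi2Norm {Ω : Type*} [MeasurableSpace Ω] (X : Ω → ℝ) (P : Measure Ω) : ℝ≥0∞ :=
  ⨅ (t : ℝ≥0) (_ : 0 < t ∧ ∫⁻ ω, ENNReal.ofReal (Real.exp (X ω ^ 2 / (t : ℝ) ^ 2)) ∂P ≤ 2), (t : ℝ≥0∞)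

/-- The covariates `x₁, …, xₙ ∈ ℝᵖ` have i.i.d. zero-mean entries (over all samples and all
coordinates) of variance `1`, fourth moment `m` and sub-Gaussian norm at most `κ`. -/
structure IsSubGaussianDesign {Ω : Type*} [MeasurableSpace Ω] {n p : ℕ}
    (x : Fin n → Ω → EuclideanSpace ℝ (Fin p)) (κ : ℝ≥0) (m : ℝ) (P : Measure Ω) : Prop where
  measurable : ∀ i, Measurable (x i)
  indep : iIndepFun (fun (q : Fin n × Fin p) ω => x q.1 ω q.2) P
  identDistrib : ∀ q r : Fin n × Fin p,
    IdentDistrib (fun ω => x q.1 ω q.2) (fun ω => x r.1 ω r.2) P P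
  psi2Norm_le : ∀ i l, psi2Norm (fun ω => x i ω l) P ≤ κ
  mean : ∀ i l, ∫ ω, x i ω l ∂P = 0
  second_moment : ∀ i l, ∫ ω, x i ω l ^ 2 ∂P = 1
  fourth_moment : ∀ i l, ∫ ω, x i ω l ^ 4 ∂P = m

/-- `ε₁, …, εₙ` are independent Rademacher (uniform `±1`) random variables. -/
structure IsRademacherFamily {Ω : Type*} [MeasurableSpace Ω] {n : ℕ}
    (ε : Fin n → Ω → ℝ) (P : Measure Ω) : Prop where
  measurable : ∀ i, Measurable (ε i)
  indep : iIndepFun ε P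
  prob_one : ∀ i, P {ω | ε i ω = 1} = 1 / 2
  prob_neg_one : ∀ i, P {ω | ε i ω = -1} = 1 / 2

/-- The Noisy Phase Model: `zᵢ = |xᵢᵀ β + eᵢ|`. -/
def noisyPhase {n p : ℕ} (x : Fin n → EuclideanSpace ℝ (Fin p)) (β : EuclideanSpace ℝ (Fin p))
    (e : EuclideanSpace ℝ (Fin n)) (i : Fin n) : ℝ :=
  |inner ℝ (x i) β + e i|

/-! ### The convex program -/

/-- The trace inner product `⟨A, B⟩ = tr (Aᵀ B)` of matrices. -/
def matInner {p : ℕ} (A B : Matrix (Fin p) (Fin p) ℝ) : ℝ := (Aᵀ * B).trace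

/-- The nuclear norm: the sum of the singular values. -/
def nuclearNorm {p : ℕ} (K : Matrix (Fin p) (Fin p) ℝ) : ℝ :=
  ∑ i ∈ Finset.range p, (Matrix.toEuclideanLin K).singularValues i

/-- The constraint `∑ᵢ |-⟨xᵢ xᵢᵀ, K⟩ + 2 yᵢ ⟨xᵢ, g⟩ - yᵢ²| ≤ η`. -/
def IsFeasible {n p : ℕ} (x : Fin n → EuclideanSpace ℝ (Fin p)) (y : Fin n → ℝ) (η : ℝ)
    (K : Matrix (Fin p) (Fin p) ℝ) (g : EuclideanSpace ℝ (Fin p)) : Prop :=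
  ∑ i, |-matInner (Matrix.vecMulVec (x i) (x i)) K + 2 * y i * inner ℝ (x i) g - y i ^ 2| ≤ η

/-- `(K, g)` is an optimal solution of the program minimizing `‖K‖_*` over all
`(K, g) ∈ ℝ^{p × p} × ℝᵖ` that satisfy the constraint. -/
def IsOptimal {n p : ℕ} (x : Fin n → EuclideanSpace ℝ (Fin p)) (y : Fin n → ℝ) (η : ℝ)
    (K : Matrix (Fin p) (Fin p) ℝ) (g : EuclideanSpace ℝ (Fin p)) : Prop :=
  IsFeasible x y η K g ∧ ∀ K' g', IsFeasible x y η K' g' → nuclearNorm K ≤ nuclearNorm K'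

/-! ### Estimation of the regressors from `(K, g)` -/

/-- `J = g gᵀ - K`, where `K` enters through its symmetric part (which is `K` itself if `K` is
symmetric), so that `J` always has real eigenvalues. -/
def matJ {p : ℕ} (K : Matrix (Fin p) (Fin p) ℝ) (g : EuclideanSpace ℝ (Fin p)) :
    Matrix (Fin p) (Fin p) ℝ :=
  Matrix.vecMulVec g g - (1 / 2 : ℝ) • (K + Kᵀ)

/-- `(lam, v)` is a first eigenvalue-eigenvector pair of `J`: `lam` is the largest eigenvalue and
`v` is a unit eigenvector for it. -/
def IsFirstEigenpair {p : ℕ} (J : Matrix (Fin p) (Fin p) ℝ) (lam : ℝ)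
    (v : EuclideanSpace ℝ (Fin p)) : Prop :=
  ‖v‖ = 1 ∧ Matrix.toEuclideanLin J v = lam • v ∧
    ∀ r : ℝ, Module.End.HasEigenvalue (Matrix.toEuclideanLin J) r → r ≤ lam

/-- `(b₁, b₂)` is a possible output of the eigenvector step on the input `(K, g)`:
`b₁, b₂ = g ± √lam v` (`√` is `0` on negative numbers). -/
def IsEigenOutput {p : ℕ} (K : Matrix (Fin p) (Fin p) ℝ) (g b₁ b₂ : EuclideanSpace ℝ (Fin p)) :
    Prop :=
  ∃ lam v, IsFirstEigenpair (matJ K g) lam v ∧ b₁ = g + √lam • v ∧ b₂ = g - √lam • v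

/-- `(b₁, b₂)` is a possible output of the convex program with data `(x, y)` and parameter `η`,
followed by the eigenvector step. -/
def IsOutput {n p : ℕ} (x : Fin n → EuclideanSpace ℝ (Fin p)) (y : Fin n → ℝ) (η : ℝ)
    (b₁ b₂ : EuclideanSpace ℝ (Fin p)) : Prop :=
  ∃ K g, IsOptimal x y η K g ∧ IsEigenOutput K g b₁ b₂

end PhaseRetrieval

end

namespace PhaseRetrieval

open scoped InnerProductSpace

/-! ### Duality for the nuclear norm -/

section NuclearNorm

variable {p : ℕ}

/-! The signs remove the absolute value. Writing `s i` for `ε i` times the sign of `⟪x i, β⟫ + e i`,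
the observation is `s i * (⟪x i, β⟫ + e i)`, a mixed regression with regressors `β` and `-β` whose
lifted truth is `K = -β βᵀ`, `g = 0`. A Rademacher vector independent of `(x, e)`, multiplied by
signs computed from `(x, e)`, is again Rademacher and independent of `(x, e)`
(`IsRademacherFamily.mul_signs`). So `s` is independent of the design even though the noise may
depend on it, and afterwards `e` enters only through deterministic inequalities.

Put `u = β / ‖β‖` and let `S` be the symmetric part of `K + β βᵀ`. Up to noise terms the residual at
`(K, g)` is `-⟪x i, S (x i)⟫ + 2 s i ⟪x i, β⟫ ⟪x i, g⟫`. Once `η` is large enough the truth is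
feasible, so an optimal `K` has nuclear norm at most `‖β‖²`. Testing this against a subgradient at
`-β βᵀ` shows that the compression of `S` to the complement of `u` has trace norm at most `⟪u, S u⟫`
(`exists_cone_decomposition`). Hence `S` is controlled by the single vector `S u`, with nuclear norm
at most `4 ‖S u‖`.

It remains to bound the `ℓ¹` norm of the residual below by a multiple of `n (‖S u‖ + ‖β‖ ‖g‖)`. This
is done by duality (`IsCertified.norm_add_norm_le`): bounded weights `φ` with `∑ φ i x i x iᵀ` close
to `n (a uᵀ + u aᵀ) / 2` pair with the residual to give about `-n ⟪a, S u⟫`, and `a` can be chosen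
to correlate with `S u`. The terms in `g` disappear because `∑ s i φ i x i x iᵀ` is close to zero.
Using `s i φ i` in place of `φ i` exchanges the two roles and detects `g`. Feasibility bounds the
same `ℓ¹` norm above by a multiple of `√n ‖e‖ ‖β‖`, up to a term in `‖g‖` that is absorbed on the
left, which gives `IsCertified.error_le`. The matrix `J` is then a small perturbation of `β βᵀ`, and
an elementary eigenvector estimate (`min_norm_sqrt_smul_le`) finishes.

The weights are an explicit quadratic polynomial in the row, clipped at a level `τ`. A fourth-moment
identity makes its second-moment matrix exact (`IsSubGaussianRow.integral_certWeight_mul`). The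
coefficient `1 / (m - 1)` corrects the diagonal, and this is where `m > 1` enters. Clipping costs a
bias of order `1 / τ`. Bernstein's inequality and a net of the unit ball make everything uniform
(`IsSignedSample.exists_isCertified`), with a failure probability exponentially small in `n` once
`n` dominates `p`. -/

lemma exists_orthonormalBasis_norm_eq_singularValues
    (T : EuclideanSpace ℝ (Fin p) →ₗ[ℝ] EuclideanSpace ℝ (Fin p)) :
    ∃ v : OrthonormalBasis (Fin p) ℝ (EuclideanSpace ℝ (Fin p)),
      (∀ i, ‖T (v i)‖ = T.singularValues i) ∧ ∀ i j, i ≠ j → ⟪T (v i), T (v j)⟫_ℝ = 0 := by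
  have hn : Module.finrank ℝ (EuclideanSpace ℝ (Fin p)) = p := by simp
  have hinner : ∀ i j, ⟪T (T.isSymmetric_adjoint_comp_self.eigenvectorBasis hn i),
      T (T.isSymmetric_adjoint_comp_self.eigenvectorBasis hn j)⟫_ℝ =
      T.singularValues i ^ 2 *
        ⟪T.isSymmetric_adjoint_comp_self.eigenvectorBasis hn i,
          T.isSymmetric_adjoint_comp_self.eigenvectorBasis hn j⟫_ℝ := by
    intro i j
    rw [← LinearMap.adjoint_inner_left, ← LinearMap.comp_apply,
      LinearMap.IsSymmetric.apply_eigenvectorBasis, T.sq_singularValues_fin hn]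
    simp [inner_smul_left]
  refine ⟨T.isSymmetric_adjoint_comp_self.eigenvectorBasis hn, fun i => ?_, fun i j hij => ?_⟩
  · have h := hinner i i
    rw [real_inner_self_eq_norm_sq, real_inner_self_eq_norm_sq, OrthonormalBasis.norm_eq_one] at h
    have h0 := T.singularValues_nonneg i
    exact (sq_eq_sq₀ (norm_nonneg _) h0).1 (by linarith)
  · rw [hinner, OrthonormalBasis.inner_eq_zero _ hij, mul_zero]

lemma nuclearNorm_eq_sum (K : Matrix (Fin p) (Fin p) ℝ) :
    nuclearNorm K = ∑ i : Fin p, (Matrix.toEuclideanLin K).singularValues i :=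
  (Fin.sum_univ_eq_sum_range (fun i => (Matrix.toEuclideanLin K).singularValues i) p).symm

lemma sum_inner_eq_trace (W T : EuclideanSpace ℝ (Fin p) →ₗ[ℝ] EuclideanSpace ℝ (Fin p))
    (b : OrthonormalBasis (Fin p) ℝ (EuclideanSpace ℝ (Fin p))) :
    ∑ j, ⟪W (b j), T (b j)⟫_ℝ = LinearMap.trace ℝ _ (LinearMap.adjoint W ∘ₗ T) := by
  rw [LinearMap.trace_eq_sum_inner _ b]
  simp [LinearMap.adjoint_inner_right]

/-- Trace duality: pairing with a contraction is at most the nuclear norm. -/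
lemma sum_inner_le_nuclearNorm (K : Matrix (Fin p) (Fin p) ℝ)
    (W : EuclideanSpace ℝ (Fin p) →ₗ[ℝ] EuclideanSpace ℝ (Fin p)) (hW : ∀ z, ‖W z‖ ≤ ‖z‖)
    (b : OrthonormalBasis (Fin p) ℝ (EuclideanSpace ℝ (Fin p))) :
    ∑ j, ⟪W (b j), Matrix.toEuclideanLin K (b j)⟫_ℝ ≤ nuclearNorm K := by
  obtain ⟨v, hv, -⟩ := exists_orthonormalBasis_norm_eq_singularValues (Matrix.toEuclideanLin K)
  rw [sum_inner_eq_trace, ← sum_inner_eq_trace _ _ v, nuclearNorm_eq_sum]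
  refine Finset.sum_le_sum fun j _ => (real_inner_le_norm _ _).trans ?_
  rw [hv]
  have h := hW (v j)
  rw [OrthonormalBasis.norm_eq_one] at h
  exact mul_le_of_le_one_left (LinearMap.singularValues_nonneg _ _) h

lemma norm_sq_sum_smul_of_orthogonal {ι : Type*} [Fintype ι] (c : ι → ℝ)
    (w : ι → EuclideanSpace ℝ (Fin p)) (hw : ∀ i j, i ≠ j → ⟪w i, w j⟫_ℝ = 0) :
    ‖∑ i, c i • w i‖ ^ 2 = ∑ i, c i ^ 2 * ‖w i‖ ^ 2 := by
  classical
  rw [← real_inner_self_eq_norm_sq, sum_inner]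
  refine Finset.sum_congr rfl fun i _ => ?_
  rw [inner_sum, Finset.sum_eq_single i]
  · rw [inner_smul_left, inner_smul_right, real_inner_self_eq_norm_sq]; simp; ring
  · intro j _ hj
    rw [inner_smul_left, inner_smul_right, hw i j hj.symm]; simp
  · simp

/-- The maximiser in trace duality is the partial isometry of the polar decomposition, sending each
right singular vector to the matching left one. Since `0⁻¹ = 0`, it vanishes on the kernel without a
case distinction in its definition. -/
lemma exists_contraction_sum_inner_eq_nuclearNorm (K : Matrix (Fin p) (Fin p) ℝ) :
    ∃ W : EuclideanSpace ℝ (Fin p) →ₗ[ℝ] EuclideanSpace ℝ (Fin p), (∀ z, ‖W z‖ ≤ ‖z‖) ∧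
      ∀ b : OrthonormalBasis (Fin p) ℝ (EuclideanSpace ℝ (Fin p)),
        ∑ j, ⟪W (b j), Matrix.toEuclideanLin K (b j)⟫_ℝ = nuclearNorm K := by
  set T := Matrix.toEuclideanLin K with hT
  obtain ⟨v, hv, hvo⟩ := exists_orthonormalBasis_norm_eq_singularValues T
  have hWv : ∀ j, (∑ i, (innerₗ _ (v i)).smulRight ((T.singularValues i)⁻¹ • T (v i)) :
      EuclideanSpace ℝ (Fin p) →ₗ[ℝ] EuclideanSpace ℝ (Fin p)) (v j) =
      (T.singularValues j)⁻¹ • T (v j) := by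
    intro j
    rw [LinearMap.sum_apply, Finset.sum_eq_single j]
    · simp
    · intro i _ hij
      simp [OrthonormalBasis.inner_eq_zero v hij]
    · simp
  refine ⟨∑ i, (innerₗ _ (v i)).smulRight ((T.singularValues i)⁻¹ • T (v i)), fun z => ?_,
    fun b => ?_⟩
  · rw [← sq_le_sq₀ (norm_nonneg _) (norm_nonneg _), ← v.sum_sq_norm_inner_right z]
    simp only [LinearMap.sum_apply, LinearMap.smulRight_apply, innerₗ_apply_apply]
    rw [norm_sq_sum_smul_of_orthogonal]
    · refine Finset.sum_le_sum fun i _ => ?_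
      rw [Real.norm_eq_abs, sq_abs, norm_smul, hv, norm_inv, Real.norm_of_nonneg
        (T.singularValues_nonneg i)]
      refine mul_le_of_le_one_right (sq_nonneg _) ?_
      rcases eq_or_ne (T.singularValues i) 0 with h | h
      · simp [h]
      · simp [inv_mul_cancel₀ h]
    · intro i j hij
      rw [inner_smul_left, inner_smul_right, hvo i j hij]; simp
  · rw [sum_inner_eq_trace, ← sum_inner_eq_trace _ _ v, nuclearNorm_eq_sum]
    refine Finset.sum_congr rfl fun j _ => ?_
    rw [hWv, inner_smul_left, real_inner_self_eq_norm_sq, hv]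
    rcases eq_or_ne (T.singularValues j) 0 with h | h
    · simp [← hT, h]
    · simp only [conj_trivial]; field_simp; rfl

lemma nuclearNorm_nonneg (K : Matrix (Fin p) (Fin p) ℝ) : 0 ≤ nuclearNorm K :=
  Finset.sum_nonneg fun _ _ => LinearMap.singularValues_nonneg _ _

lemma nuclearNorm_zero : nuclearNorm (0 : Matrix (Fin p) (Fin p) ℝ) = 0 := by
  simp [nuclearNorm]

lemma nuclearNorm_le_sum_norm (K : Matrix (Fin p) (Fin p) ℝ)
    (b : OrthonormalBasis (Fin p) ℝ (EuclideanSpace ℝ (Fin p))) :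
    nuclearNorm K ≤ ∑ j, ‖Matrix.toEuclideanLin K (b j)‖ := by
  obtain ⟨W, hW, h⟩ := exists_contraction_sum_inner_eq_nuclearNorm K
  rw [← h b]
  refine Finset.sum_le_sum fun j _ => (real_inner_le_norm _ _).trans ?_
  have h := hW (b j)
  rw [OrthonormalBasis.norm_eq_one] at h
  exact mul_le_of_le_one_left (norm_nonneg _) h

lemma nuclearNorm_le_add_sub (K K' : Matrix (Fin p) (Fin p) ℝ) :
    nuclearNorm K ≤ nuclearNorm K' + nuclearNorm (K - K') := by
  obtain ⟨W, hW, h⟩ := exists_contraction_sum_inner_eq_nuclearNorm K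
  rw [← h (EuclideanSpace.basisFun _ ℝ)]
  have h1 := sum_inner_le_nuclearNorm K' W hW (EuclideanSpace.basisFun _ ℝ)
  have h2 := sum_inner_le_nuclearNorm (K - K') W hW (EuclideanSpace.basisFun _ ℝ)
  refine le_trans (le_of_eq ?_) (add_le_add h1 h2)
  rw [← Finset.sum_add_distrib]
  refine Finset.sum_congr rfl fun j _ => ?_
  rw [← inner_add_right, ← LinearMap.add_apply, ← map_add, add_sub_cancel]

lemma continuous_nuclearNorm : Continuous (nuclearNorm (p := p)) := by
  rw [continuous_iff_continuousAt]
  intro K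
  have hc : ∀ K' : Matrix (Fin p) (Fin p) ℝ, |nuclearNorm K' - nuclearNorm K| ≤
      ∑ j, ‖Matrix.toEuclideanLin (K' - K) (EuclideanSpace.basisFun _ ℝ j)‖ := by
    intro K'
    have h1 := (nuclearNorm_le_add_sub K' K)
    have h2 := (nuclearNorm_le_add_sub K K')
    have h3 := nuclearNorm_le_sum_norm (K' - K) (EuclideanSpace.basisFun _ ℝ)
    have h4 := nuclearNorm_le_sum_norm (K - K') (EuclideanSpace.basisFun _ ℝ)
    have h5 : ∑ j, ‖Matrix.toEuclideanLin (K - K') (EuclideanSpace.basisFun _ ℝ j)‖ =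
        ∑ j, ‖Matrix.toEuclideanLin (K' - K) (EuclideanSpace.basisFun _ ℝ j)‖ := by
      refine Finset.sum_congr rfl fun j _ => ?_
      rw [← neg_sub, map_neg, LinearMap.neg_apply, norm_neg]
    rw [abs_le]; constructor <;> linarith
  have hcont : Continuous fun K' : Matrix (Fin p) (Fin p) ℝ =>
      ∑ j, ‖Matrix.toEuclideanLin (K' - K) (EuclideanSpace.basisFun _ ℝ j)‖ := by
    refine continuous_finsetSum _ fun j _ => Continuous.norm ?_
    have : Continuous (fun M : Matrix (Fin p) (Fin p) ℝ =>
      Matrix.toEuclideanLin M (EuclideanSpace.basisFun _ ℝ j)) := by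
      simp only [Matrix.toEuclideanLin, Matrix.toLpLin_apply]
      fun_prop
    exact this.comp (continuous_id.sub continuous_const)
  have h0 := hcont.tendsto K
  simp only [sub_self, map_zero, LinearMap.zero_apply, norm_zero, Finset.sum_const_zero] at h0
  rw [ContinuousAt, tendsto_iff_norm_sub_tendsto_zero]
  exact squeeze_zero (fun _ => norm_nonneg _) hc h0

lemma toEuclideanLin_vecMulVec_apply (a b z : EuclideanSpace ℝ (Fin p)) :
    Matrix.toEuclideanLin (Matrix.vecMulVec a b) z = ⟪b, z⟫_ℝ • a := by
  ext i
  simp [Matrix.toEuclideanLin, Matrix.mulVec, Matrix.vecMulVec, dotProduct, PiLp.inner_apply,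
    Finset.sum_mul]
  exact Finset.sum_congr rfl fun j _ => by ring

lemma inner_toEuclideanLin_transpose (K : Matrix (Fin p) (Fin p) ℝ)
    (y z : EuclideanSpace ℝ (Fin p)) :
    ⟪y, Matrix.toEuclideanLin Kᵀ z⟫_ℝ = ⟪Matrix.toEuclideanLin K y, z⟫_ℝ := by
  simp [Matrix.toEuclideanLin, Matrix.mulVec, dotProduct, PiLp.inner_apply,
    Finset.mul_sum, Finset.sum_mul]
  rw [Finset.sum_comm]
  exact Finset.sum_congr rfl fun j _ => Finset.sum_congr rfl fun i _ => by ring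

lemma matInner_vecMulVec_self (x : EuclideanSpace ℝ (Fin p)) (K : Matrix (Fin p) (Fin p) ℝ) :
    matInner (Matrix.vecMulVec x x) K = ⟪x, Matrix.toEuclideanLin K x⟫_ℝ := by
  simp [matInner, Matrix.trace, Matrix.mul_apply, Matrix.vecMulVec, Matrix.toEuclideanLin,
    Matrix.mulVec, dotProduct, PiLp.inner_apply, Finset.sum_mul]
  rw [Finset.sum_comm]
  exact Finset.sum_congr rfl fun j _ => Finset.sum_congr rfl fun i _ => by ring

lemma nuclearNorm_neg_vecMulVec_self_le (β : EuclideanSpace ℝ (Fin p)) :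
    nuclearNorm (-Matrix.vecMulVec β β) ≤ ‖β‖ ^ 2 := by
  obtain ⟨W, hW, h⟩ := exists_contraction_sum_inner_eq_nuclearNorm (-Matrix.vecMulVec β β)
  set b := EuclideanSpace.basisFun (Fin p) ℝ
  have h1 : ∑ j, ⟪W (b j), Matrix.toEuclideanLin (-Matrix.vecMulVec β β) (b j)⟫_ℝ =
      -⟪W β, β⟫_ℝ := by
    conv_rhs => rw [← b.sum_repr' β, map_sum, sum_inner]
    rw [← Finset.sum_neg_distrib]
    refine Finset.sum_congr rfl fun j _ => ?_
    rw [map_neg, LinearMap.neg_apply, toEuclideanLin_vecMulVec_apply, b.sum_repr' β, map_smul,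
      inner_neg_right, inner_smul_left, inner_smul_right, real_inner_comm]
    simp
  rw [← h b, h1]
  have h2 := abs_real_inner_le_norm (W β) β
  have h3 := hW β
  have h4 := neg_abs_le ⟪W β, β⟫_ℝ
  nlinarith [norm_nonneg β]

/-- An entry is the pairing with a rank-one contraction. This makes nuclear-norm balls bounded and
forces `K = 0` when the norm vanishes. -/
lemma abs_apply_le_nuclearNorm (K : Matrix (Fin p) (Fin p) ℝ) (i j : Fin p) :
    |K i j| ≤ nuclearNorm K := by
  classical
  set b := EuclideanSpace.basisFun (Fin p) ℝ with hb
  have key : ∀ s : ℝ, |s| ≤ 1 → s * K i j ≤ nuclearNorm K := by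
    intro s hs
    have h := sum_inner_le_nuclearNorm K ((innerₗ _ (b j)).smulRight (s • b i)) ?_ b
    · rw [Finset.sum_eq_single j] at h
      · have hK : ⟪b i, Matrix.toEuclideanLin K (b j)⟫_ℝ = K i j := by
          simp [hb, Matrix.toEuclideanLin, Matrix.toLpLin_apply, PiLp.inner_apply]
        rw [← hK]
        simpa [inner_smul_left] using h
      · intro k _ hk
        simp [OrthonormalBasis.inner_eq_zero b hk.symm]
      · simp
    · intro z
      have h1 := abs_real_inner_le_norm (b j) z
      simp only [LinearMap.smulRight_apply, innerₗ_apply_apply, norm_smul, Real.norm_eq_abs,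
        OrthonormalBasis.norm_eq_one, mul_one, one_mul] at h1 ⊢
      nlinarith [abs_nonneg s, abs_nonneg ⟪b j, z⟫_ℝ]
  rw [abs_le']
  exact ⟨by simpa using key 1 (by simp), by simpa using key (-1) (by simp)⟩

end NuclearNorm

/-! ### The cone condition at a negative semidefinite rank-one matrix -/

section Cone

variable {p : ℕ}

lemma norm_sq_sub_inner_smul (u z : EuclideanSpace ℝ (Fin p)) (hu : ‖u‖ = 1) :
    ‖z - ⟪u, z⟫_ℝ • u‖ ^ 2 = ‖z‖ ^ 2 - ⟪u, z⟫_ℝ ^ 2 := by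
  rw [norm_sub_sq_real, inner_smul_right, norm_smul, hu, real_inner_comm, Real.norm_eq_abs,
    mul_one, sq_abs]
  ring

/-- Since `c` kills every `v k` that meets `u`, the sum sees only the component of `z` orthogonal to
`u` and stays orthogonal to `u`; Pythagoras then adds the two parts. -/
lemma norm_le_contraction_sub_sum (u : EuclideanSpace ℝ (Fin p)) (hu : ‖u‖ = 1)
    (v : OrthonormalBasis (Fin p) ℝ (EuclideanSpace ℝ (Fin p))) (c : Fin p → ℝ)
    (hc : ∀ k, |c k| ≤ 1) (hcu : ∀ k, c k * ⟪u, v k⟫_ℝ = 0) (z : EuclideanSpace ℝ (Fin p)) :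
    ‖∑ k, (c k * ⟪v k, z⟫_ℝ) • v k - ⟪u, z⟫_ℝ • u‖ ≤ ‖z‖ := by
  have horth : ⟪∑ k, (c k * ⟪v k, z⟫_ℝ) • v k, u⟫_ℝ = 0 := by
    rw [sum_inner]
    refine Finset.sum_eq_zero fun k _ => ?_
    rw [inner_smul_left, real_inner_comm u (v k)]
    simp only [conj_trivial]
    linear_combination ⟪v k, z⟫_ℝ * hcu k
  have h1 : ‖∑ k, (c k * ⟪v k, z⟫_ℝ) • v k‖ ^ 2 ≤ ‖z - ⟪u, z⟫_ℝ • u‖ ^ 2 := by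
    rw [norm_sq_sum_smul_of_orthogonal _ _ fun i j hij => v.inner_eq_zero hij,
      ← v.sum_sq_norm_inner_right (z - _)]
    refine Finset.sum_le_sum fun k _ => ?_
    rw [OrthonormalBasis.norm_eq_one, Real.norm_eq_abs, sq_abs, inner_sub_right, inner_smul_right]
    have h2 : c k * ⟪v k, z⟫_ℝ = c k * (⟪v k, z⟫_ℝ - ⟪u, z⟫_ℝ * ⟪v k, u⟫_ℝ) := by
      rw [real_inner_comm u (v k)]
      linear_combination (⟪u, z⟫_ℝ) * hcu k
    rw [h2, mul_pow, one_pow, mul_one]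
    exact mul_le_of_le_one_left (sq_nonneg _) ((sq_le_one_iff_abs_le_one _).2 (hc k))
  rw [norm_sq_sub_inner_smul u z hu] at h1
  rw [← sq_le_sq₀ (norm_nonneg _) (norm_nonneg _), norm_sub_sq_real, inner_smul_right, horth,
    norm_smul, hu, Real.norm_eq_abs, mul_one, sq_abs]
  linarith

/-- The operator paired with `K` is a subgradient of the nuclear norm at negative multiples of `u
uᵀ`. -/
lemma sum_mul_inner_sub_le_nuclearNorm (K : Matrix (Fin p) (Fin p) ℝ)
    (u : EuclideanSpace ℝ (Fin p)) (hu : ‖u‖ = 1)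
    (v : OrthonormalBasis (Fin p) ℝ (EuclideanSpace ℝ (Fin p))) (c : Fin p → ℝ)
    (hc : ∀ k, |c k| ≤ 1) (hcu : ∀ k, c k * ⟪u, v k⟫_ℝ = 0) :
    ∑ k, c k * ⟪v k, Matrix.toEuclideanLin K (v k)⟫_ℝ - ⟪u, Matrix.toEuclideanLin K u⟫_ℝ ≤
      nuclearNorm K := by
  set W : EuclideanSpace ℝ (Fin p) →ₗ[ℝ] EuclideanSpace ℝ (Fin p) :=
    ∑ k, (innerₗ _ (v k)).smulRight (c k • v k) - (innerₗ _ u).smulRight u with hW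
  have hWz : ∀ z, W z = ∑ k, (c k * ⟪v k, z⟫_ℝ) • v k - ⟪u, z⟫_ℝ • u := by
    intro z
    simp only [hW, LinearMap.sub_apply, LinearMap.sum_apply, LinearMap.smulRight_apply,
      innerₗ_apply_apply, smul_smul, mul_comm]
  have hWv : ∀ j, W (v j) = c j • v j - ⟪u, v j⟫_ℝ • u := by
    intro j
    rw [hWz, Finset.sum_eq_single j]
    · rw [real_inner_self_eq_norm_sq, v.norm_eq_one]; simp
    · intro i _ hij
      simp [OrthonormalBasis.inner_eq_zero v hij]
    · simp
  refine le_trans (le_of_eq ?_) (sum_inner_le_nuclearNorm K W (fun z => by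
    rw [hWz]; exact norm_le_contraction_sub_sum u hu v c hc hcu z) v)
  have h1 : ⟪u, Matrix.toEuclideanLin K u⟫_ℝ =
      ∑ j, ⟪u, v j⟫_ℝ * ⟪u, Matrix.toEuclideanLin K (v j)⟫_ℝ := by
    conv_lhs => rw [← v.sum_repr' u, map_sum, v.sum_repr' u, inner_sum]
    simp only [map_smul, inner_smul_right, real_inner_comm]
  rw [h1, ← Finset.sum_sub_distrib]
  refine Finset.sum_congr rfl fun j _ => ?_
  rw [hWv, inner_sub_left, inner_smul_left, inner_smul_left]
  simp

/-- If the nuclear norm of `K` is at most that of `-B² u uᵀ`, the difference `S` (symmetrized)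
is, up to its action on `u`, a matrix of trace norm at most `uᵀ S u`. -/
lemma exists_cone_decomposition (K : Matrix (Fin p) (Fin p) ℝ)
    (S : EuclideanSpace ℝ (Fin p) →ₗ[ℝ] EuclideanSpace ℝ (Fin p)) (hS : S.IsSymmetric)
    (u : EuclideanSpace ℝ (Fin p)) (hu : ‖u‖ = 1) (B : ℝ)
    (hSK : ∀ z, ⟪z, S z⟫_ℝ = ⟪z, Matrix.toEuclideanLin K z⟫_ℝ + B ^ 2 * ⟪u, z⟫_ℝ ^ 2)
    (hK : nuclearNorm K ≤ B ^ 2) :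
    ∃ (σ : Fin p → ℝ) (v : Fin p → EuclideanSpace ℝ (Fin p)), (∀ k, ‖v k‖ = 1) ∧
      ∑ k, |σ k| ≤ ⟪u, S u⟫_ℝ ∧
      ∀ b c, ⟪b, S c⟫_ℝ = ∑ k, σ k * (⟪b, v k⟫_ℝ * ⟪c, v k⟫_ℝ) + ⟪b, u⟫_ℝ * ⟪c, S u⟫_ℝ +
        ⟪b, S u⟫_ℝ * ⟪c, u⟫_ℝ - ⟪u, S u⟫_ℝ * (⟪b, u⟫_ℝ * ⟪c, u⟫_ℝ) := by
  set P : EuclideanSpace ℝ (Fin p) →ₗ[ℝ] EuclideanSpace ℝ (Fin p) :=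
    LinearMap.id - (innerₗ _ u).smulRight u with hP
  have hPz : ∀ z, P z = z - ⟪u, z⟫_ℝ • u := fun z => by simp [hP]
  have hPsymm : ∀ b c, ⟪P b, c⟫_ℝ = ⟪b, P c⟫_ℝ := by
    intro b c
    rw [hPz, hPz, inner_sub_left, inner_sub_right, inner_smul_left, inner_smul_right,
      real_inner_comm b u]
    simp only [conj_trivial]; ring
  set R := P ∘ₗ S ∘ₗ P with hR
  have hRbc : ∀ b c, ⟪b, R c⟫_ℝ = ⟪P b, S (P c)⟫_ℝ := fun b c => by
    rw [hPsymm]; rfl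
  have hRs : R.IsSymmetric := by
    intro b c
    rw [hRbc, real_inner_comm, hRbc, real_inner_comm, hS]
  have hRu : R u = 0 := by
    have : P u = 0 := by rw [hPz, real_inner_self_eq_norm_sq, hu]; simp
    simp [hR, this]
  have hn : Module.finrank ℝ (EuclideanSpace ℝ (Fin p)) = p := by simp
  set v := hRs.eigenvectorBasis hn with hv
  set σ := hRs.eigenvalues hn with hσ
  have hRv : ∀ k, R (v k) = σ k • v k := fun k => hRs.apply_eigenvectorBasis hn k
  have hexp : ∀ b c, ⟪b, R c⟫_ℝ = ⟪b, S c⟫_ℝ - ⟪b, u⟫_ℝ * ⟪c, S u⟫_ℝ -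
      ⟪b, S u⟫_ℝ * ⟪c, u⟫_ℝ + ⟪u, S u⟫_ℝ * (⟪b, u⟫_ℝ * ⟪c, u⟫_ℝ) := by
    intro b c
    rw [hRbc, hPz, hPz, map_sub, map_smul]
    simp only [inner_sub_left, inner_sub_right, inner_smul_left, inner_smul_right, conj_trivial]
    rw [← hS u c, real_inner_comm b u, real_inner_comm c u, real_inner_comm c (S u)]
    ring
  have hσu : ∀ k, σ k * ⟪u, v k⟫_ℝ = 0 := by
    intro k
    have h := hRs u (v k)
    rw [hRu, hRv, inner_zero_left, inner_smul_right] at h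
    exact h.symm
  -- An eigenvector of `R` for the eigenvalue zero need not be orthogonal to `u`. The convention
  -- that the sign of zero is zero removes exactly those.
  set c : Fin p → ℝ := fun k => SignType.sign (σ k) with hc
  have hcu : ∀ k, c k * ⟪u, v k⟫_ℝ = 0 := by
    intro k
    rcases mul_eq_zero.1 (hσu k) with h | h
    · simp [hc, h]
    · simp [h]
  have hcσ : ∀ k, c k * σ k = |σ k| := fun k => sign_mul_self (σ k)
  have hc1 : ∀ k, |c k| ≤ 1 := by
    intro k
    rcases lt_trichotomy (σ k) 0 with h | h | h <;> simp [hc, h]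
  refine ⟨σ, v, fun k => v.norm_eq_one k, ?_, fun b d => ?_⟩
  -- Duality gives `∑ |σ k| - ⟪u, K u⟫ ≤ B²`, and `⟪u, K u⟫ = ⟪u, S u⟫ - B²`.
  · have hdual := sum_mul_inner_sub_le_nuclearNorm K u hu v c hc1 hcu
    have hval : ∀ k, c k * ⟪v k, Matrix.toEuclideanLin K (v k)⟫_ℝ = |σ k| := by
      intro j
      rw [← hcσ]
      rcases eq_or_ne (c j) 0 with h | h
      · simp [h]
      · have huj : ⟪u, v j⟫_ℝ = 0 := (mul_eq_zero.1 (hcu j)).resolve_left h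
        have h3 := hSK (v j)
        have h4 := hexp (v j) (v j)
        rw [huj] at h3
        rw [hRv, inner_smul_right, real_inner_self_eq_norm_sq, v.norm_eq_one,
          real_inner_comm u (v j), huj] at h4
        congr 1
        linarith
    simp only [hval] at hdual
    have h5 := hSK u
    rw [real_inner_self_eq_norm_sq, hu] at h5
    linarith
  · have h1 : ⟪b, R d⟫_ℝ = ∑ k, σ k * (⟪b, v k⟫_ℝ * ⟪d, v k⟫_ℝ) := by
      conv_lhs => rw [← v.sum_repr' d, map_sum, inner_sum]
      refine Finset.sum_congr rfl fun k _ => ?_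
      rw [map_smul, hRv, inner_smul_right, inner_smul_right, real_inner_comm d]
      ring
    have h2 := hexp b d
    linarith

end Cone

/-! ### Perturbation of the leading eigenpair of a rank-one matrix -/

section Eigen

variable {E : Type*} [NormedAddCommGroup E] [InnerProductSpace ℝ E]

lemma norm_sqrt_smul_sub_le (J : E →ₗ[ℝ] E) (β : E) (hβ : β ≠ 0) {δ : ℝ} (hδ : 0 ≤ δ)
    (hJ : ∀ b c, |⟪b, J c⟫_ℝ - ⟪b, β⟫_ℝ * ⟪β, c⟫_ℝ| ≤ δ * (‖b‖ * ‖c‖)) {lam : ℝ} {v : E}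
    (hv : ‖v‖ = 1) (hJv : J v = lam • v) (hmax : ∀ z, ⟪z, J z⟫_ℝ ≤ lam * ‖z‖ ^ 2)
    (hs : 0 ≤ ⟪β, v⟫_ℝ) : ‖√lam • v - β‖ ≤ 10 * δ / ‖β‖ := by
  have hB : 0 < ‖β‖ := norm_pos_iff.2 hβ
  have hsB : ⟪β, v⟫_ℝ ≤ ‖β‖ := by simpa [hv] using real_inner_le_norm β v
  have hlow : ‖β‖ ^ 2 - δ ≤ lam := by
    have h1 := (abs_le.1 (hJ β β)).1
    have h2 := hmax β
    rw [real_inner_self_eq_norm_sq] at h1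
    have : (‖β‖ ^ 2 - δ) * ‖β‖ ^ 2 ≤ lam * ‖β‖ ^ 2 := by nlinarith
    exact le_of_mul_le_mul_right this (by positivity)
  have hvv : |lam - ⟪β, v⟫_ℝ ^ 2| ≤ δ := by
    have h1 := hJ v v
    rw [hJv, inner_smul_right, real_inner_self_eq_norm_sq, hv, real_inner_comm] at h1
    convert h1 using 2 <;> ring
  rw [abs_le] at hvv
  rw [le_div_iff₀ hB]
  -- If `δ` is comparable to `‖β‖²` the triangle inequality is enough; otherwise `√lam` is at least
  -- `‖β‖ / 2` and may be divided by.
  rcases le_or_gt (‖β‖ ^ 2 / 4) δ with hc | hc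
  · have h1 : ‖√lam • v - β‖ ≤ √lam + ‖β‖ := by
      refine (norm_sub_le _ _).trans ?_
      rw [norm_smul, hv, Real.norm_of_nonneg (Real.sqrt_nonneg _), mul_one]
    have h2 : √lam ^ 2 ≤ 5 * δ := by
      rcases le_or_gt 0 lam with h | h
      · rw [Real.sq_sqrt h]; nlinarith
      · rw [Real.sqrt_eq_zero_of_nonpos h.le]; linarith [sq_nonneg ‖β‖]
    nlinarith [mul_le_mul_of_nonneg_right h1 hB.le, sq_nonneg (√lam - ‖β‖)]
  · have hlam : 3 / 4 * ‖β‖ ^ 2 ≤ lam := by linarith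
    have hlam0 : 0 < lam := lt_of_lt_of_le (by positivity) hlam
    have hr0 : 0 < √lam := Real.sqrt_pos.2 hlam0
    have hr2 : √lam ^ 2 = lam := Real.sq_sqrt hlam0.le
    have hr : ‖β‖ / 2 ≤ √lam := by
      rw [← sq_le_sq₀ (by positivity) hr0.le, hr2]; nlinarith
    -- The form is tested on `lam • v - ⟪β, v⟫ • β` itself, where the error `J v - ⟪β, v⟫ β` pairs
    -- to its own squared norm.
    have hd : ‖lam • v - ⟪β, v⟫_ℝ • β‖ ≤ δ := by
      have h1 := (abs_le.1 (hJ (lam • v - ⟪β, v⟫_ℝ • β) v)).2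
      have h2 : ⟪lam • v - ⟪β, v⟫_ℝ • β, J v⟫_ℝ -
          ⟪lam • v - ⟪β, v⟫_ℝ • β, β⟫_ℝ * ⟪β, v⟫_ℝ = ‖lam • v - ⟪β, v⟫_ℝ • β‖ ^ 2 := by
        rw [← real_inner_self_eq_norm_sq, hJv, inner_sub_right (lam • v - ⟪β, v⟫_ℝ • β),
          inner_smul_right _ β]
        ring
      rw [h2, hv, mul_one] at h1
      rcases (norm_nonneg (lam • v - ⟪β, v⟫_ℝ • β)).eq_or_lt with h | h
      · rw [← h]; exact hδ
      · exact le_of_mul_le_mul_right (by nlinarith) h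
    have hsr : |⟪β, v⟫_ℝ - √lam| * √lam ≤ δ := by
      have h1 : |⟪β, v⟫_ℝ - √lam| * (⟪β, v⟫_ℝ + √lam) ≤ δ := by
        rw [← abs_of_nonneg (by positivity : 0 ≤ ⟪β, v⟫_ℝ + √lam), ← abs_mul, abs_le]
        constructor <;> nlinarith
      nlinarith [abs_nonneg (⟪β, v⟫_ℝ - √lam)]
    have hkey : √lam • (√lam • v - β) =
        (lam • v - ⟪β, v⟫_ℝ • β) + (⟪β, v⟫_ℝ - √lam) • β := by
      rw [smul_sub, smul_smul, ← sq, hr2, sub_smul]; abel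
    have h3 : √lam * ‖√lam • v - β‖ ≤ δ + |⟪β, v⟫_ℝ - √lam| * ‖β‖ := by
      have h4 : ‖√lam • (√lam • v - β)‖ ≤ δ + |⟪β, v⟫_ℝ - √lam| * ‖β‖ := by
        rw [hkey]
        refine (norm_add_le _ _).trans (add_le_add hd ?_)
        rw [norm_smul, Real.norm_eq_abs]
      rwa [norm_smul, Real.norm_of_nonneg hr0.le] at h4
    have h5 : |⟪β, v⟫_ℝ - √lam| * ‖β‖ ≤ 2 * δ := by
      nlinarith [abs_nonneg (⟪β, v⟫_ℝ - √lam)]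
    nlinarith [norm_nonneg (√lam • v - β)]

/-- An eigenvector is determined only up to sign; the minimum over the two outputs absorbs the
ambiguity. -/
lemma min_norm_sqrt_smul_le (J : E →ₗ[ℝ] E) (β : E) (hβ : β ≠ 0) {δ : ℝ} (hδ : 0 ≤ δ)
    (hJ : ∀ b c, |⟪b, J c⟫_ℝ - ⟪b, β⟫_ℝ * ⟪β, c⟫_ℝ| ≤ δ * (‖b‖ * ‖c‖)) {lam : ℝ} {v : E}
    (hv : ‖v‖ = 1) (hJv : J v = lam • v) (hmax : ∀ z, ⟪z, J z⟫_ℝ ≤ lam * ‖z‖ ^ 2) (g : E) :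
    min ‖g + √lam • v - β‖ ‖g - √lam • v - β‖ ≤ ‖g‖ + 10 * δ / ‖β‖ := by
  rcases le_total 0 ⟪β, v⟫_ℝ with h | h
  · refine (min_le_left _ _).trans ?_
    rw [add_sub_assoc]
    exact (norm_add_le _ _).trans
      (add_le_add le_rfl (norm_sqrt_smul_sub_le J β hβ hδ hJ hv hJv hmax h))
  · refine (min_le_right _ _).trans ?_
    have h1 := norm_sqrt_smul_sub_le J β hβ hδ hJ (v := -v) (by rwa [norm_neg])
      (by rw [map_neg, hJv, smul_neg]) hmax (by rw [inner_neg_right]; linarith)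
    have h2 : g - √lam • v - β = g + (√lam • -v - β) := by rw [smul_neg]; abel
    rw [h2]
    exact (norm_add_le _ _).trans (add_le_add le_rfl h1)

lemma inner_apply_le_of_eigenvalues_le [FiniteDimensional ℝ E] {J : E →ₗ[ℝ] E}
    (hJ : J.IsSymmetric) {lam : ℝ} (hlam : ∀ r : ℝ, Module.End.HasEigenvalue J r → r ≤ lam)
    (z : E) : ⟪z, J z⟫_ℝ ≤ lam * ‖z‖ ^ 2 := by
  set v := hJ.eigenvectorBasis rfl
  have h1 : ⟪z, J z⟫_ℝ = ∑ k, hJ.eigenvalues rfl k * ⟪v k, z⟫_ℝ ^ 2 := by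
    conv_lhs => rw [← v.sum_repr' z, map_sum, v.sum_repr' z, inner_sum]
    refine Finset.sum_congr rfl fun k _ => ?_
    rw [map_smul, hJ.apply_eigenvectorBasis, inner_smul_right, inner_smul_right, real_inner_comm z]
    simp only [RCLike.ofReal_real_eq_id, id]
    ring
  rw [h1, ← v.sum_sq_norm_inner_right z, Finset.mul_sum]
  refine Finset.sum_le_sum fun k _ => ?_
  rw [Real.norm_eq_abs, sq_abs]
  exact mul_le_mul_of_nonneg_right (hlam _ (hJ.hasEigenvalue_eigenvalues rfl k)) (sq_nonneg _)

lemma exists_maximal_eigenpair [FiniteDimensional ℝ E] [Nontrivial E] {J : E →ₗ[ℝ] E}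
    (hJ : J.IsSymmetric) : ∃ (lam : ℝ) (v : E), ‖v‖ = 1 ∧ J v = lam • v ∧
      ∀ r : ℝ, Module.End.HasEigenvalue J r → r ≤ lam := by
  have hpos : 0 < Module.finrank ℝ E := Module.finrank_pos
  refine ⟨hJ.eigenvalues rfl ⟨0, hpos⟩, hJ.eigenvectorBasis rfl ⟨0, hpos⟩,
    OrthonormalBasis.norm_eq_one _ _, hJ.apply_eigenvectorBasis rfl _, fun r hr => ?_⟩
  obtain ⟨z, hz⟩ := hr.exists_hasEigenvector
  have hz0 : 0 < ‖z‖ ^ 2 := by have := norm_pos_iff.2 hz.2; positivity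
  set v := hJ.eigenvectorBasis rfl
  have h1 : r * ‖z‖ ^ 2 = ∑ k, hJ.eigenvalues rfl k * ⟪v k, z⟫_ℝ ^ 2 := by
    rw [← real_inner_self_eq_norm_sq, ← inner_smul_right, ← hz.apply_eq_smul]
    conv_lhs => rw [← v.sum_repr' z, map_sum, v.sum_repr' z, inner_sum]
    refine Finset.sum_congr rfl fun k _ => ?_
    rw [map_smul, hJ.apply_eigenvectorBasis, inner_smul_right, inner_smul_right, real_inner_comm z]
    simp only [RCLike.ofReal_real_eq_id, id]
    ring
  refine le_of_mul_le_mul_right ?_ hz0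
  rw [h1, ← v.sum_sq_norm_inner_right z, Finset.mul_sum]
  refine Finset.sum_le_sum fun k _ => ?_
  rw [Real.norm_eq_abs, sq_abs]
  exact mul_le_mul_of_nonneg_right (hJ.eigenvalues_antitone rfl (Nat.zero_le k.1)) (sq_nonneg _)

end Eigen

/-! ### Nets of the unit ball -/

section Net

variable {E : Type*} [NormedAddCommGroup E] [InnerProductSpace ℝ E]

/-- A maximal 1-separated set in the ball of radius 2, halved: the volume bound limits its size, and
a point it misses could be added to it. -/
lemma exists_net [FiniteDimensional ℝ E] : ∃ N : Finset E, N.card ≤ 5 ^ Module.finrank ℝ E ∧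
    (∀ a ∈ N, ‖a‖ ≤ 1) ∧ ∀ v : E, ‖v‖ ≤ 1 → ∃ a ∈ N, ‖v - a‖ ≤ 1 / 2 := by
  classical
  let good : Finset E → Prop := fun s => (∀ c ∈ s, ‖c‖ ≤ 2) ∧ ∀ c ∈ s, ∀ d ∈ s, c ≠ d → 1 ≤ ‖c - d‖
  have hbd : ∀ s, good s → s.card ≤ 5 ^ Module.finrank ℝ E := fun s hs =>
    Besicovitch.card_le_of_separated s hs.1 hs.2
  obtain ⟨k, ⟨s, hs, hsk⟩, hmax⟩ : ∃ k, (∃ s, good s ∧ s.card = k) ∧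
      ∀ k', (∃ s, good s ∧ s.card = k') → k' ≤ k := by
    have hne : {k | ∃ s, good s ∧ s.card = k}.Nonempty := ⟨0, ∅, by simp [good], rfl⟩
    have hb : BddAbove {k | ∃ s, good s ∧ s.card = k} :=
      ⟨5 ^ Module.finrank ℝ E, by rintro _ ⟨s, hs, rfl⟩; exact hbd s hs⟩
    exact ⟨_, Nat.sSup_mem hne hb, fun k' hk' => le_csSup hb hk'⟩
  refine ⟨s.image fun c => (1 / 2 : ℝ) • c, Finset.card_image_le.trans (hbd s hs), ?_, ?_⟩
  · intro a ha
    obtain ⟨c, hc, rfl⟩ := Finset.mem_image.1 ha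
    have := hs.1 c hc
    rw [norm_smul, Real.norm_of_nonneg (by norm_num)]; linarith
  · intro v hv
    by_contra! hcon
    have hfar : ∀ c ∈ s, 1 < ‖(2 : ℝ) • v - c‖ := by
      intro c hc
      have h1 := hcon _ (Finset.mem_image_of_mem _ hc)
      have h2 : (2 : ℝ) • v - c = (2 : ℝ) • (v - (1 / 2 : ℝ) • c) := by
        rw [smul_sub, smul_smul]; norm_num
      rw [h2, norm_smul, Real.norm_of_nonneg (by norm_num)]; linarith
    have hnot : (2 : ℝ) • v ∉ s := fun h => by simpa using (hfar _ h).trans_le' zero_le_one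
    have hgood : good (insert ((2 : ℝ) • v) s) := by
      constructor
      · intro c hc
        rcases Finset.mem_insert.1 hc with rfl | hc
        · rw [norm_smul, Real.norm_of_nonneg (by norm_num)]; linarith
        · exact hs.1 c hc
      · intro c hc d hd hcd
        rcases Finset.mem_insert.1 hc with rfl | hc <;> rcases Finset.mem_insert.1 hd with rfl | hd
        · exact absurd rfl hcd
        · exact (hfar d hd).le
        · rw [norm_sub_rev]; exact (hfar c hc).le
        · exact hs.2 c hc d hd hcd
    have := hmax _ ⟨_, hgood, rfl⟩
    rw [Finset.card_insert_of_notMem hnot] at this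
    omega

lemma exists_mem_net_half_norm_le {N : Finset E}
    (hN : ∀ v : E, ‖v‖ ≤ 1 → ∃ a ∈ N, ‖v - a‖ ≤ 1 / 2) (w : E) :
    ∃ a ∈ N, ‖w‖ / 2 ≤ ⟪a, w⟫_ℝ := by
  rcases eq_or_ne w 0 with rfl | hw
  · obtain ⟨a, ha, -⟩ := hN 0 (by simp)
    exact ⟨a, ha, by simp⟩
  have hw0 : 0 < ‖w‖ := norm_pos_iff.2 hw
  obtain ⟨a, ha, h⟩ := hN (‖w‖⁻¹ • w) (by rw [norm_smul, norm_inv, norm_norm, inv_mul_cancel₀ hw0.ne'])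
  refine ⟨a, ha, ?_⟩
  have h1 := (real_inner_le_norm (‖w‖⁻¹ • w - a) w).trans
    (mul_le_mul_of_nonneg_right h (norm_nonneg _))
  rw [inner_sub_left, inner_smul_left, real_inner_self_eq_norm_sq] at h1
  have h2 : (starRingEnd ℝ) ‖w‖⁻¹ * ‖w‖ ^ 2 = ‖w‖ := by
    simp only [conj_trivial]; field_simp
  rw [h2] at h1
  linarith

lemma abs_le_of_abs_le_on_net [CompleteSpace E] {N : Finset E}
    (hN : ∀ v : E, ‖v‖ ≤ 1 → ∃ a ∈ N, ‖v - a‖ ≤ 1 / 2) (f : E →L[ℝ] ℝ) {δ : ℝ}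
    (hf : ∀ a ∈ N, |f a| ≤ δ) (b : E) : |f b| ≤ 2 * δ * ‖b‖ := by
  set w := (InnerProductSpace.toDual ℝ E).symm f with hw
  have hfw : ∀ z, f z = ⟪w, z⟫_ℝ := fun z => by simp [hw]
  obtain ⟨a, ha, h⟩ := exists_mem_net_half_norm_le hN w
  have h1 := (le_abs_self _).trans (hf a ha)
  rw [hfw, real_inner_comm] at h1
  rw [hfw]
  refine (abs_real_inner_le_norm _ _).trans (mul_le_mul_of_nonneg_right ?_ (norm_nonneg _))
  linarith

/-- A net at distance `1 / 2` loses a factor 2 in each of the two arguments. -/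
lemma abs_bilin_le_of_abs_le_on_net [FiniteDimensional ℝ E] {N : Finset E}
    (hN : ∀ v : E, ‖v‖ ≤ 1 → ∃ a ∈ N, ‖v - a‖ ≤ 1 / 2) (Q : E →ₗ[ℝ] E →ₗ[ℝ] ℝ) {δ : ℝ}
    (hQ : ∀ b ∈ N, ∀ c ∈ N, |Q b c| ≤ δ) (b c : E) : |Q b c| ≤ 4 * δ * (‖b‖ * ‖c‖) := by
  have : CompleteSpace E := FiniteDimensional.complete ℝ E
  have h1 : ∀ b ∈ N, ∀ c, |Q b c| ≤ 2 * δ * ‖c‖ := fun b hb c =>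
    abs_le_of_abs_le_on_net hN (Q b).toContinuousLinearMap (hQ b hb) c
  have h2 := abs_le_of_abs_le_on_net hN (Q.flip c).toContinuousLinearMap
    (fun b hb => h1 b hb c) b
  refine h2.trans (le_of_eq ?_)
  ring

end Net

/-! ### Recovery from dual certificates -/

section Deterministic

variable {n p : ℕ}

/-- The design `x` with signs `s` admits, in every direction `w`, weights bounded by `τ` that
approximately extract the symmetric form `(a uᵀ + u aᵀ) / 2` for some `a` correlated with `w`, and
that are approximately uncorrelated with the signs. -/
structure IsCertified (x : Fin n → EuclideanSpace ℝ (Fin p)) (s : Fin n → ℝ)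
    (u : EuclideanSpace ℝ (Fin p)) (τ : ℝ) : Prop where
  sign : ∀ i, s i ^ 2 = 1
  gram : ∀ h, ∑ i, ⟪x i, h⟫_ℝ ^ 2 ≤ 2 * n * ‖h‖ ^ 2
  certificate : ∀ w, ∃ (a : EuclideanSpace ℝ (Fin p)) (φ : Fin n → ℝ), ‖w‖ / 2 ≤ ⟪a, w⟫_ℝ ∧
    ‖a‖ ≤ 1 ∧ (∀ i, |φ i| ≤ τ) ∧
    (∀ b c, |∑ i, φ i * (⟪x i, b⟫_ℝ * ⟪x i, c⟫_ℝ) -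
      n / 2 * (⟪a, b⟫_ℝ * ⟪u, c⟫_ℝ + ⟪u, b⟫_ℝ * ⟪a, c⟫_ℝ)| ≤ n / 32 * (‖b‖ * ‖c‖)) ∧
    (∀ b c, |∑ i, s i * φ i * (⟪x i, b⟫_ℝ * ⟪x i, c⟫_ℝ)| ≤ n / 32 * (‖b‖ * ‖c‖))

lemma IsCertified.abs_sign {x : Fin n → EuclideanSpace ℝ (Fin p)} {s : Fin n → ℝ}
    {u : EuclideanSpace ℝ (Fin p)} {τ : ℝ} (hx : IsCertified x s u τ) (i : Fin n) :
    |s i| = 1 := by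
  rw [← pow_eq_one_iff_of_nonneg (abs_nonneg _) two_ne_zero, sq_abs, hx.sign]

/-- The conclusion of `exists_cone_decomposition`. -/
def HasConeDecomposition (S : EuclideanSpace ℝ (Fin p) →ₗ[ℝ] EuclideanSpace ℝ (Fin p))
    (u : EuclideanSpace ℝ (Fin p)) : Prop :=
  ∃ (σ : Fin p → ℝ) (v : Fin p → EuclideanSpace ℝ (Fin p)), (∀ k, ‖v k‖ = 1) ∧
    ∑ k, |σ k| ≤ ⟪u, S u⟫_ℝ ∧
    ∀ b c, ⟪b, S c⟫_ℝ = ∑ k, σ k * (⟪b, v k⟫_ℝ * ⟪c, v k⟫_ℝ) + ⟪b, u⟫_ℝ * ⟪c, S u⟫_ℝ +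
      ⟪b, S u⟫_ℝ * ⟪c, u⟫_ℝ - ⟪u, S u⟫_ℝ * (⟪b, u⟫_ℝ * ⟪c, u⟫_ℝ)

/-- With `w = S u` the expression is the pairing of `q` with `S` through its cone decomposition. The
three pieces weigh `‖w‖`, `2 ‖w‖` and `‖w‖`, which is the bound `4 ‖S u‖` on the nuclear norm of
`S`. -/
lemma abs_cone_combination_le {σ : Fin p → ℝ} {v : Fin p → EuclideanSpace ℝ (Fin p)}
    {u w : EuclideanSpace ℝ (Fin p)} (hv : ∀ k, ‖v k‖ = 1) (hu : ‖u‖ = 1)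
    (hσ : ∑ k, |σ k| ≤ ⟪u, w⟫_ℝ) {q : EuclideanSpace ℝ (Fin p) → EuclideanSpace ℝ (Fin p) → ℝ}
    {δ : ℝ} (hδ : 0 ≤ δ) (hq : ∀ b c, |q b c| ≤ δ * (‖b‖ * ‖c‖)) :
    |∑ k, σ k * q (v k) (v k) + 2 * q u w - ⟪u, w⟫_ℝ * q u u| ≤ 4 * δ * ‖w‖ := by
  have huw : ⟪u, w⟫_ℝ ≤ ‖w‖ := by simpa [hu] using real_inner_le_norm u w
  have huw0 : 0 ≤ ⟪u, w⟫_ℝ := (Finset.sum_nonneg fun k _ => abs_nonneg (σ k)).trans hσ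
  have h1 : |∑ k, σ k * q (v k) (v k)| ≤ δ * ‖w‖ := by
    calc |∑ k, σ k * q (v k) (v k)| ≤ ∑ k, |σ k * q (v k) (v k)| := Finset.abs_sum_le_sum_abs _ _
      _ ≤ ∑ k, |σ k| * δ := by
          refine Finset.sum_le_sum fun k _ => ?_
          rw [abs_mul]
          have := hq (v k) (v k)
          rw [hv, one_mul, mul_one] at this
          exact mul_le_mul_of_nonneg_left this (abs_nonneg _)
      _ = (∑ k, |σ k|) * δ := by rw [Finset.sum_mul]
      _ ≤ ‖w‖ * δ := mul_le_mul_of_nonneg_right (hσ.trans huw) hδ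
      _ = δ * ‖w‖ := mul_comm _ _
  have h2 := hq u w
  have h3 := hq u u
  rw [hu, one_mul] at h2
  rw [hu, one_mul, mul_one] at h3
  have h4 : |⟪u, w⟫_ℝ * q u u| ≤ δ * ‖w‖ := by
    rw [abs_mul, abs_of_nonneg huw0, mul_comm]
    exact mul_le_mul h3 huw huw0 hδ
  rw [abs_le] at *
  constructor <;> linarith [h1.1, h1.2, h2.1, h2.2, h4.1, h4.2]

/-- The value `⟪b, S c⟫` is the pairing of `S` with the symmetrised rank-one form of `b` and `c`, so
the operator norm of `S` is also controlled by `S u`. -/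
lemma HasConeDecomposition.abs_inner_le {S : EuclideanSpace ℝ (Fin p) →ₗ[ℝ] EuclideanSpace ℝ (Fin p)}
    {u : EuclideanSpace ℝ (Fin p)} (hS : HasConeDecomposition S u) (hu : ‖u‖ = 1)
    (b c : EuclideanSpace ℝ (Fin p)) : |⟪b, S c⟫_ℝ| ≤ 4 * ‖S u‖ * (‖b‖ * ‖c‖) := by
  obtain ⟨σ, v, hv, hσ, hS⟩ := hS
  have h := abs_cone_combination_le hv hu hσ (δ := ‖b‖ * ‖c‖)
    (q := fun y z => (⟪b, y⟫_ℝ * ⟪c, z⟫_ℝ + ⟪b, z⟫_ℝ * ⟪c, y⟫_ℝ) / 2) (by positivity)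
    (fun y z => by
      have h1 := mul_le_mul (abs_real_inner_le_norm b y) (abs_real_inner_le_norm c z)
        (abs_nonneg _) (by positivity)
      have h2 := mul_le_mul (abs_real_inner_le_norm b z) (abs_real_inner_le_norm c y)
        (abs_nonneg _) (by positivity)
      rw [← abs_mul] at h1 h2
      rw [abs_div, abs_two, div_le_iff₀ two_pos]
      refine (abs_add_le _ _).trans ?_
      linarith)
  rw [hS b c]
  have h3 : ∑ k, σ k * (⟪b, v k⟫_ℝ * ⟪c, v k⟫_ℝ) =
      ∑ k, σ k * ((⟪b, v k⟫_ℝ * ⟪c, v k⟫_ℝ + ⟪b, v k⟫_ℝ * ⟪c, v k⟫_ℝ) / 2) :=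
    Finset.sum_congr rfl fun k _ => by ring
  rw [h3]
  refine le_trans (le_of_eq ?_) (h.trans (le_of_eq (by ring)))
  congr 1
  ring

/-- The weighted Gram matrix is close in operator norm to its target, `S` has small nuclear norm,
and the target pairs with `S` to exactly `n ⟪a, S u⟫`. Taking `a = 0` handles the signed weights. -/
lemma abs_sum_mul_inner_sub_le {S : EuclideanSpace ℝ (Fin p) →ₗ[ℝ] EuclideanSpace ℝ (Fin p)}
    {u : EuclideanSpace ℝ (Fin p)} (hS : HasConeDecomposition S u) (hu : ‖u‖ = 1)
    (x : Fin n → EuclideanSpace ℝ (Fin p)) (a : EuclideanSpace ℝ (Fin p)) (ψ : Fin n → ℝ)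
    {δ : ℝ} (hδ : 0 ≤ δ)
    (h : ∀ b c, |∑ i, ψ i * (⟪x i, b⟫_ℝ * ⟪x i, c⟫_ℝ) -
      n / 2 * (⟪a, b⟫_ℝ * ⟪u, c⟫_ℝ + ⟪u, b⟫_ℝ * ⟪a, c⟫_ℝ)| ≤ δ * (‖b‖ * ‖c‖)) :
    |∑ i, ψ i * ⟪x i, S (x i)⟫_ℝ - n * ⟪a, S u⟫_ℝ| ≤ 4 * δ * ‖S u‖ := by
  obtain ⟨σ, v, hv, hσ, hS⟩ := hS
  refine le_trans (le_of_eq ?_) (abs_cone_combination_le hv hu hσ hδ h)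
  congr 1
  have h1 : ∀ i, ψ i * ⟪x i, S (x i)⟫_ℝ =
      ∑ k, σ k * (ψ i * (⟪x i, v k⟫_ℝ * ⟪x i, v k⟫_ℝ)) +
      2 * (ψ i * (⟪x i, u⟫_ℝ * ⟪x i, S u⟫_ℝ)) -
      ⟪u, S u⟫_ℝ * (ψ i * (⟪x i, u⟫_ℝ * ⟪x i, u⟫_ℝ)) := by
    intro i
    rw [hS (x i) (x i), mul_sub, mul_add, mul_add, Finset.mul_sum]
    have : ∀ k, ψ i * (σ k * (⟪x i, v k⟫_ℝ * ⟪x i, v k⟫_ℝ)) =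
      σ k * (ψ i * (⟪x i, v k⟫_ℝ * ⟪x i, v k⟫_ℝ)) := fun k => by ring
    simp only [this]
    ring
  have h2 : (n : ℝ) * ⟪a, S u⟫_ℝ =
      ∑ k, σ k * (n / 2 * (⟪a, v k⟫_ℝ * ⟪u, v k⟫_ℝ + ⟪u, v k⟫_ℝ * ⟪a, v k⟫_ℝ)) +
      2 * (n / 2 * (⟪a, u⟫_ℝ * ⟪u, S u⟫_ℝ + ⟪u, u⟫_ℝ * ⟪a, S u⟫_ℝ)) -
      ⟪u, S u⟫_ℝ * (n / 2 * (⟪a, u⟫_ℝ * ⟪u, u⟫_ℝ + ⟪u, u⟫_ℝ * ⟪a, u⟫_ℝ)) := by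
    have h3 := hS a u
    have h4 : ∑ k, σ k * (n / 2 * (⟪a, v k⟫_ℝ * ⟪u, v k⟫_ℝ + ⟪u, v k⟫_ℝ * ⟪a, v k⟫_ℝ)) =
        n * ∑ k, σ k * (⟪a, v k⟫_ℝ * ⟪u, v k⟫_ℝ) := by
      rw [Finset.mul_sum]
      exact Finset.sum_congr rfl fun k _ => by ring
    rw [h4]
    have h5 : ⟪u, u⟫_ℝ = 1 := by rw [real_inner_self_eq_norm_sq, hu]; norm_num
    rw [h5] at h3 ⊢
    linear_combination (n : ℝ) * h3
  rw [h2]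
  simp only [h1, mul_sub, Finset.sum_add_distrib, Finset.sum_sub_distrib, ← Finset.mul_sum]
  rw [Finset.sum_comm]
  simp only [← Finset.mul_sum]
  ring

/-- A lower bound for the `ℓ¹` norm of the lifted measurements on the cone. -/
lemma IsCertified.norm_add_norm_le {x : Fin n → EuclideanSpace ℝ (Fin p)} {s : Fin n → ℝ}
    {u : EuclideanSpace ℝ (Fin p)} {τ : ℝ} (hx : IsCertified x s u τ) (hu : ‖u‖ = 1)
    {S : EuclideanSpace ℝ (Fin p) →ₗ[ℝ] EuclideanSpace ℝ (Fin p)}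
    (hS : HasConeDecomposition S u) (h : EuclideanSpace ℝ (Fin p)) :
    n * (‖S u‖ + ‖h‖) ≤
      8 * τ * ∑ i, |-⟪x i, S (x i)⟫_ℝ + 2 * s i * ⟪x i, u⟫_ℝ * ⟪x i, h⟫_ℝ| := by
  set f : Fin n → ℝ := fun i => -⟪x i, S (x i)⟫_ℝ + 2 * s i * ⟪x i, u⟫_ℝ * ⟪x i, h⟫_ℝ with hf
  have hn : (0 : ℝ) ≤ n / 32 := by positivity
  have hs1 := hx.abs_sign
  have hpair : ∀ ψ : Fin n → ℝ, (∀ i, |ψ i| ≤ τ) → |∑ i, ψ i * f i| ≤ τ * ∑ i, |f i| := by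
    intro ψ hψ
    refine (Finset.abs_sum_le_sum_abs _ _).trans ?_
    rw [Finset.mul_sum]
    refine Finset.sum_le_sum fun i _ => ?_
    rw [abs_mul]
    exact mul_le_mul_of_nonneg_right (hψ i) (abs_nonneg _)
  have hw : n * (‖S u‖ / 2) ≤ τ * ∑ i, |f i| + n / 32 * (4 * ‖S u‖ + 2 * ‖h‖) := by
    obtain ⟨a, φ, ha, -, hφ, hc, hsc⟩ := hx.certificate (S u)
    have h1 := (abs_le.1 (abs_sum_mul_inner_sub_le hS hu x a φ hn hc)).1
    have h2 := (abs_le.1 (hpair φ hφ)).1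
    have h3 := (abs_le.1 (hsc u h)).2
    rw [hu, one_mul] at h3
    have h4 : ∑ i, φ i * f i = -∑ i, φ i * ⟪x i, S (x i)⟫_ℝ +
        2 * ∑ i, s i * φ i * (⟪x i, u⟫_ℝ * ⟪x i, h⟫_ℝ) := by
      rw [Finset.mul_sum, ← Finset.sum_neg_distrib, ← Finset.sum_add_distrib]
      exact Finset.sum_congr rfl fun i _ => by simp only [hf]; ring
    have h5 : (n : ℝ) * (‖S u‖ / 2) ≤ n * ⟪a, S u⟫_ℝ :=
      mul_le_mul_of_nonneg_left ha (Nat.cast_nonneg n)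
    linarith
  have hh : n * (‖h‖ / 2) ≤ τ * ∑ i, |f i| + n / 32 * (4 * ‖S u‖ + 2 * ‖h‖) := by
    -- The target form at `(u, h)` is `n / 2` times `⟪a, h + ⟪u, h⟫ u⟫`, so this is the direction to
    -- certify; its norm is at least `‖h‖`.
    obtain ⟨a, φ, ha, -, hφ, hc, hsc⟩ := hx.certificate (h + ⟪u, h⟫_ℝ • u)
    have h1 := (abs_le.1 (abs_sum_mul_inner_sub_le hS hu x 0 (fun i => s i * φ i) hn
      (by simpa using hsc))).2
    have h2 := (abs_le.1 (hpair (fun i => s i * φ i) fun i => by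
      rw [abs_mul, hs1, one_mul]; exact hφ i)).2
    have h3 := (abs_le.1 (hc u h)).1
    rw [hu, one_mul] at h3
    have h4 : ∑ i, s i * φ i * f i = -∑ i, s i * φ i * ⟪x i, S (x i)⟫_ℝ +
        2 * ∑ i, φ i * (⟪x i, u⟫_ℝ * ⟪x i, h⟫_ℝ) := by
      rw [Finset.mul_sum, ← Finset.sum_neg_distrib, ← Finset.sum_add_distrib]
      refine Finset.sum_congr rfl fun i _ => ?_
      simp only [hf]
      linear_combination 2 * φ i * ⟪x i, u⟫_ℝ * ⟪x i, h⟫_ℝ * hx.sign i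
    have h5 : ‖h‖ / 2 ≤ ⟪a, u⟫_ℝ * ⟪u, h⟫_ℝ + ⟪u, u⟫_ℝ * ⟪a, h⟫_ℝ := by
      have h6 : ‖h‖ ≤ ‖h + ⟪u, h⟫_ℝ • u‖ := by
        rw [← sq_le_sq₀ (norm_nonneg _) (norm_nonneg _), norm_add_sq_real, inner_smul_right,
          real_inner_comm u h]
        nlinarith [mul_self_nonneg ⟪u, h⟫_ℝ, sq_nonneg ‖⟪u, h⟫_ℝ • u‖]
      rw [inner_add_right, inner_smul_right] at ha
      rw [real_inner_self_eq_norm_sq, hu]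
      linarith
    have h7 := mul_le_mul_of_nonneg_left h5 (Nat.cast_nonneg (α := ℝ) n)
    simp only [inner_zero_left, mul_zero, sub_zero] at h1
    linarith
  -- Adding `hw` and `hh`, the error terms take at most half of the left-hand side, which leaves the
  -- factor `8 τ`.
  have hnh : 0 ≤ (n : ℝ) * ‖h‖ := by positivity
  change n * (‖S u‖ + ‖h‖) ≤ 8 * τ * ∑ i, |f i|
  linarith

/-! ### The error operator and the noise -/

lemma norm_normalize {β : EuclideanSpace ℝ (Fin p)} (hβ : β ≠ 0) : ‖‖β‖⁻¹ • β‖ = 1 := by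
  rw [norm_smul, norm_inv, norm_norm, inv_mul_cancel₀ (norm_ne_zero_iff.2 hβ)]

/-- The symmetric part of `K + β βᵀ`. -/
noncomputable def errorOp (K : Matrix (Fin p) (Fin p) ℝ) (β : EuclideanSpace ℝ (Fin p)) :
    EuclideanSpace ℝ (Fin p) →ₗ[ℝ] EuclideanSpace ℝ (Fin p) :=
  Matrix.toEuclideanLin ((1 / 2 : ℝ) • (K + Kᵀ) + Matrix.vecMulVec β β)

lemma inner_errorOp (K : Matrix (Fin p) (Fin p) ℝ) (β y z : EuclideanSpace ℝ (Fin p)) :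
    ⟪y, errorOp K β z⟫_ℝ = (⟪y, Matrix.toEuclideanLin K z⟫_ℝ +
      ⟪Matrix.toEuclideanLin K y, z⟫_ℝ) / 2 + ⟪y, β⟫_ℝ * ⟪β, z⟫_ℝ := by
  rw [errorOp, map_add, map_smul, map_add, LinearMap.add_apply, LinearMap.smul_apply,
    LinearMap.add_apply, toEuclideanLin_vecMulVec_apply, inner_add_right, inner_smul_right,
    inner_add_right, inner_toEuclideanLin_transpose, inner_smul_right]
  ring

lemma isSymmetric_errorOp (K : Matrix (Fin p) (Fin p) ℝ) (β : EuclideanSpace ℝ (Fin p)) :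
    (errorOp K β).IsSymmetric := by
  intro y z
  rw [real_inner_comm, inner_errorOp, inner_errorOp, real_inner_comm z, real_inner_comm _ y,
    real_inner_comm y β, real_inner_comm β z]
  ring

lemma inner_errorOp_self (K : Matrix (Fin p) (Fin p) ℝ) (β z : EuclideanSpace ℝ (Fin p)) :
    ⟪z, errorOp K β z⟫_ℝ = ⟪z, Matrix.toEuclideanLin K z⟫_ℝ + ⟪z, β⟫_ℝ ^ 2 := by
  rw [inner_errorOp, real_inner_comm z (Matrix.toEuclideanLin K z), real_inner_comm z β]
  ring

lemma hasConeDecomposition_errorOp (K : Matrix (Fin p) (Fin p) ℝ) {β : EuclideanSpace ℝ (Fin p)}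
    (hβ : β ≠ 0) (hK : nuclearNorm K ≤ ‖β‖ ^ 2) :
    HasConeDecomposition (errorOp K β) (‖β‖⁻¹ • β) := by
  refine exists_cone_decomposition K _ (isSymmetric_errorOp K β) _ (norm_normalize hβ) ‖β‖
    (fun z => ?_) hK
  rw [inner_errorOp_self, inner_smul_left, real_inner_comm β z, mul_pow, ← mul_assoc]
  have : ‖β‖ ≠ 0 := norm_ne_zero_iff.2 hβ
  simp only [conj_trivial]
  field_simp

/-- Exhibits `J` as `β βᵀ` perturbed by `g gᵀ - S`, so `δ = ‖g‖² + 4 ‖S u‖` is admissible in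
`min_norm_sqrt_smul_le`. -/
lemma inner_toEuclideanLin_matJ (K : Matrix (Fin p) (Fin p) ℝ)
    (g β y z : EuclideanSpace ℝ (Fin p)) :
    ⟪y, Matrix.toEuclideanLin (matJ K g) z⟫_ℝ =
      ⟪y, β⟫_ℝ * ⟪β, z⟫_ℝ + ⟪y, g⟫_ℝ * ⟪g, z⟫_ℝ - ⟪y, errorOp K β z⟫_ℝ := by
  have h : matJ K g = Matrix.vecMulVec β β + Matrix.vecMulVec g g -
      ((1 / 2 : ℝ) • (K + Kᵀ) + Matrix.vecMulVec β β) := by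
    rw [matJ]; abel
  rw [h, map_sub, map_add, LinearMap.sub_apply, LinearMap.add_apply,
    toEuclideanLin_vecMulVec_apply, toEuclideanLin_vecMulVec_apply, inner_sub_right,
    inner_add_right, inner_smul_right, inner_smul_right]
  rw [errorOp]
  ring

lemma isSymmetric_matJ (K : Matrix (Fin p) (Fin p) ℝ) (g : EuclideanSpace ℝ (Fin p)) :
    (Matrix.toEuclideanLin (matJ K g)).IsSymmetric := by
  intro y z
  rw [real_inner_comm, inner_toEuclideanLin_matJ K g 0, inner_toEuclideanLin_matJ K g 0,
    ← isSymmetric_errorOp, real_inner_comm y (errorOp K 0 z), real_inner_comm y g,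
    real_inner_comm z g]
  simp only [inner_zero_left, inner_zero_right]
  ring

lemma sum_abs_mul_inner_le {x : Fin n → EuclideanSpace ℝ (Fin p)}
    (hgram : ∀ h, ∑ i, ⟪x i, h⟫_ℝ ^ 2 ≤ 2 * n * ‖h‖ ^ 2) (e : EuclideanSpace ℝ (Fin n))
    (h : EuclideanSpace ℝ (Fin p)) :
    ∑ i, |e i * ⟪x i, h⟫_ℝ| ≤ 2 * (√n * ‖e‖ * ‖h‖) := by
  have h1 := Real.sum_mul_le_sqrt_mul_sqrt Finset.univ (fun i => |e i|) fun i => |⟪x i, h⟫_ℝ|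
  simp only [sq_abs, ← abs_mul] at h1
  refine h1.trans ?_
  have h2 : √(∑ i, e i ^ 2) = ‖e‖ := by
    rw [EuclideanSpace.norm_eq]; simp
  have h3 : √(∑ i, ⟪x i, h⟫_ℝ ^ 2) ≤ 2 * (√n * ‖h‖) := by
    rw [Real.sqrt_le_left (by positivity), mul_pow, mul_pow, Real.sq_sqrt (Nat.cast_nonneg n)]
    refine (hgram h).trans ?_
    nlinarith [mul_nonneg (Nat.cast_nonneg (α := ℝ) n) (sq_nonneg ‖h‖)]
  rw [h2]
  nlinarith [mul_le_mul_of_nonneg_left h3 (norm_nonneg e)]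

/-- The phaseless observations with signs `s`. -/
noncomputable def signedObservation (x : Fin n → EuclideanSpace ℝ (Fin p)) (β : EuclideanSpace ℝ (Fin p))
    (e : EuclideanSpace ℝ (Fin n)) (s : Fin n → ℝ) (i : Fin n) : ℝ :=
  s i * (⟪x i, β⟫_ℝ + e i)

lemma residual_eq {x : Fin n → EuclideanSpace ℝ (Fin p)} {s : Fin n → ℝ} (i : Fin n)
    (hs : s i ^ 2 = 1) (β : EuclideanSpace ℝ (Fin p)) (e : EuclideanSpace ℝ (Fin n))
    (K : Matrix (Fin p) (Fin p) ℝ) (g : EuclideanSpace ℝ (Fin p)) :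
    -matInner (Matrix.vecMulVec (x i) (x i)) K + 2 * signedObservation x β e s i * ⟪x i, g⟫_ℝ -
        signedObservation x β e s i ^ 2 =
      (-⟪x i, errorOp K β (x i)⟫_ℝ + 2 * s i * ⟪x i, β⟫_ℝ * ⟪x i, g⟫_ℝ) +
        2 * s i * (e i * ⟪x i, g⟫_ℝ) - 2 * (e i * ⟪x i, β⟫_ℝ) - e i ^ 2 := by
  rw [matInner_vecMulVec_self, inner_errorOp_self, signedObservation, mul_pow, hs]
  ring

variable {x : Fin n → EuclideanSpace ℝ (Fin p)} {s : Fin n → ℝ} {β : EuclideanSpace ℝ (Fin p)}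
  {e : EuclideanSpace ℝ (Fin n)} {τ η : ℝ}

/-- At the truth only noise remains: the cross term costs `4 √n ‖e‖ ‖β‖` by Cauchy-Schwarz and the
Gram bound, and `‖e‖²` costs one more. This is the origin of the constant 5. -/
lemma IsCertified.isFeasible_true (hx : IsCertified x s (‖β‖⁻¹ • β) τ)
    (he : ‖e‖ ≤ √n * ‖β‖) (hη : 5 * (√n * ‖e‖ * ‖β‖) ≤ η) :
    IsFeasible x (signedObservation x β e s) η (-Matrix.vecMulVec β β) 0 := by
  have hS : errorOp (-Matrix.vecMulVec β β) β = 0 := by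
    have h1 : (1 / 2 : ℝ) • (-Matrix.vecMulVec β β + (-Matrix.vecMulVec β β)ᵀ) +
        Matrix.vecMulVec β β = 0 := by
      ext i j
      simp [Matrix.vecMulVec]
      ring
    rw [errorOp, h1, map_zero]
  have hsum : ∑ i, e i ^ 2 = ‖e‖ ^ 2 := by
    rw [EuclideanSpace.norm_sq_eq]; simp
  have h2 := sum_abs_mul_inner_le hx.gram e β
  have h3 : ‖e‖ ^ 2 ≤ √n * ‖e‖ * ‖β‖ := by nlinarith [norm_nonneg e]
  unfold IsFeasible
  calc _ ≤ ∑ i, (2 * |e i * ⟪x i, β⟫_ℝ| + e i ^ 2) := by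
        refine Finset.sum_le_sum fun i _ => ?_
        rw [residual_eq i (hx.sign i), hS]
        simp only [LinearMap.zero_apply, inner_zero_right]
        rw [abs_le]
        constructor <;> nlinarith [abs_le.1 (le_refl |e i * ⟪x i, β⟫_ℝ|), sq_nonneg (e i)]
    _ ≤ η := by
        rw [Finset.sum_add_distrib, ← Finset.mul_sum, hsum]
        linarith

lemma IsCertified.sum_abs_le (hx : IsCertified x s (‖β‖⁻¹ • β) τ) (he : ‖e‖ ≤ √n * ‖β‖)
    {K : Matrix (Fin p) (Fin p) ℝ} {g : EuclideanSpace ℝ (Fin p)}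
    (hK : IsFeasible x (signedObservation x β e s) η K g) :
    ∑ i, |-⟪x i, errorOp K β (x i)⟫_ℝ + 2 * s i * ⟪x i, β⟫_ℝ * ⟪x i, g⟫_ℝ| ≤
      η + 4 * (√n * ‖e‖ * ‖g‖) + 5 * (√n * ‖e‖ * ‖β‖) := by
  have hsum : ∑ i, e i ^ 2 = ‖e‖ ^ 2 := by
    rw [EuclideanSpace.norm_sq_eq]; simp
  have h2 := sum_abs_mul_inner_le hx.gram e β
  have h2' := sum_abs_mul_inner_le hx.gram e g
  have h3 : ‖e‖ ^ 2 ≤ √n * ‖e‖ * ‖β‖ := by nlinarith [norm_nonneg e]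
  have hs1 := hx.abs_sign
  unfold IsFeasible at hK
  calc _ ≤ ∑ i, (|-matInner (Matrix.vecMulVec (x i) (x i)) K +
        2 * signedObservation x β e s i * ⟪x i, g⟫_ℝ - signedObservation x β e s i ^ 2| +
        2 * |e i * ⟪x i, g⟫_ℝ| + (2 * |e i * ⟪x i, β⟫_ℝ| + e i ^ 2)) := by
        refine Finset.sum_le_sum fun i _ => ?_
        have h4 := residual_eq i (hx.sign i) (x := x) β e K g
        set r := -matInner (Matrix.vecMulVec (x i) (x i)) K +
          2 * signedObservation x β e s i * ⟪x i, g⟫_ℝ - signedObservation x β e s i ^ 2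
        have h5 : -⟪x i, errorOp K β (x i)⟫_ℝ + 2 * s i * ⟪x i, β⟫_ℝ * ⟪x i, g⟫_ℝ =
          r - 2 * (s i * (e i * ⟪x i, g⟫_ℝ)) + (2 * (e i * ⟪x i, β⟫_ℝ) + e i ^ 2) := by
          linarith
        have h6 : |s i * (e i * ⟪x i, g⟫_ℝ)| = |e i * ⟪x i, g⟫_ℝ| := by rw [abs_mul, hs1, one_mul]
        rw [h5, ← h6, abs_le]
        constructor <;> linarith [abs_le.1 (le_refl |r|), sq_nonneg (e i),
          abs_le.1 (le_refl |e i * ⟪x i, β⟫_ℝ|), abs_le.1 (le_refl |s i * (e i * ⟪x i, g⟫_ℝ)|)]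
    _ ≤ _ := by
        rw [Finset.sum_add_distrib, Finset.sum_add_distrib, Finset.sum_add_distrib,
          ← Finset.mul_sum, ← Finset.mul_sum, hsum]
        linarith

/-- The estimation error of every feasible point whose nuclear norm is at most that of the truth. -/
lemma IsCertified.error_le (hx : IsCertified x s (‖β‖⁻¹ • β) τ) (hβ : β ≠ 0) (hn : 0 < n)
    {c : ℝ} (hτ : 0 ≤ τ) (he : ‖e‖ ≤ √n * ‖β‖) (heτ : 64 * τ * ‖e‖ ≤ √n * ‖β‖)
    (hη : η ≤ c * (√n * ‖e‖ * ‖β‖)) {K : Matrix (Fin p) (Fin p) ℝ}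
    {g : EuclideanSpace ℝ (Fin p)} (hK : IsFeasible x (signedObservation x β e s) η K g)
    (hKn : nuclearNorm K ≤ ‖β‖ ^ 2) :
    ‖errorOp K β (‖β‖⁻¹ • β)‖ + ‖β‖ * ‖g‖ ≤ 16 * τ * (c + 5) * (‖β‖ * (‖e‖ / √n)) := by
  have hR : 0 < √(n : ℝ) := Real.sqrt_pos.2 (by exact_mod_cast hn)
  have hR2 : √(n : ℝ) ^ 2 = n := Real.sq_sqrt (Nat.cast_nonneg n)
  have hB : 0 < ‖β‖ := norm_pos_iff.2 hβ
  have h1 := hx.norm_add_norm_le (norm_normalize hβ) (hasConeDecomposition_errorOp K hβ hKn)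
    (‖β‖ • g)
  have h2 : ∀ i, 2 * s i * ⟪x i, ‖β‖⁻¹ • β⟫_ℝ * ⟪x i, ‖β‖ • g⟫_ℝ =
      2 * s i * ⟪x i, β⟫_ℝ * ⟪x i, g⟫_ℝ := by
    intro i
    rw [inner_smul_right, inner_smul_right]
    field_simp
  simp only [h2, norm_smul, norm_norm] at h1
  have h3 := mul_le_mul_of_nonneg_left (hx.sum_abs_le he hK) (by positivity : 0 ≤ 8 * τ)
  set w := ‖errorOp K β (‖β‖⁻¹ • β)‖
  have hw : 0 ≤ w := norm_nonneg _
  -- The noise term linear in `g` is absorbed into the left-hand side; `heτ` makes it at most half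
  -- of `n ‖β‖ ‖g‖`.
  have h4 : 8 * τ * (4 * (√n * ‖e‖ * ‖g‖)) ≤ n * (‖β‖ * ‖g‖) / 2 := by
    have := mul_le_mul_of_nonneg_left heτ (by positivity : 0 ≤ √n * ‖g‖ / 2)
    have hB2 : n * (‖β‖ * ‖g‖) / 2 = √n * ‖g‖ / 2 * (√n * ‖β‖) := by
      linear_combination (-(‖β‖ * ‖g‖) / 2) * hR2
    linarith
  have h5 : 8 * τ * η ≤ 8 * τ * (c * (√n * ‖e‖ * ‖β‖)) :=
    mul_le_mul_of_nonneg_left hη (by positivity)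
  have h6 : n * (w + ‖β‖ * ‖g‖) ≤ 16 * τ * (c + 5) * (√n * ‖e‖ * ‖β‖) := by
    have : 0 ≤ (n : ℝ) * w := by positivity
    nlinarith
  have h7 : 16 * τ * (c + 5) * (√n * ‖e‖ * ‖β‖) =
      n * (16 * τ * (c + 5) * (‖β‖ * (‖e‖ / √n))) := by
    have h8 : n * (‖e‖ / √n) = √n * ‖e‖ := by
      rw [mul_div_assoc', div_eq_iff hR.ne']
      linear_combination -‖e‖ * hR2
    linear_combination -(16 * τ * (c + 5) * ‖β‖) * h8
  rw [h7] at h6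
  exact le_of_mul_le_mul_left h6 (by exact_mod_cast hn)

lemma IsCertified.min_norm_sub_le (hx : IsCertified x s (‖β‖⁻¹ • β) τ) (hβ : β ≠ 0) (hn : 0 < n)
    {c : ℝ} (hc : 0 ≤ c) (hτ : 0 ≤ τ) (he : ‖e‖ ≤ √n * ‖β‖) (heτ : 64 * τ * ‖e‖ ≤ √n * ‖β‖)
    (hη : η ≤ c * (√n * ‖e‖ * ‖β‖)) {K : Matrix (Fin p) (Fin p) ℝ}
    {g : EuclideanSpace ℝ (Fin p)} (hK : IsFeasible x (signedObservation x β e s) η K g)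
    (hKn : nuclearNorm K ≤ ‖β‖ ^ 2) {b₁ b₂ : EuclideanSpace ℝ (Fin p)}
    (hb : IsEigenOutput K g b₁ b₂) :
    min ‖b₁ - β‖ ‖b₂ - β‖ ≤
      (41 * (16 * τ * (c + 5)) + 10 * (16 * τ * (c + 5)) ^ 2) * (‖e‖ / √n) := by
  obtain ⟨lam, v, ⟨hv, hJv, hmax⟩, rfl, rfl⟩ := hb
  have hR : 0 < √(n : ℝ) := Real.sqrt_pos.2 (by exact_mod_cast hn)
  have hB : 0 < ‖β‖ := norm_pos_iff.2 hβ
  have herr := hx.error_le hβ hn hτ he heτ hη hK hKn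
  set C := 16 * τ * (c + 5) with hC
  have hC0 : 0 ≤ C := by positivity
  set q := ‖e‖ / √(n : ℝ) with hq
  have hq0 : 0 ≤ q := by positivity
  have hqB : q ≤ ‖β‖ := by rw [hq, div_le_iff₀ hR]; linarith
  set w := ‖errorOp K β (‖β‖⁻¹ • β)‖ with hw
  have hw0 : 0 ≤ w := norm_nonneg _
  have hg : ‖g‖ ≤ C * q := by
    have : ‖β‖ * ‖g‖ ≤ ‖β‖ * (C * q) := by linarith
    exact le_of_mul_le_mul_left this hB
  have hwC : w ≤ ‖β‖ * (C * q) := by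
    have : 0 ≤ ‖β‖ * ‖g‖ := by positivity
    linarith
  have h1 := min_norm_sqrt_smul_le (Matrix.toEuclideanLin (matJ K g)) β hβ
    (δ := ‖g‖ ^ 2 + 4 * w) (by positivity) (fun b d => by
      have h2 := (hasConeDecomposition_errorOp K hβ hKn).abs_inner_le (norm_normalize hβ) b d
      rw [← hw] at h2
      have h3 := mul_le_mul (abs_real_inner_le_norm b g) (abs_real_inner_le_norm g d)
        (abs_nonneg _) (by positivity)
      rw [← abs_mul] at h3
      rw [inner_toEuclideanLin_matJ K g β]
      rw [abs_le] at *
      constructor <;> linarith [h2.1, h2.2, h3.1, h3.2]) hv hJv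
    (inner_apply_le_of_eigenvalues_le (isSymmetric_matJ K g) hmax) g
  refine h1.trans ?_
  have h4 : 10 * (‖g‖ ^ 2 + 4 * w) / ‖β‖ ≤ 10 * (C ^ 2 + 4 * C) * q := by
    rw [div_le_iff₀ hB]
    have h5 : ‖g‖ ^ 2 ≤ C ^ 2 * (q * ‖β‖) := by
      calc ‖g‖ ^ 2 ≤ (C * q) ^ 2 := by gcongr
        _ = C ^ 2 * (q * q) := by ring
        _ ≤ C ^ 2 * (q * ‖β‖) := by gcongr
    nlinarith
  linarith

/-! ### Existence of optimal solutions -/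

lemma continuous_matInner_right (A : Matrix (Fin p) (Fin p) ℝ) :
    Continuous fun K : Matrix (Fin p) (Fin p) ℝ => matInner A K := by
  unfold matInner
  exact (continuous_const.matrix_mul continuous_id).matrix_trace

/-- The objective does not see `g`, so compactness of a sublevel set needs a separate bound on `g`
there; the error estimate supplies it. -/
lemma exists_isOptimal_of_bounded (x : Fin n → EuclideanSpace ℝ (Fin p)) (y : Fin n → ℝ)
    (η r ρ : ℝ) (hne : ∃ K g, IsFeasible x y η K g ∧ nuclearNorm K ≤ r)
    (hbd : ∀ K g, IsFeasible x y η K g → nuclearNorm K ≤ r → ‖g‖ ≤ ρ) :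
    ∃ K g, IsOptimal x y η K g := by
  let A : Set (Matrix (Fin p) (Fin p) ℝ × EuclideanSpace ℝ (Fin p)) :=
    {q | IsFeasible x y η q.1 q.2 ∧ nuclearNorm q.1 ≤ r}
  have hAc : IsClosed A := by
    have hcl : IsClosed {q : Matrix (Fin p) (Fin p) ℝ × EuclideanSpace ℝ (Fin p) |
        IsFeasible x y η q.1 q.2} := by
      refine isClosed_le ?_ continuous_const
      refine continuous_finsetSum _ fun i _ => Continuous.abs ?_
      exact (((continuous_matInner_right _).comp continuous_fst).neg.add
        (continuous_const.mul (continuous_const.inner continuous_snd))).sub continuous_const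
    exact hcl.inter (isClosed_le (continuous_nuclearNorm.comp continuous_fst) continuous_const)
  have hbox : IsCompact {K : Matrix (Fin p) (Fin p) ℝ | ∀ i j, K i j ∈ Set.Icc (-r) r} := by
    have h := isCompact_univ_pi fun _ : Fin p =>
      isCompact_univ_pi fun _ : Fin p => isCompact_Icc (a := -r) (b := r)
    have heq : {K : Fin p → Fin p → ℝ | ∀ i j, K i j ∈ Set.Icc (-r) r} =
        Set.univ.pi fun _ => Set.univ.pi fun _ => Set.Icc (-r) r := by
      ext K
      exact ⟨fun hK i _ j _ => hK i j, fun hK i j => hK i trivial j trivial⟩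
    rw [← heq] at h
    exact h
  have hA : IsCompact A := by
    refine (hbox.prod (isCompact_closedBall (0 : EuclideanSpace ℝ (Fin p)) ρ)).of_isClosed_subset
      hAc fun q hq => ⟨fun i j => ?_, ?_⟩
    · exact abs_le.1 ((abs_apply_le_nuclearNorm q.1 i j).trans hq.2)
    · rw [mem_closedBall_zero_iff]
      exact hbd _ _ hq.1 hq.2
  obtain ⟨K₀, g₀, h₀⟩ := hne
  obtain ⟨q, hqA, hq⟩ := hA.exists_isMinOn ⟨(K₀, g₀), h₀⟩
    (continuous_nuclearNorm.comp continuous_fst).continuousOn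
  refine ⟨q.1, q.2, hqA.1, fun K' g' h' => ?_⟩
  rcases le_or_gt (nuclearNorm K') r with h | h
  · exact hq (a := (K', g')) ⟨h', h⟩
  · exact hqA.2.trans h.le

lemma exists_isOutput_of_isOptimal [Nonempty (Fin p)] {y : Fin n → ℝ}
    (h : ∃ K g, IsOptimal x y η K g) : ∃ b₁ b₂, IsOutput x y η b₁ b₂ := by
  obtain ⟨K, g, hKg⟩ := h
  obtain ⟨lam, v, hv⟩ := exists_maximal_eigenpair (isSymmetric_matJ K g)
  exact ⟨_, _, K, g, hKg, lam, v, hv, rfl, rfl⟩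

/-- On certified data the program is solvable and every output has small error. -/
theorem IsCertified.output (hx : IsCertified x s (‖β‖⁻¹ • β) τ) (hβ : β ≠ 0) (hn : 0 < n)
    (hp : 0 < p) {c : ℝ} (hc : 0 ≤ c) (hτ : 0 ≤ τ) (he : ‖e‖ ≤ √n * ‖β‖)
    (heτ : 64 * τ * ‖e‖ ≤ √n * ‖β‖) (hη₁ : 5 * (√n * ‖e‖ * ‖β‖) ≤ η)
    (hη₂ : η ≤ c * (√n * ‖e‖ * ‖β‖)) :
    (∃ b₁ b₂, IsOutput x (signedObservation x β e s) η b₁ b₂) ∧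
      ∀ b₁ b₂, IsOutput x (signedObservation x β e s) η b₁ b₂ → min ‖b₁ - β‖ ‖b₂ - β‖ ≤
        (41 * (16 * τ * (c + 5)) + 10 * (16 * τ * (c + 5)) ^ 2) * (‖e‖ / √n) := by
  have : Nonempty (Fin p) := ⟨⟨0, hp⟩⟩
  have hB : 0 < ‖β‖ := norm_pos_iff.2 hβ
  have hfeas := hx.isFeasible_true he hη₁
  have hnuc := nuclearNorm_neg_vecMulVec_self_le β
  constructor
  · refine exists_isOutput_of_isOptimal (exists_isOptimal_of_bounded _ _ _ (‖β‖ ^ 2)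
      (16 * τ * (c + 5) * (‖e‖ / √n)) ⟨_, _, hfeas, hnuc⟩ fun K g hK hKn => ?_)
    have h := hx.error_le hβ hn hτ he heτ hη₂ hK hKn
    have h0 := norm_nonneg (errorOp K β (‖β‖⁻¹ • β))
    refine le_of_mul_le_mul_left (a := ‖β‖) ?_ hB
    linarith
  · rintro b₁ b₂ ⟨K, g, hopt, hb⟩
    exact hx.min_norm_sub_le hβ hn hc hτ he heτ hη₂ hopt.1 ((hopt.2 _ _ hfeas).trans hnuc) hb

/-- The degenerate case of a vanishing regressor and no noise. -/
theorem output_of_zero (hp : 0 < p) :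
    (∃ b₁ b₂, IsOutput x (0 : Fin n → ℝ) 0 b₁ b₂) ∧
      ∀ b₁ b₂, IsOutput x (0 : Fin n → ℝ) 0 b₁ b₂ → min ‖b₁‖ ‖b₂‖ ≤ 0 := by
  have : Nonempty (Fin p) := ⟨⟨0, hp⟩⟩
  have hfeas : IsFeasible x (0 : Fin n → ℝ) 0 0 0 := by
    simp [IsFeasible, matInner]
  constructor
  · refine exists_isOutput_of_isOptimal ⟨0, 0, hfeas, fun K _ _ => ?_⟩
    rw [nuclearNorm_zero]
    exact nuclearNorm_nonneg K
  · rintro b₁ b₂ ⟨K, g, hopt, lam, v, ⟨hv, hJv, hmax⟩, rfl, rfl⟩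
    have hK : K = 0 := by
      have h := hopt.2 _ _ hfeas
      rw [nuclearNorm_zero] at h
      ext i j
      exact abs_eq_zero.1 (le_antisymm ((abs_apply_le_nuclearNorm K i j).trans h) (abs_nonneg _))
    subst hK
    have hJ : ∀ z, Matrix.toEuclideanLin (matJ 0 g) z = ⟪g, z⟫_ℝ • g := by
      intro z
      have : matJ 0 g = Matrix.vecMulVec g g := by simp [matJ]
      rw [this, toEuclideanLin_vecMulVec_apply]
    rcases eq_or_ne g 0 with rfl | hg
    · rw [hJ] at hJv
      have hlam : lam = 0 := by
        have h := congrArg norm hJv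
        rw [smul_zero, norm_zero, norm_smul, hv, mul_one] at h
        exact norm_eq_zero.1 h.symm
      simp [hlam]
    -- With zero data any `g` is feasible, but `J = g gᵀ` exactly, so `√lam v` is `±g` and one of
    -- the two outputs vanishes. This is the perturbation bound with `δ = 0` and `g` in the role of
    -- `β`.
    · have h := min_norm_sqrt_smul_le (Matrix.toEuclideanLin (matJ 0 g)) g hg (δ := 0) le_rfl
        (fun b d => by rw [hJ, inner_smul_right, mul_comm, sub_self, abs_zero, zero_mul]) hv hJv
        (inner_apply_le_of_eigenvalues_le (isSymmetric_matJ 0 g) hmax) 0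
      simp only [zero_add, zero_sub, norm_zero, mul_zero, zero_div] at h
      have h1 : ‖-(√lam • v) - g‖ = ‖g + √lam • v‖ := by rw [← norm_neg]; congr 1; abel
      rw [norm_sub_rev, h1] at h
      rwa [min_comm]

end Deterministic

/-! ### Exponential moments -/

section Exponential

variable {Ω : Type*} [MeasurableSpace Ω] {P : Measure Ω}

lemma integrable_and_integral_le_of_lintegral_le {f : Ω → ℝ} (hf : AEStronglyMeasurable f P)
    (h0 : ∀ ω, 0 ≤ f ω) {L : ℝ} (hL : 0 ≤ L)
    (h : ∫⁻ ω, ENNReal.ofReal (f ω) ∂P ≤ ENNReal.ofReal L) :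
    Integrable f P ∧ ∫ ω, f ω ∂P ≤ L := by
  have hint : Integrable f P := by
    refine ⟨hf, ?_⟩
    rw [hasFiniteIntegral_iff_ofReal (ae_of_all _ h0)]
    exact h.trans_lt ENNReal.ofReal_lt_top
  refine ⟨hint, ?_⟩
  rw [integral_eq_lintegral_of_nonneg_ae (ae_of_all _ h0) hf]
  exact ENNReal.toReal_le_of_le_ofReal hL h

lemma integrable_and_integral_le_of_le {f g : Ω → ℝ} (hf : AEStronglyMeasurable f P)
    (h0 : ∀ ω, 0 ≤ f ω) (hfg : ∀ᵐ ω ∂P, f ω ≤ g ω) (hg : Integrable g P) {L : ℝ}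
    (hL : ∫ ω, g ω ∂P ≤ L) : Integrable f P ∧ ∫ ω, f ω ∂P ≤ L := by
  have hint : Integrable f P := hg.mono' hf (by
    filter_upwards [hfg] with ω h
    rwa [Real.norm_of_nonneg (h0 ω)])
  exact ⟨hint, (integral_mono_ae hint hg hfg).trans hL⟩

lemma exp_le_one_add_add_sq_mul_exp_abs (y : ℝ) :
    Real.exp y ≤ 1 + y + y ^ 2 * Real.exp |y| := by
  have h := Complex.norm_exp_sub_sum_le_norm_mul_exp (y : ℂ) 2
  have h1 : Complex.exp y - ∑ m ∈ Finset.range 2, (y : ℂ) ^ m / (m.factorial : ℂ) =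
      ((Real.exp y - (1 + y) : ℝ) : ℂ) := by
    simp [Finset.sum_range_succ]
  rw [h1, Complex.norm_real, Complex.norm_real, Real.norm_eq_abs, Real.norm_eq_abs, sq_abs] at h
  linarith [le_abs_self (Real.exp y - (1 + y))]

lemma sq_le_two_mul_exp {r : ℝ} (hr : 0 ≤ r) : r ^ 2 ≤ 2 * Real.exp r := by
  have h := Real.pow_div_factorial_le_exp r hr 2
  rw [div_le_iff₀ (by positivity)] at h
  norm_num at h
  linarith

/-- A centered variable with an exponential moment has a Gaussian moment generating function near
the origin. -/
lemma mgf_sub_integral_le [IsProbabilityMeasure P] {W : Ω → ℝ} (hW : AEStronglyMeasurable W P)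
    {α L : ℝ} (hα : 0 < α) (hint : Integrable (fun ω => Real.exp (α * |W ω|)) P)
    (hL : ∫ ω, Real.exp (α * |W ω|) ∂P ≤ L) {θ : ℝ} (hθ : |θ| ≤ α / 2) :
    Integrable (fun ω => Real.exp (θ * (W ω - ∫ ω', W ω' ∂P))) P ∧
      ∫ ω, Real.exp (θ * (W ω - ∫ ω', W ω' ∂P)) ∂P ≤
        Real.exp (θ ^ 2 * (8 / α ^ 2 * Real.exp L * L)) := by
  set M := ∫ ω', W ω' ∂P with hM
  have hWα := integrable_and_integral_le_of_le (P := P) (f := fun ω => α * |W ω|)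
    (hW.norm.const_mul α) (fun ω => by positivity)
    (ae_of_all _ fun ω => by linarith [Real.add_one_le_exp (α * |W ω|)]) hint hL
  have hWint : Integrable W P := by
    have h1 : Integrable (fun ω => α⁻¹ * (α * |W ω|)) P := hWα.1.const_mul _
    refine h1.mono' hW (ae_of_all _ fun ω => ?_)
    rw [inv_mul_cancel_left₀ hα.ne', Real.norm_eq_abs]
  have hML : α * |M| ≤ L := by
    refine le_trans ?_ hWα.2
    rw [integral_const_mul]
    exact mul_le_mul_of_nonneg_left (abs_integral_le_integral_abs) hα.le
  -- The linear term will integrate to zero. Half of the exponential moment pays for the square in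
  -- the remainder, the other half for its exponential factor.
  have hpt : ∀ ω, Real.exp (θ * (W ω - M)) ≤ 1 + θ * (W ω - M) +
      θ ^ 2 * (8 / α ^ 2 * Real.exp L) * Real.exp (α * |W ω|) := by
    intro ω
    have h1 := exp_le_one_add_add_sq_mul_exp_abs (θ * (W ω - M))
    have h2 : (W ω - M) ^ 2 * Real.exp |θ * (W ω - M)| ≤
        8 / α ^ 2 * Real.exp L * Real.exp (α * |W ω|) := by
      have h3 : |θ * (W ω - M)| ≤ α / 2 * |W ω - M| := by
        rw [abs_mul]; exact mul_le_mul_of_nonneg_right hθ (abs_nonneg _)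
      have h4 := sq_le_two_mul_exp (r := α / 2 * |W ω - M|) (by positivity)
      rw [mul_pow, sq_abs] at h4
      have h5 : (W ω - M) ^ 2 ≤ 8 / α ^ 2 * Real.exp (α / 2 * |W ω - M|) := by
        rw [div_mul_eq_mul_div, le_div_iff₀ (by positivity)]
        nlinarith
      calc (W ω - M) ^ 2 * Real.exp |θ * (W ω - M)|
          ≤ 8 / α ^ 2 * Real.exp (α / 2 * |W ω - M|) * Real.exp (α / 2 * |W ω - M|) :=
            mul_le_mul h5 (Real.exp_le_exp.2 h3) (Real.exp_pos _).le (by positivity)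
        _ = 8 / α ^ 2 * Real.exp (α * |W ω - M|) := by
            rw [mul_assoc, ← Real.exp_add]; congr 2; ring
        _ ≤ 8 / α ^ 2 * Real.exp (L + α * |W ω|) := by
            refine mul_le_mul_of_nonneg_left (Real.exp_le_exp.2 ?_) (by positivity)
            have := mul_le_mul_of_nonneg_left (abs_sub (W ω) M) hα.le
            linarith
        _ = 8 / α ^ 2 * Real.exp L * Real.exp (α * |W ω|) := by rw [Real.exp_add]; ring
    have h6 := mul_le_mul_of_nonneg_left h2 (sq_nonneg θ)
    rw [mul_pow] at h1
    linarith
  have hI : Integrable (fun ω => θ * (W ω - M)) P :=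
    (hWint.sub (integrable_const _)).const_mul _
  have hI1 : Integrable (fun ω => 1 + θ * (W ω - M)) P := (integrable_const _).add hI
  have hI2 : Integrable (fun ω => θ ^ 2 * (8 / α ^ 2 * Real.exp L) * Real.exp (α * |W ω|)) P :=
    hint.const_mul _
  have hg : Integrable (fun ω => 1 + θ * (W ω - M) +
      θ ^ 2 * (8 / α ^ 2 * Real.exp L) * Real.exp (α * |W ω|)) P := hI1.add hI2
  refine integrable_and_integral_le_of_le
    (Real.continuous_exp.comp_aestronglyMeasurable ((hW.sub aestronglyMeasurable_const).const_mul θ))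
    (fun ω => (Real.exp_pos _).le) (ae_of_all _ hpt) hg ?_
  rw [integral_add hI1 hI2, integral_add (integrable_const _) hI, integral_const_mul,
    integral_const_mul, integral_sub hWint (integrable_const _)]
  simp only [integral_const, probReal_univ, smul_eq_mul, one_mul, ← hM, sub_self, mul_zero,
    add_zero]
  have h7 : θ ^ 2 * (8 / α ^ 2 * Real.exp L) * ∫ ω, Real.exp (α * |W ω|) ∂P ≤
      θ ^ 2 * (8 / α ^ 2 * Real.exp L * L) := by
    exact (mul_le_mul_of_nonneg_left hL (by positivity)).trans (le_of_eq (by ring))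
  linarith [Real.add_one_le_exp (θ ^ 2 * (8 / α ^ 2 * Real.exp L * L))]

/-- The exponent in the concentration inequality `measure_abs_sum_sub_gt_le`. -/
noncomputable def concentrationRate (α L ε : ℝ) : ℝ :=
  min (α / 2) (ε / (2 * (8 / α ^ 2 * Real.exp L * L))) * ε / 2

lemma concentrationRate_pos {α L ε : ℝ} (hα : 0 < α) (hL : 0 < L) (hε : 0 < ε) :
    0 < concentrationRate α L ε := by
  unfold concentrationRate
  have : 0 < min (α / 2) (ε / (2 * (8 / α ^ 2 * Real.exp L * L))) := by positivity
  positivity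

lemma measure_sum_sub_ge_le [IsProbabilityMeasure P] {n : ℕ} {W : Fin n → Ω → ℝ}
    (hW : ∀ i, Measurable (W i)) (hind : iIndepFun W P) {α L ε : ℝ} (hα : 0 < α) (hL : 0 < L)
    (hε : 0 < ε) (hint : ∀ i, Integrable (fun ω => Real.exp (α * |W i ω|)) P)
    (hle : ∀ i, ∫ ω, Real.exp (α * |W i ω|) ∂P ≤ L) :
    P.real {ω | n * ε ≤ ∑ i, W i ω - ∑ i, ∫ ω', W i ω' ∂P} ≤
      Real.exp (-(concentrationRate α L ε * n)) := by
  set M := 8 / α ^ 2 * Real.exp L * L with hM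
  have hM0 : 0 < M := by positivity
  -- The first bound keeps `θ` where the moment generating function is controlled; the second makes
  -- the quadratic term at most half of the linear gain `θ ε`.
  set θ := min (α / 2) (ε / (2 * M)) with hθ
  have hθ0 : 0 < θ := by positivity
  have hθα : |θ| ≤ α / 2 := by rw [abs_of_pos hθ0]; exact min_le_left _ _
  have hθM : θ * M ≤ ε / 2 := by
    have : θ ≤ ε / (2 * M) := min_le_right _ _
    rw [le_div_iff₀ (by positivity)] at this
    linarith
  set Y : Fin n → Ω → ℝ := fun i ω => W i ω - ∫ ω', W i ω' ∂P with hY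
  have hYm : ∀ i, Measurable (Y i) := fun i => (hW i).sub_const _
  have hYind : iIndepFun Y P :=
    hind.comp (fun i t => t - ∫ ω', W i ω' ∂P) fun _ => measurable_id.sub_const _
  have hmgf : ∀ i, Integrable (fun ω => Real.exp (θ * Y i ω)) P ∧ mgf (Y i) P θ ≤
      Real.exp (θ ^ 2 * M) := fun i =>
    mgf_sub_integral_le (hW i).aestronglyMeasurable hα (hint i) (hle i) hθα
  have hsum : P.real {ω | n * ε ≤ (∑ i, Y i) ω} ≤
      Real.exp (-θ * (n * ε)) * mgf (∑ i, Y i) P θ :=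
    measure_ge_le_exp_mul_mgf _ hθ0.le
      (hYind.integrable_exp_mul_sum hYm fun i _ => (hmgf i).1)
  rw [hYind.mgf_sum hYm] at hsum
  have hset : {ω | n * ε ≤ ∑ i, W i ω - ∑ i, ∫ ω', W i ω' ∂P} = {ω | n * ε ≤ (∑ i, Y i) ω} := by
    ext ω
    simp [hY, Finset.sum_apply]
  rw [hset]
  refine hsum.trans ?_
  calc _ ≤ Real.exp (-θ * (n * ε)) * ∏ _i : Fin n, Real.exp (θ ^ 2 * M) :=
        mul_le_mul_of_nonneg_left
          (Finset.prod_le_prod (fun _ _ => mgf_nonneg) fun i _ => (hmgf i).2) (Real.exp_pos _).le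
    _ = Real.exp (-θ * (n * ε) + n * (θ ^ 2 * M)) := by
        rw [Finset.prod_const, Finset.card_univ, Fintype.card_fin, ← Real.exp_nat_mul,
          ← Real.exp_add]
    _ ≤ _ := by
        rw [Real.exp_le_exp]
        have h1 : concentrationRate α L ε = θ * ε / 2 := rfl
        have h2 := mul_le_mul_of_nonneg_left hθM (by positivity : 0 ≤ (n : ℝ) * θ)
        rw [h1]
        nlinarith

/-- Bernstein's inequality for independent variables with a common exponential moment bound. -/
lemma measure_abs_sum_sub_gt_le [IsProbabilityMeasure P] {n : ℕ} {W : Fin n → Ω → ℝ}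
    (hW : ∀ i, Measurable (W i)) (hind : iIndepFun W P) {α L ε : ℝ} (hα : 0 < α) (hL : 0 < L)
    (hε : 0 < ε) (hint : ∀ i, Integrable (fun ω => Real.exp (α * |W i ω|)) P)
    (hle : ∀ i, ∫ ω, Real.exp (α * |W i ω|) ∂P ≤ L) :
    P.real {ω | n * ε < |∑ i, W i ω - ∑ i, ∫ ω', W i ω' ∂P|} ≤
      2 * Real.exp (-(concentrationRate α L ε * n)) := by
  have h1 := measure_sum_sub_ge_le hW hind hα hL hε hint hle
  have h2 := measure_sum_sub_ge_le (W := fun i ω => -W i ω) (fun i => (hW i).neg)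
    (hind.comp (fun _ t => -t) fun _ => measurable_neg) hα hL hε
    (by simpa using hint) (by simpa using hle)
  have h3 : {ω | n * ε < |∑ i, W i ω - ∑ i, ∫ ω', W i ω' ∂P|} ⊆
      {ω | n * ε ≤ ∑ i, W i ω - ∑ i, ∫ ω', W i ω' ∂P} ∪
        {ω | n * ε ≤ ∑ i, -W i ω - ∑ i, ∫ ω', -W i ω' ∂P} := by
    intro ω hω
    rcases lt_abs.1 (show n * ε < |∑ i, W i ω - ∑ i, ∫ ω', W i ω' ∂P| from hω) with h | h
    · exact Or.inl h.le
    · refine Or.inr ?_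
      change n * ε ≤ ∑ i, -W i ω - ∑ i, ∫ ω', -W i ω' ∂P
      simp only [integral_neg, Finset.sum_neg_distrib]
      linarith
  refine (measureReal_mono h3).trans ((measureReal_union_le _ _).trans ?_)
  linarith

/-- A mean-zero variable with a square-exponential moment is sub-Gaussian. -/
lemma exists_hasSubgaussianMGF (k : ℝ) (hk : 0 < k) : ∃ c : ℝ≥0, 0 < c ∧
    ∀ {Ω : Type*} [MeasurableSpace Ω] (P : Measure Ω) [IsProbabilityMeasure P] (X : Ω → ℝ),
      Measurable X → ∫ ω, X ω ∂P = 0 →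
      ∫⁻ ω, ENNReal.ofReal (Real.exp (X ω ^ 2 / k ^ 2)) ∂P ≤ 2 → HasSubgaussianMGF X c P := by
  set L : ℝ := 2 * Real.exp 1 with hL
  set M : ℝ := 8 / (1 / k) ^ 2 * Real.exp L * L with hM
  have hM0 : 0 < M := by positivity
  refine ⟨(2 * M + 10 * k ^ 2).toNNReal, Real.toNNReal_pos.2 (by positivity),
    fun P _ X hX h0 hexp => ?_⟩
  have hsq := integrable_and_integral_le_of_lintegral_le (P := P) (L := 2)
    (f := fun ω => Real.exp (X ω ^ 2 / k ^ 2))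
    (by fun_prop) (fun ω => (Real.exp_pos _).le) zero_le_two (by simpa using hexp)
  have habs := integrable_and_integral_le_of_le (P := P)
    (f := fun ω => Real.exp (1 / k * |X ω|)) (g := fun ω => Real.exp 1 * Real.exp (X ω ^ 2 / k ^ 2))
    (L := L) (by fun_prop) (fun ω => (Real.exp_pos _).le) (ae_of_all _ fun ω => by
      rw [← Real.exp_add, Real.exp_le_exp, ← sq_abs (X ω), ← div_pow, one_div_mul_eq_div]
      nlinarith [sq_nonneg (|X ω| / k - 1), sq_nonneg (|X ω| / k)])
    (hsq.1.const_mul _) (by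
      rw [integral_const_mul, hL, mul_comm 2]
      exact mul_le_mul_of_nonneg_left hsq.2 (Real.exp_pos _).le)
  have hbig : ∀ θ : ℝ, Integrable (fun ω => Real.exp (θ * X ω)) P ∧
      ∫ ω, Real.exp (θ * X ω) ∂P ≤ Real.exp (θ ^ 2 * k ^ 2) * 2 := by
    intro θ
    refine integrable_and_integral_le_of_le (P := P)
      (g := fun ω => Real.exp (θ ^ 2 * k ^ 2) * Real.exp (X ω ^ 2 / k ^ 2))
      (by fun_prop) (fun ω => (Real.exp_pos _).le) (ae_of_all _ fun ω => ?_)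
      (hsq.1.const_mul _) ?_
    · rw [← Real.exp_add, Real.exp_le_exp, ← div_pow, ← mul_pow]
      have : θ * X ω = (θ * k) * (X ω / k) := by field_simp
      rw [this]
      nlinarith [sq_nonneg (θ * k - X ω / k), sq_nonneg (θ * k), sq_nonneg (X ω / k)]
    · rw [integral_const_mul]
      exact mul_le_mul_of_nonneg_left hsq.2 (Real.exp_pos _).le
  refine ⟨fun θ => (hbig θ).1, fun θ => ?_⟩
  rw [Real.coe_toNNReal _ (by positivity : 0 ≤ 2 * M + 10 * k ^ 2)]
  change ∫ ω, Real.exp (θ * X ω) ∂P ≤ _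
  -- Near zero, centring gives a quadratic exponent. Away from zero the crude bound suffices, since
  -- its prefactor 2 is at most `exp (4 θ² k²)`.
  rcases le_or_gt |θ| (1 / k / 2) with h | h
  · have h1 := (mgf_sub_integral_le hX.aestronglyMeasurable (by positivity) habs.1 habs.2 h).2
    simp only [h0, sub_zero] at h1
    refine h1.trans (Real.exp_le_exp.2 ?_)
    nlinarith [sq_nonneg (θ * k)]
  · refine (hbig θ).2.trans ?_
    have h1 : 1 ≤ 4 * (θ ^ 2 * k ^ 2) := by
      rw [div_lt_iff₀ two_pos, div_lt_iff₀ hk] at h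
      nlinarith [sq_abs θ, abs_nonneg θ, mul_pos (lt_of_le_of_lt (abs_nonneg _) (lt_add_one |θ|)) hk]
    have h2 : (2 : ℝ) ≤ Real.exp (4 * (θ ^ 2 * k ^ 2)) :=
      le_trans (by linarith) (Real.add_one_le_exp _)
    calc _ ≤ Real.exp (θ ^ 2 * k ^ 2) * Real.exp (4 * (θ ^ 2 * k ^ 2)) :=
          mul_le_mul_of_nonneg_left h2 (Real.exp_pos _).le
      _ ≤ _ := by
          rw [← Real.exp_add, Real.exp_le_exp]
          nlinarith [mul_nonneg hM0.le (sq_nonneg θ)]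

lemma lintegral_exp_mul_gaussianReal (t : ℝ) :
    ∫⁻ g, ENNReal.ofReal (Real.exp (t * g)) ∂(gaussianReal 0 1) =
      ENNReal.ofReal (Real.exp (t ^ 2 / 2)) := by
  have h := congrFun (mgf_id_gaussianReal (μ := 0) (v := 1)) t
  simp only [mgf, id, zero_mul, zero_add, NNReal.coe_one, one_mul] at h
  rw [← h, ofReal_integral_eq_lintegral_ofReal (integrable_exp_mul_gaussianReal t)
    (ae_of_all _ fun _ => (Real.exp_pos _).le)]

lemma lintegral_exp_sq_div_four_gaussianReal_le :
    ∫⁻ g, ENNReal.ofReal (Real.exp (g ^ 2 / 4)) ∂(gaussianReal 0 1) ≤ 2 := by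
  rw [gaussianReal_of_var_ne_zero 0 one_ne_zero,
    lintegral_withDensity_eq_lintegral_mul _ (measurable_gaussianPDF 0 1) (by fun_prop)]
  have h1 : ∀ g : ℝ, (gaussianPDF 0 1 * fun g => ENNReal.ofReal (Real.exp (g ^ 2 / 4))) g =
      ENNReal.ofReal ((√(2 * Real.pi))⁻¹ * Real.exp (-(1 / 4) * g ^ 2)) := by
    intro g
    rw [Pi.mul_apply, gaussianPDF, ← ENNReal.ofReal_mul (gaussianPDFReal_nonneg 0 1 g),
      gaussianPDFReal]
    simp only [NNReal.coe_one, mul_one, sub_zero]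
    rw [mul_assoc, ← Real.exp_add]
    congr 3
    ring
  simp only [h1]
  rw [← ofReal_integral_eq_lintegral_ofReal
    ((integrable_exp_neg_mul_sq (by norm_num)).const_mul _) (ae_of_all _ fun _ => by positivity),
    integral_const_mul, integral_gaussian]
  have h2 : √(Real.pi / (1 / 4)) = √2 * √(2 * Real.pi) := by
    rw [← Real.sqrt_mul zero_le_two]; congr 1; ring
  have h3 : 0 < √(2 * Real.pi) := Real.sqrt_pos.2 (by positivity)
  rw [h2, mul_comm, mul_assoc, mul_inv_cancel₀ h3.ne', mul_one]
  refine ENNReal.ofReal_le_of_le_toReal ?_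
  norm_num

/-- Square-exponential moments of sub-Gaussian variables, by averaging over a Gaussian scale. -/
lemma exp_sq_of_hasSubgaussianMGF [IsProbabilityMeasure P] {X : Ω → ℝ} (hX : Measurable X)
    {c : ℝ≥0} (hc : 0 < c) (h : HasSubgaussianMGF X c P) :
    Integrable (fun ω => Real.exp (1 / (4 * c) * X ω ^ 2)) P ∧
      ∫ ω, Real.exp (1 / (4 * c) * X ω ^ 2) ∂P ≤ 2 := by
  have hc' : (0 : ℝ) < c := hc
  refine integrable_and_integral_le_of_lintegral_le (by fun_prop) (fun _ => (Real.exp_pos _).le)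
    zero_le_two ?_
  -- Chosen so that averaging `exp (s X g)` over the Gaussian `g` gives `exp (X² / (4 c))`, while
  -- averaging over `X` first gives at most `exp (g² / 4)`, still Gaussian-integrable.
  set s := √(1 / (2 * (c : ℝ))) with hs
  have hs2 : s ^ 2 = 1 / (2 * c) := Real.sq_sqrt (by positivity)
  calc ∫⁻ ω, ENNReal.ofReal (Real.exp (1 / (4 * c) * X ω ^ 2)) ∂P
      = ∫⁻ ω, ∫⁻ g, ENNReal.ofReal (Real.exp ((s * X ω) * g)) ∂(gaussianReal 0 1) ∂P := by
        refine lintegral_congr fun ω => ?_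
        rw [lintegral_exp_mul_gaussianReal, mul_pow, hs2]
        congr 2; field_simp; ring
    _ = ∫⁻ g, ∫⁻ ω, ENNReal.ofReal (Real.exp ((s * X ω) * g)) ∂P ∂(gaussianReal 0 1) := by
        refine lintegral_lintegral_swap ?_
        have : Measurable fun q : Ω × ℝ => ENNReal.ofReal (Real.exp ((s * X q.1) * q.2)) := by
          fun_prop
        exact this.aemeasurable
    _ ≤ ∫⁻ g, ENNReal.ofReal (Real.exp (g ^ 2 / 4)) ∂(gaussianReal 0 1) := by
        refine lintegral_mono fun g => ?_
        have h1 : ∀ ω, (s * X ω) * g = (s * g) * X ω := fun ω => by ring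
        simp only [h1]
        rw [← ofReal_integral_eq_lintegral_ofReal (h.integrable_exp_mul _)
          (ae_of_all _ fun _ => (Real.exp_pos _).le)]
        refine ENNReal.ofReal_le_ofReal ((h.mgf_le (s * g)).trans (Real.exp_le_exp.2 ?_))
        rw [mul_pow, hs2]
        refine le_of_eq ?_
        field_simp
        ring
    _ ≤ ENNReal.ofReal 2 := by simpa using lintegral_exp_sq_div_four_gaussianReal_le

/-- The infimum need not be attained and `κ` may be zero; enlarging the scale to `κ + 1` avoids both
problems. -/
lemma lintegral_exp_sq_le_two_of_psi2Norm_le {X : Ω → ℝ} {κ : ℝ≥0} (h : psi2Norm X P ≤ κ) :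
    ∫⁻ ω, ENNReal.ofReal (Real.exp (X ω ^ 2 / ((κ : ℝ) + 1) ^ 2)) ∂P ≤ 2 := by
  have h1 : psi2Norm X P < ((κ + 1 : ℝ≥0) : ℝ≥0∞) :=
    h.trans_lt (by exact_mod_cast lt_add_one κ)
  obtain ⟨t, ht⟩ := iInf_lt_iff.1 h1
  obtain ⟨⟨ht0, htX⟩, htκ⟩ := iInf_lt_iff.1 ht
  have htκ' : (t : ℝ) ≤ κ + 1 := by exact_mod_cast htκ.le
  have ht0' : (0 : ℝ) < t := ht0
  refine (lintegral_mono fun ω => ENNReal.ofReal_le_ofReal (Real.exp_le_exp.2 ?_)).trans htX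
  gcongr

end Exponential

/-! ### Moments of linear forms in independent variables -/

section Moments

variable {Ω : Type*} [MeasurableSpace Ω] {P : Measure Ω}

/-- A measurable function all of whose absolute moments are finite. -/
def HasMoments (f : Ω → ℝ) (P : Measure Ω) : Prop :=
  Measurable f ∧ ∀ k : ℕ, Integrable (fun ω => |f ω| ^ k) P

namespace HasMoments

variable {f g : Ω → ℝ}

lemma integrable (hf : HasMoments f P) : Integrable f P := by
  refine (hf.2 1).mono' hf.1.aestronglyMeasurable (ae_of_all _ fun ω => ?_)
  rw [pow_one, Real.norm_eq_abs]

/-- Asking for all moments at once makes the class stable under products, so every polynomial in the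
coordinates is integrable without bookkeeping of exponents. -/
lemma mul (hf : HasMoments f P) (hg : HasMoments g P) : HasMoments (fun ω => f ω * g ω) P := by
  refine ⟨hf.1.mul hg.1, fun k => ?_⟩
  refine ((hf.2 (2 * k)).add (hg.2 (2 * k))).mono'
    (((hf.1.mul hg.1).abs.pow_const k).aestronglyMeasurable) (ae_of_all _ fun ω => ?_)
  rw [Real.norm_of_nonneg (by positivity), abs_mul, mul_pow, Pi.add_apply, pow_mul', pow_mul']
  nlinarith [sq_nonneg (|f ω| ^ k - |g ω| ^ k), sq_nonneg (|f ω| ^ k), sq_nonneg (|g ω| ^ k)]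

lemma add (hf : HasMoments f P) (hg : HasMoments g P) : HasMoments (fun ω => f ω + g ω) P := by
  refine ⟨hf.1.add hg.1, fun k => ?_⟩
  refine (((hf.2 k).add (hg.2 k)).const_mul (2 ^ k)).mono'
    (((hf.1.add hg.1).abs.pow_const k).aestronglyMeasurable) (ae_of_all _ fun ω => ?_)
  rw [Real.norm_of_nonneg (by positivity), Pi.add_apply]
  have h1 : |f ω + g ω| ≤ 2 * max |f ω| |g ω| := by
    linarith [abs_add_le (f ω) (g ω), le_max_left |f ω| |g ω|, le_max_right |f ω| |g ω|]
  calc |f ω + g ω| ^ k ≤ (2 * max |f ω| |g ω|) ^ k := by gcongr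
    _ = 2 ^ k * (max |f ω| |g ω|) ^ k := mul_pow _ _ _
    _ ≤ _ := by
        refine mul_le_mul_of_nonneg_left ?_ (by positivity)
        rcases max_choice |f ω| |g ω| with h | h <;> rw [h]
        · linarith [pow_nonneg (abs_nonneg (g ω)) k]
        · linarith [pow_nonneg (abs_nonneg (f ω)) k]

lemma const [IsFiniteMeasure P] (t : ℝ) : HasMoments (fun _ : Ω => t) P :=
  ⟨measurable_const, fun _ => integrable_const _⟩

lemma const_mul [IsFiniteMeasure P] (hf : HasMoments f P) (t : ℝ) :
    HasMoments (fun ω => t * f ω) P := (const t).mul hf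

lemma sub [IsFiniteMeasure P] (hf : HasMoments f P) (hg : HasMoments g P) :
    HasMoments (fun ω => f ω - g ω) P := by
  simpa [sub_eq_add_neg] using hf.add (hg.const_mul (-1))

lemma pow [IsFiniteMeasure P] (hf : HasMoments f P) (k : ℕ) : HasMoments (fun ω => f ω ^ k) P := by
  induction k with
  | zero => simpa using const (P := P) 1
  | succ k ih => simpa [pow_succ] using ih.mul hf

lemma sum [IsFiniteMeasure P] {ι : Type*} {F : ι → Ω → ℝ} (s : Finset ι)
    (hF : ∀ i ∈ s, HasMoments (F i) P) : HasMoments (fun ω => ∑ i ∈ s, F i ω) P := by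
  classical
  induction s using Finset.induction_on with
  | empty => simpa using const (P := P) 0
  | insert i s hi ih =>
    simp only [Finset.sum_insert hi]
    exact (hF i (Finset.mem_insert_self i s)).add
      (ih fun j hj => hF j (Finset.mem_insert_of_mem hj))

end HasMoments

lemma hasMoments_of_hasSubgaussianMGF {X : Ω → ℝ} (hX : Measurable X) {c : ℝ≥0}
    (h : HasSubgaussianMGF X c P) : HasMoments X P := by
  refine ⟨hX, fun k => ?_⟩
  rcases Nat.eq_zero_or_pos k with rfl | hk
  · simp only [pow_zero]
    simpa using h.integrable_exp_mul 0
  · exact (h.memLp (k : ℝ≥0)).integrable_norm_pow (by exact_mod_cast hk.ne')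

variable {ι : Type*} {ξ : ι → Ω → ℝ} {m : ℝ}

/-- Independent standardized variables with fourth moment `m` and finite moments. -/
structure IsStandardFamily (ξ : ι → Ω → ℝ) (m : ℝ) (P : Measure Ω) : Prop where
  indep : iIndepFun ξ P
  hasMoments : ∀ l, HasMoments (ξ l) P
  mean : ∀ l, ∫ ω, ξ l ω ∂P = 0
  second_moment : ∀ l, ∫ ω, ξ l ω ^ 2 ∂P = 1
  fourth_moment : ∀ l, ∫ ω, ξ l ω ^ 4 ∂P = m

namespace IsStandardFamily

/-- A coordinate outside `s` is independent of everything built from `s`. This drives the inductions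
that compute second and fourth moments. -/
lemma integral_pow_mul (h : IsStandardFamily ξ m P) {s : Finset ι} {l : ι} (hl : l ∉ s) (k : ℕ)
    {g : (s → ℝ) → ℝ} (hg : Measurable g) :
    ∫ ω, ξ l ω ^ k * g (fun i => ξ i ω) ∂P =
      (∫ ω, ξ l ω ^ k ∂P) * ∫ ω, g (fun i => ξ i ω) ∂P := by
  classical
  have hind := h.indep.indepFun_finset {l} s (by simpa using hl) fun i => (h.hasMoments i).1
  have hind2 := hind.comp (φ := fun t => t ⟨l, Finset.mem_singleton_self l⟩ ^ k) (ψ := g)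
    (by fun_prop) hg
  have hm : Measurable fun ω => fun i : s => ξ i ω :=
    measurable_pi_lambda _ fun i => (h.hasMoments i).1
  exact hind2.integral_fun_mul_eq_mul_integral
    (((h.hasMoments l).1.pow_const k).aestronglyMeasurable)
    ((hg.comp hm).aestronglyMeasurable)

variable [IsProbabilityMeasure P]

lemma hasMoments_sum (h : IsStandardFamily ξ m P) (s : Finset ι) (a : ι → ℝ) :
    HasMoments (fun ω => ∑ l ∈ s, a l * ξ l ω) P :=
  HasMoments.sum s fun l _ => (h.hasMoments l).const_mul (a l)

lemma integral_sum (h : IsStandardFamily ξ m P) (s : Finset ι) (a : ι → ℝ) :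
    ∫ ω, ∑ l ∈ s, a l * ξ l ω ∂P = 0 := by
  rw [integral_finsetSum _ fun l _ => ((h.hasMoments l).const_mul (a l)).integrable]
  exact Finset.sum_eq_zero fun l _ => by rw [integral_const_mul, h.mean, mul_zero]

lemma integral_sum_mul_sum (h : IsStandardFamily ξ m P) (s : Finset ι) (a b : ι → ℝ) :
    ∫ ω, (∑ l ∈ s, a l * ξ l ω) * (∑ l ∈ s, b l * ξ l ω) ∂P = ∑ l ∈ s, a l * b l := by
  classical
  induction s using Finset.induction_on with
  | empty => simp
  | insert l s hl ih =>
    have hA := h.hasMoments_sum s a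
    have hB := h.hasMoments_sum s b
    have hl' := h.hasMoments l
    have h1 : ∀ ω, (∑ i ∈ insert l s, a i * ξ i ω) * (∑ i ∈ insert l s, b i * ξ i ω) =
        (∑ i ∈ s, a i * ξ i ω) * (∑ i ∈ s, b i * ξ i ω) +
        ξ l ω ^ 1 * (a l * (∑ i ∈ s, b i * ξ i ω) + b l * ∑ i ∈ s, a i * ξ i ω) +
        a l * b l * ξ l ω ^ 2 := by
      intro ω
      rw [Finset.sum_insert hl, Finset.sum_insert hl]
      ring
    have h2 : ∫ ω, ξ l ω ^ 1 * (a l * (∑ i ∈ s, b i * ξ i ω) + b l * ∑ i ∈ s, a i * ξ i ω) ∂P =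
        0 := by
      have h3 := h.integral_pow_mul hl 1 (g := fun t => a l * (∑ i : s, b i * t i) +
        b l * ∑ i : s, a i * t i) (by fun_prop)
      have hsum : ∀ (f : ι → ℝ) (ω : Ω), ∑ i : s, f i * ξ i ω = ∑ i ∈ s, f i * ξ i ω := fun f ω =>
        Finset.sum_coe_sort s (fun i => f i * ξ i ω)
      simp only [hsum] at h3
      rw [h3]
      simp only [pow_one, h.mean, zero_mul]
    simp only [h1]
    rw [integral_add ((hA.mul hB).add ((hl'.pow 1).mul
        ((hB.const_mul (a l)).add (hA.const_mul (b l))))).integrable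
        ((hl'.pow 2).const_mul (a l * b l)).integrable,
      integral_add (hA.mul hB).integrable ((hl'.pow 1).mul
        ((hB.const_mul (a l)).add (hA.const_mul (b l)))).integrable, h2, ih, integral_const_mul,
      h.second_moment, Finset.sum_insert hl]
    ring

/-- Wick's formula with a diagonal correction by the excess kurtosis. Expand in powers of the new
coordinate: the first power has mean zero, the third multiplies a centred linear form (so the third
moment is irrelevant), the second yields the six cross terms, and the fourth yields `m`. -/
lemma integral_sum_mul_sum_mul_sum_mul_sum (h : IsStandardFamily ξ m P) (s : Finset ι)
    (a b c d : ι → ℝ) :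
    ∫ ω, (∑ l ∈ s, a l * ξ l ω) * (∑ l ∈ s, b l * ξ l ω) *
      ((∑ l ∈ s, c l * ξ l ω) * (∑ l ∈ s, d l * ξ l ω)) ∂P =
      (∑ l ∈ s, a l * b l) * (∑ l ∈ s, c l * d l) + (∑ l ∈ s, a l * c l) * (∑ l ∈ s, b l * d l) +
      (∑ l ∈ s, a l * d l) * (∑ l ∈ s, b l * c l) + (m - 3) * ∑ l ∈ s, a l * b l * (c l * d l) := by
  classical
  induction s using Finset.induction_on with
  | empty => simp
  | insert l s hl ih =>
    have hA := h.hasMoments_sum s a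
    have hB := h.hasMoments_sum s b
    have hC := h.hasMoments_sum s c
    have hD := h.hasMoments_sum s d
    have hl' := h.hasMoments l
    have hsum : ∀ (f : ι → ℝ) (ω : Ω), ∑ i : s, f i * ξ i ω = ∑ i ∈ s, f i * ξ i ω := fun f ω =>
      Finset.sum_coe_sort s (fun i => f i * ξ i ω)
    have hR1 := h.integral_pow_mul hl 1 (g := fun t =>
      a l * ((∑ i : s, b i * t i) * ((∑ i : s, c i * t i) * (∑ i : s, d i * t i))) +
      b l * ((∑ i : s, a i * t i) * ((∑ i : s, c i * t i) * (∑ i : s, d i * t i))) +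
      (c l * ((∑ i : s, a i * t i) * ((∑ i : s, b i * t i) * (∑ i : s, d i * t i))) +
      d l * ((∑ i : s, a i * t i) * ((∑ i : s, b i * t i) * (∑ i : s, c i * t i)))))
      (by fun_prop)
    have hR2 := h.integral_pow_mul hl 2 (g := fun t =>
      a l * b l * ((∑ i : s, c i * t i) * (∑ i : s, d i * t i)) +
      a l * c l * ((∑ i : s, b i * t i) * (∑ i : s, d i * t i)) +
      (a l * d l * ((∑ i : s, b i * t i) * (∑ i : s, c i * t i)) +
      b l * c l * ((∑ i : s, a i * t i) * (∑ i : s, d i * t i))) +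
      (b l * d l * ((∑ i : s, a i * t i) * (∑ i : s, c i * t i)) +
      c l * d l * ((∑ i : s, a i * t i) * (∑ i : s, b i * t i)))) (by fun_prop)
    have hR3 := h.integral_pow_mul hl 3 (g := fun t =>
      a l * b l * c l * (∑ i : s, d i * t i) + a l * b l * d l * (∑ i : s, c i * t i) +
      (a l * c l * d l * (∑ i : s, b i * t i) + b l * c l * d l * (∑ i : s, a i * t i)))
      (by fun_prop)
    simp only [hsum] at hR1 hR2 hR3
    simp only [pow_one, h.mean, zero_mul] at hR1
    rw [h.second_moment, one_mul] at hR2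
    have hI1 := hl'.mul ((((hB.mul (hC.mul hD)).const_mul (a l)).add
      ((hA.mul (hC.mul hD)).const_mul (b l))).add (((hA.mul (hB.mul hD)).const_mul (c l)).add
      ((hA.mul (hB.mul hC)).const_mul (d l))))
    have hQ1 := (((hC.mul hD).const_mul (a l * b l)).add ((hB.mul hD).const_mul (a l * c l)))
    have hQ2 := (((hB.mul hC).const_mul (a l * d l)).add ((hA.mul hD).const_mul (b l * c l)))
    have hQ3 := (((hA.mul hC).const_mul (b l * d l)).add ((hA.mul hB).const_mul (c l * d l)))
    have hI2 := (hl'.pow 2).mul ((hQ1.add hQ2).add hQ3)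
    have hT1 := ((hD.const_mul (a l * b l * c l)).add (hC.const_mul (a l * b l * d l)))
    have hT2 := ((hB.const_mul (a l * c l * d l)).add (hA.const_mul (b l * c l * d l)))
    have hI3 := (hl'.pow 3).mul (hT1.add hT2)
    have hI0 := (hA.mul hB).mul (hC.mul hD)
    have hI4 := (hl'.pow 4).const_mul (a l * b l * (c l * d l))
    rw [integral_add (hQ1.add hQ2).integrable hQ3.integrable,
      integral_add hQ1.integrable hQ2.integrable,
      integral_add ((hC.mul hD).const_mul (a l * b l)).integrable
        ((hB.mul hD).const_mul (a l * c l)).integrable,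
      integral_add ((hB.mul hC).const_mul (a l * d l)).integrable
        ((hA.mul hD).const_mul (b l * c l)).integrable,
      integral_add ((hA.mul hC).const_mul (b l * d l)).integrable
        ((hA.mul hB).const_mul (c l * d l)).integrable] at hR2
    simp only [integral_const_mul, h.integral_sum_mul_sum] at hR2
    rw [integral_add hT1.integrable hT2.integrable,
      integral_add (hD.const_mul (a l * b l * c l)).integrable
        (hC.const_mul (a l * b l * d l)).integrable,
      integral_add (hB.const_mul (a l * c l * d l)).integrable
        (hA.const_mul (b l * c l * d l)).integrable] at hR3
    simp only [integral_const_mul, h.integral_sum, mul_zero, add_zero] at hR3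
    have hexp : ∀ ω, (∑ i ∈ insert l s, a i * ξ i ω) * (∑ i ∈ insert l s, b i * ξ i ω) *
        ((∑ i ∈ insert l s, c i * ξ i ω) * (∑ i ∈ insert l s, d i * ξ i ω)) =
        (∑ i ∈ s, a i * ξ i ω) * (∑ i ∈ s, b i * ξ i ω) *
          ((∑ i ∈ s, c i * ξ i ω) * (∑ i ∈ s, d i * ξ i ω)) +
        ξ l ω * (a l * ((∑ i ∈ s, b i * ξ i ω) *
            ((∑ i ∈ s, c i * ξ i ω) * (∑ i ∈ s, d i * ξ i ω))) +
          b l * ((∑ i ∈ s, a i * ξ i ω) * ((∑ i ∈ s, c i * ξ i ω) * (∑ i ∈ s, d i * ξ i ω))) +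
          (c l * ((∑ i ∈ s, a i * ξ i ω) * ((∑ i ∈ s, b i * ξ i ω) * (∑ i ∈ s, d i * ξ i ω))) +
          d l * ((∑ i ∈ s, a i * ξ i ω) *
            ((∑ i ∈ s, b i * ξ i ω) * (∑ i ∈ s, c i * ξ i ω))))) +
        ξ l ω ^ 2 * (a l * b l * ((∑ i ∈ s, c i * ξ i ω) * (∑ i ∈ s, d i * ξ i ω)) +
          a l * c l * ((∑ i ∈ s, b i * ξ i ω) * (∑ i ∈ s, d i * ξ i ω)) +
          (a l * d l * ((∑ i ∈ s, b i * ξ i ω) * (∑ i ∈ s, c i * ξ i ω)) +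
          b l * c l * ((∑ i ∈ s, a i * ξ i ω) * (∑ i ∈ s, d i * ξ i ω))) +
          (b l * d l * ((∑ i ∈ s, a i * ξ i ω) * (∑ i ∈ s, c i * ξ i ω)) +
          c l * d l * ((∑ i ∈ s, a i * ξ i ω) * (∑ i ∈ s, b i * ξ i ω)))) +
        ξ l ω ^ 3 * (a l * b l * c l * (∑ i ∈ s, d i * ξ i ω) +
          a l * b l * d l * (∑ i ∈ s, c i * ξ i ω) +
          (a l * c l * d l * (∑ i ∈ s, b i * ξ i ω) + b l * c l * d l * (∑ i ∈ s, a i * ξ i ω))) +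
        a l * b l * (c l * d l) * ξ l ω ^ 4 := by
      intro ω
      simp only [Finset.sum_insert hl]
      ring
    simp only [hexp]
    rw [integral_add (((hI0.add hI1).add hI2).add hI3).integrable hI4.integrable,
      integral_add ((hI0.add hI1).add hI2).integrable hI3.integrable,
      integral_add (hI0.add hI1).integrable hI2.integrable,
      integral_add hI0.integrable hI1.integrable, ih, hR1, hR2, hR3, integral_const_mul,
      h.fourth_moment]
    simp only [Finset.sum_insert hl]
    ring

end IsStandardFamily

end Moments

/-! ### The certificate weights -/

section Certificate

variable {Ω : Type*} [MeasurableSpace Ω] {P : Measure Ω} {p : ℕ} {m : ℝ} {c : ℝ≥0}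
  {X : Ω → EuclideanSpace ℝ (Fin p)}

/-- A random vector with independent standardized sub-Gaussian coordinates. -/
structure IsSubGaussianRow (X : Ω → EuclideanSpace ℝ (Fin p)) (c : ℝ≥0) (m : ℝ)
    (P : Measure Ω) : Prop where
  measurable : Measurable X
  standard : IsStandardFamily (fun l ω => X ω l) m P
  subGaussian : ∀ l, HasSubgaussianMGF (fun ω => X ω l) c P

lemma inner_eq_sum (b x : EuclideanSpace ℝ (Fin p)) : ⟪b, x⟫_ℝ = ∑ l, b l * x l := by
  simp [PiLp.inner_apply, mul_comm]

lemma sum_sq_le_one {b : EuclideanSpace ℝ (Fin p)} (hb : ‖b‖ ≤ 1) : ∑ l, b l ^ 2 ≤ 1 := by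
  have h : ‖b‖ ^ 2 = ∑ l, b l ^ 2 := by rw [EuclideanSpace.norm_sq_eq]; simp
  rw [← h]
  exact pow_le_one₀ (norm_nonneg _) hb

lemma sum_abs_mul_le_one {a b : EuclideanSpace ℝ (Fin p)} (ha : ‖a‖ ≤ 1) (hb : ‖b‖ ≤ 1) :
    ∑ l, |a l * b l| ≤ 1 := by
  have h1 := sum_sq_le_one ha
  have h2 := sum_sq_le_one hb
  calc ∑ l, |a l * b l| ≤ ∑ l, (a l ^ 2 + b l ^ 2) / 2 := by
        refine Finset.sum_le_sum fun l _ => ?_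
        rw [abs_le]
        constructor <;> nlinarith [sq_nonneg (a l + b l), sq_nonneg (a l - b l)]
    _ = (∑ l, a l ^ 2 + ∑ l, b l ^ 2) / 2 := by
        rw [← Finset.sum_add_distrib, Finset.sum_div]
    _ ≤ 1 := by linarith

namespace IsSubGaussianRow

/-- Variance proxies of independent summands add with weights `b l ^ 2`, so the constant `c` does
not grow with the dimension. -/
lemma hasSubgaussianMGF_inner (h : IsSubGaussianRow X c m P) {b : EuclideanSpace ℝ (Fin p)}
    (hb : ‖b‖ ≤ 1) : HasSubgaussianMGF (fun ω => ⟪b, X ω⟫_ℝ) c P := by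
  have h1 := HasSubgaussianMGF.sum_of_iIndepFun (s := Finset.univ)
    (h.standard.indep.comp (fun l t => b l * t) fun l => measurable_id.const_mul _)
    fun l _ => (h.subGaussian l).const_mul (b l)
  refine ⟨fun t => ?_, fun t => ?_⟩
  · simp only [inner_eq_sum]
    exact h1.integrable_exp_mul t
  · simp only [inner_eq_sum]
    refine (h1.mgf_le t).trans (Real.exp_le_exp.2 ?_)
    have h0 : ((∑ l, (⟨b l ^ 2, sq_nonneg _⟩ * c : ℝ≥0) : ℝ≥0) : ℝ) = (∑ l, b l ^ 2) * c := by
      rw [NNReal.coe_sum, Finset.sum_mul]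
      rfl
    refine (le_of_eq (congrArg (fun r => r * t ^ 2 / 2) h0)).trans ?_
    have h2 := sum_sq_le_one hb
    have h3 : 0 ≤ (c : ℝ) * t ^ 2 := by positivity
    nlinarith

lemma measurable_inner (h : IsSubGaussianRow X c m P) (b : EuclideanSpace ℝ (Fin p)) :
    Measurable fun ω => ⟪b, X ω⟫_ℝ :=
  (continuous_const.inner continuous_id).measurable.comp h.measurable

lemma hasMoments_apply (h : IsSubGaussianRow X c m P) (l : Fin p) :
    HasMoments (fun ω => X ω l) P := h.standard.hasMoments l

variable [IsProbabilityMeasure P]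

lemma hasMoments_inner (h : IsSubGaussianRow X c m P) (b : EuclideanSpace ℝ (Fin p)) :
    HasMoments (fun ω => ⟪b, X ω⟫_ℝ) P := by
  simp only [inner_eq_sum]
  exact h.standard.hasMoments_sum Finset.univ b

lemma exp_inner_sq (h : IsSubGaussianRow X c m P) (hc : 0 < c) {b : EuclideanSpace ℝ (Fin p)}
    (hb : ‖b‖ ≤ 1) : Integrable (fun ω => Real.exp (1 / (4 * c) * ⟪b, X ω⟫_ℝ ^ 2)) P ∧
      ∫ ω, Real.exp (1 / (4 * c) * ⟪b, X ω⟫_ℝ ^ 2) ∂P ≤ 2 :=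
  exp_sq_of_hasSubgaussianMGF (h.measurable_inner b) hc (h.hasSubgaussianMGF_inner hb)

lemma integral_inner_pow_six_le (h : IsSubGaussianRow X c m P) (hc : 0 < c)
    {b : EuclideanSpace ℝ (Fin p)} (hb : ‖b‖ ≤ 1) :
    ∫ ω, ⟪b, X ω⟫_ℝ ^ 6 ∂P ≤ 768 * (c : ℝ) ^ 3 := by
  have hc' : (0 : ℝ) < c := hc
  have h1 := h.exp_inner_sq hc hb
  have h2 : ∀ ω, ⟪b, X ω⟫_ℝ ^ 6 ≤
      384 * (c : ℝ) ^ 3 * Real.exp (1 / (4 * c) * ⟪b, X ω⟫_ℝ ^ 2) := by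
    intro ω
    -- The bound `t³ / 6 ≤ exp t` at `t = ⟪b, X⟫² / (4 c)` gives the factor `6 · 64 = 384`.
    have h3 := Real.pow_div_factorial_le_exp (1 / (4 * c) * ⟪b, X ω⟫_ℝ ^ 2) (by positivity) 3
    rw [div_le_iff₀ (by positivity), mul_pow, ← pow_mul, one_div, inv_pow,
      inv_mul_le_iff₀ (by positivity)] at h3
    norm_num [Nat.factorial] at h3 ⊢
    refine h3.trans (le_of_eq ?_)
    ring
  have h4 := integral_mono ((h.hasMoments_inner b).pow 6).integrable (h1.1.const_mul _) h2
  rw [integral_const_mul] at h4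
  nlinarith [pow_pos hc' 3]

lemma integral_inner_mul_inner (h : IsSubGaussianRow X c m P) (a b : EuclideanSpace ℝ (Fin p)) :
    ∫ ω, ⟪a, X ω⟫_ℝ * ⟪b, X ω⟫_ℝ ∂P = ⟪a, b⟫_ℝ := by
  simp only [inner_eq_sum]
  exact h.standard.integral_sum_mul_sum Finset.univ a b

lemma integral_inner_mul_four (h : IsSubGaussianRow X c m P)
    (a b d f : EuclideanSpace ℝ (Fin p)) :
    ∫ ω, ⟪a, X ω⟫_ℝ * ⟪b, X ω⟫_ℝ * (⟪d, X ω⟫_ℝ * ⟪f, X ω⟫_ℝ) ∂P =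
      ⟪a, b⟫_ℝ * ⟪d, f⟫_ℝ + ⟪a, d⟫_ℝ * ⟪b, f⟫_ℝ + ⟪a, f⟫_ℝ * ⟪b, d⟫_ℝ +
        (m - 3) * ∑ l, a l * b l * (d l * f l) := by
  simp only [inner_eq_sum]
  exact h.standard.integral_sum_mul_sum_mul_sum_mul_sum Finset.univ a b d f

end IsSubGaussianRow

/-- The weight whose second-moment matrix against `x xᵀ` is the symmetric part of `a uᵀ`. -/
noncomputable def certWeight (m : ℝ) (a u x : EuclideanSpace ℝ (Fin p)) : ℝ :=
  1 / 2 * (⟪a, x⟫_ℝ * ⟪u, x⟫_ℝ - ⟪a, u⟫_ℝ) +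
    (1 / (m - 1) - 1 / 2) * ∑ l, a l * u l * (x l ^ 2 - 1)

lemma measurable_certWeight (m : ℝ) (a u : EuclideanSpace ℝ (Fin p)) :
    Measurable (certWeight m a u) := by
  unfold certWeight
  exact Continuous.measurable (by fun_prop)

/-- The weight clipped to `[-τ, τ]`. -/
noncomputable def clippedWeight (m τ : ℝ) (a u x : EuclideanSpace ℝ (Fin p)) : ℝ :=
  max (-τ) (min τ (certWeight m a u x))

lemma measurable_clippedWeight (m τ : ℝ) (a u : EuclideanSpace ℝ (Fin p)) :
    Measurable (clippedWeight m τ a u) :=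
  measurable_const.max (measurable_const.min (measurable_certWeight m a u))

lemma abs_clippedWeight_le {m τ : ℝ} (hτ : 0 ≤ τ) (a u x : EuclideanSpace ℝ (Fin p)) :
    |clippedWeight m τ a u x| ≤ τ := by
  unfold clippedWeight
  rw [abs_le]
  exact ⟨le_max_left _ _, max_le (by linarith) (min_le_left _ _)⟩

/-- The weight changes only where it exceeds `τ` in absolute value, and there it is at most its
square over `τ`. A second moment thus controls the bias. -/
lemma abs_clippedWeight_sub_le {m τ : ℝ} (hτ : 0 < τ) (a u x : EuclideanSpace ℝ (Fin p)) :
    |clippedWeight m τ a u x - certWeight m a u x| ≤ certWeight m a u x ^ 2 / τ := by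
  unfold clippedWeight
  set t := certWeight m a u x
  rw [le_div_iff₀ hτ]
  rcases le_or_gt t τ with h | h
  · rw [min_eq_right h]
    rcases le_or_gt (-τ) t with h' | h'
    · rw [max_eq_right h', sub_self, abs_zero, zero_mul]; positivity
    · rw [max_eq_left h'.le, abs_of_pos (by linarith)]; nlinarith
  · rw [min_eq_left h.le, max_eq_right (by linarith), abs_of_neg (by linarith)]; nlinarith

/-- The diagonal sum has weights `|a l * u l|` of total mass at most one, so Cauchy-Schwarz bounds
its square by a weighted average and no factor of `p` appears. -/
lemma certWeight_sq_le (m : ℝ) {a u : EuclideanSpace ℝ (Fin p)} (ha : ‖a‖ ≤ 1) (hu : ‖u‖ ≤ 1)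
    (x : EuclideanSpace ℝ (Fin p)) :
    certWeight m a u x ^ 2 ≤ 1 / 2 * ⟪a, x⟫_ℝ ^ 4 + 1 / 2 * ⟪u, x⟫_ℝ ^ 4 +
      4 * (1 / (m - 1) - 1 / 2) ^ 2 * ∑ l, |a l * u l| * x l ^ 4 +
        (1 + 4 * (1 / (m - 1) - 1 / 2) ^ 2) := by
  unfold certWeight
  set ρ := 1 / (m - 1) - 1 / 2
  have hau : ⟪a, u⟫_ℝ ^ 2 ≤ 1 := by
    rw [sq_le_one_iff_abs_le_one]
    exact (abs_real_inner_le_norm a u).trans (mul_le_one₀ ha (norm_nonneg _) hu)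
  have hw := sum_abs_mul_le_one ha hu
  have hcs : (∑ l, a l * u l * (x l ^ 2 - 1)) ^ 2 ≤ ∑ l, |a l * u l| * (x l ^ 2 - 1) ^ 2 := by
    have h1 := Finset.sum_mul_sq_le_sq_mul_sq Finset.univ (fun l => √|a l * u l|)
      (fun l => √|a l * u l| * |x l ^ 2 - 1|)
    have h2 : ∀ l, √|a l * u l| * (√|a l * u l| * |x l ^ 2 - 1|) =
        |a l * u l * (x l ^ 2 - 1)| := fun l => by
      rw [← mul_assoc, Real.mul_self_sqrt (abs_nonneg _), ← abs_mul]
    simp only [h2, mul_pow, Real.sq_sqrt (abs_nonneg _), sq_abs] at h1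
    have h3 : (∑ l, a l * u l * (x l ^ 2 - 1)) ^ 2 ≤ (∑ l, |a l * u l * (x l ^ 2 - 1)|) ^ 2 := by
      rw [← sq_abs]
      exact pow_le_pow_left₀ (abs_nonneg _) (Finset.abs_sum_le_sum_abs _ _) 2
    refine h3.trans (h1.trans (mul_le_of_le_one_left ?_ hw))
    exact Finset.sum_nonneg fun l _ => by positivity
  have hcs2 : ∑ l, |a l * u l| * (x l ^ 2 - 1) ^ 2 ≤ 2 * ∑ l, |a l * u l| * x l ^ 4 + 2 := by
    calc ∑ l, |a l * u l| * (x l ^ 2 - 1) ^ 2 ≤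
        ∑ l, (2 * (|a l * u l| * x l ^ 4) + 2 * |a l * u l|) := by
          refine Finset.sum_le_sum fun l _ => ?_
          nlinarith [mul_nonneg (abs_nonneg (a l * u l)) (sq_nonneg (x l ^ 2 + 1))]
      _ ≤ _ := by
          rw [Finset.sum_add_distrib, ← Finset.mul_sum, ← Finset.mul_sum]
          linarith
  set T := ∑ l, a l * u l * (x l ^ 2 - 1)
  set A := ⟪a, x⟫_ℝ
  set U := ⟪u, x⟫_ℝ
  have h1 : (1 / 2 * (A * U - ⟪a, u⟫_ℝ) + ρ * T) ^ 2 ≤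
      A ^ 2 * U ^ 2 + ⟪a, u⟫_ℝ ^ 2 + 2 * ρ ^ 2 * T ^ 2 := by
    nlinarith [sq_nonneg (1 / 2 * (A * U - ⟪a, u⟫_ℝ) - ρ * T), sq_nonneg (A * U + ⟪a, u⟫_ℝ)]
  have h2 : 2 * ρ ^ 2 * T ^ 2 ≤ 2 * ρ ^ 2 * (2 * ∑ l, |a l * u l| * x l ^ 4 + 2) :=
    mul_le_mul_of_nonneg_left (hcs.trans hcs2) (by positivity)
  have h3 : A ^ 2 * U ^ 2 ≤ 1 / 2 * A ^ 4 + 1 / 2 * U ^ 4 := by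
    nlinarith [sq_nonneg (A ^ 2 - U ^ 2)]
  linarith

namespace IsSubGaussianRow

variable [IsProbabilityMeasure P]

lemma apply_eq_inner_single (x : EuclideanSpace ℝ (Fin p)) (l : Fin p) :
    x l = ⟪EuclideanSpace.single l (1 : ℝ), x⟫_ℝ := by
  simp [EuclideanSpace.inner_single_left]

lemma hasMoments_certWeight (h : IsSubGaussianRow X c m P) (a u : EuclideanSpace ℝ (Fin p)) :
    HasMoments (fun ω => certWeight m a u (X ω)) P := by
  unfold certWeight
  exact ((((h.hasMoments_inner a).mul (h.hasMoments_inner u)).sub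
    (HasMoments.const _)).const_mul _).add ((HasMoments.sum _ fun l _ =>
      (((h.hasMoments_apply l).pow 2).sub (HasMoments.const _)).const_mul _).const_mul _)

/-- The certificate has exactly the prescribed second-moment matrix. -/
lemma integral_certWeight_mul (h : IsSubGaussianRow X c m P) (hm : 1 < m)
    (a u b d : EuclideanSpace ℝ (Fin p)) :
    ∫ ω, certWeight m a u (X ω) * (⟪b, X ω⟫_ℝ * ⟪d, X ω⟫_ℝ) ∂P =
      1 / 2 * (⟪a, b⟫_ℝ * ⟪u, d⟫_ℝ + ⟪u, b⟫_ℝ * ⟪a, d⟫_ℝ) := by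
  set ρ := 1 / (m - 1) - 1 / 2 with hρ
  have hbd := (h.hasMoments_inner b).mul (h.hasMoments_inner d)
  have hau := (h.hasMoments_inner a).mul (h.hasMoments_inner u)
  have hl : ∀ l, HasMoments (fun ω => X ω l * X ω l * (⟪b, X ω⟫_ℝ * ⟪d, X ω⟫_ℝ)) P := fun l =>
    ((h.hasMoments_apply l).mul (h.hasMoments_apply l)).mul hbd
  have h1 : ∀ ω, certWeight m a u (X ω) * (⟪b, X ω⟫_ℝ * ⟪d, X ω⟫_ℝ) =
      1 / 2 * (⟪a, X ω⟫_ℝ * ⟪u, X ω⟫_ℝ * (⟪b, X ω⟫_ℝ * ⟪d, X ω⟫_ℝ) -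
        ⟪a, u⟫_ℝ * (⟪b, X ω⟫_ℝ * ⟪d, X ω⟫_ℝ)) +
      ρ * ∑ l, a l * u l * (X ω l * X ω l * (⟪b, X ω⟫_ℝ * ⟪d, X ω⟫_ℝ) -
        1 * (⟪b, X ω⟫_ℝ * ⟪d, X ω⟫_ℝ)) := by
    intro ω
    unfold certWeight
    rw [add_mul, mul_assoc ρ, Finset.sum_mul]
    congr 1
    · ring
    · congr 1
      exact Finset.sum_congr rfl fun l _ => by ring
  have h2 : ∀ l, ∫ ω, X ω l * X ω l * (⟪b, X ω⟫_ℝ * ⟪d, X ω⟫_ℝ) ∂P =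
      ⟪b, d⟫_ℝ + (m - 1) * (b l * d l) := by
    intro l
    have h3 := h.integral_inner_mul_four (EuclideanSpace.single l 1) (EuclideanSpace.single l 1) b d
    simp only [← apply_eq_inner_single] at h3
    rw [h3, Finset.sum_eq_single l]
    · simp; ring
    · intro k _ hk
      simp [hk]
    · simp
  have hterm : ∀ l, HasMoments (fun ω => a l * u l * (X ω l * X ω l *
      (⟪b, X ω⟫_ℝ * ⟪d, X ω⟫_ℝ) - 1 * (⟪b, X ω⟫_ℝ * ⟪d, X ω⟫_ℝ))) P := fun l =>
    ((hl l).sub (hbd.const_mul 1)).const_mul _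
  simp only [h1]
  rw [integral_add (((hau.mul hbd).sub (hbd.const_mul _)).const_mul _).integrable
    ((HasMoments.sum _ fun l _ => hterm l).const_mul _).integrable, integral_const_mul,
    integral_const_mul, integral_sub (hau.mul hbd).integrable (hbd.const_mul _).integrable,
    integral_const_mul, integral_finsetSum _ fun l _ => (hterm l).integrable,
    h.integral_inner_mul_four, h.integral_inner_mul_inner]
  have h4 : ∀ l, ∫ ω, a l * u l * (X ω l * X ω l * (⟪b, X ω⟫_ℝ * ⟪d, X ω⟫_ℝ) -
      1 * (⟪b, X ω⟫_ℝ * ⟪d, X ω⟫_ℝ)) ∂P = (m - 1) * (a l * u l * (b l * d l)) := by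
    intro l
    rw [integral_const_mul, integral_sub (hl l).integrable (hbd.const_mul _).integrable, h2,
      integral_const_mul, h.integral_inner_mul_inner]
    ring
  simp only [h4, ← Finset.mul_sum]
  have hm' : m - 1 ≠ 0 := by linarith
  -- Half of the quadratic part leaves a diagonal excess `(m - 3) / 2`, while each `x l ^ 2 - 1`
  -- contributes `m - 1` on the diagonal; `ρ` is the coefficient for which they cancel.
  have h5 : ρ * ((m - 1) * ∑ l, a l * u l * (b l * d l)) =
      (1 - (m - 1) / 2) * ∑ l, a l * u l * (b l * d l) := by
    rw [hρ, ← mul_assoc, sub_mul, one_div_mul_cancel hm']; ring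
  rw [h5]
  ring

lemma integral_pow_four_mul_sq_le (h : IsSubGaussianRow X c m P) (hc : 0 < c)
    {a b : EuclideanSpace ℝ (Fin p)} (ha : ‖a‖ ≤ 1) (hb : ‖b‖ ≤ 1) :
    ∫ ω, ⟪a, X ω⟫_ℝ ^ 4 * ⟪b, X ω⟫_ℝ ^ 2 ∂P ≤ 1536 * (c : ℝ) ^ 3 := by
  have hA := h.hasMoments_inner a
  have hB := h.hasMoments_inner b
  have h1 := integral_mono ((hA.pow 4).mul (hB.pow 2)).integrable
    ((hA.pow 6).add (hB.pow 6)).integrable fun ω => (by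
      nlinarith [mul_nonneg (sq_nonneg (⟪a, X ω⟫_ℝ ^ 2 - ⟪b, X ω⟫_ℝ ^ 2))
          (add_nonneg (sq_nonneg ⟪a, X ω⟫_ℝ) (sq_nonneg ⟪b, X ω⟫_ℝ)),
        pow_nonneg (sq_nonneg ⟪a, X ω⟫_ℝ) 3, pow_nonneg (sq_nonneg ⟪b, X ω⟫_ℝ) 3,
        mul_nonneg (sq_nonneg ⟪a, X ω⟫_ℝ) (sq_nonneg (⟪b, X ω⟫_ℝ ^ 2))] :
      ⟪a, X ω⟫_ℝ ^ 4 * ⟪b, X ω⟫_ℝ ^ 2 ≤ ⟪a, X ω⟫_ℝ ^ 6 + ⟪b, X ω⟫_ℝ ^ 6)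
  rw [integral_add (hA.pow 6).integrable (hB.pow 6).integrable] at h1
  linarith [h.integral_inner_pow_six_le hc ha, h.integral_inner_pow_six_le hc hb]

/-- A bound for the second moment of the certificate against a squared linear form. -/
noncomputable def _root_.PhaseRetrieval.certBound (c : ℝ≥0) (m : ℝ) : ℝ :=
  (1536 * (c : ℝ) ^ 3 + 1) * (1 + 4 * (1 / (m - 1) - 1 / 2) ^ 2)

lemma integral_certWeight_sq_mul_sq_le (h : IsSubGaussianRow X c m P) (hc : 0 < c)
    {a u b : EuclideanSpace ℝ (Fin p)} (ha : ‖a‖ ≤ 1) (hu : ‖u‖ ≤ 1) (hb : ‖b‖ ≤ 1) :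
    ∫ ω, certWeight m a u (X ω) ^ 2 * ⟪b, X ω⟫_ℝ ^ 2 ∂P ≤ certBound c m := by
  unfold certBound
  set ρ := 1 / (m - 1) - 1 / 2 with hρ
  have hA := h.hasMoments_inner a
  have hU := h.hasMoments_inner u
  have hB := h.hasMoments_inner b
  have hI1 := ((hA.pow 4).mul (hB.pow 2)).const_mul (1 / 2)
  have hI2 := ((hU.pow 4).mul (hB.pow 2)).const_mul (1 / 2)
  have hl : ∀ l, HasMoments (fun ω => |a l * u l| * (X ω l ^ 4 * ⟪b, X ω⟫_ℝ ^ 2)) P := fun l =>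
    (((h.hasMoments_apply l).pow 4).mul (hB.pow 2)).const_mul _
  have hI3 := (HasMoments.sum Finset.univ fun l _ => hl l).const_mul (4 * ρ ^ 2)
  have hI4 := (hB.pow 2).const_mul (1 + 4 * ρ ^ 2)
  have h1 := integral_mono (((h.hasMoments_certWeight a u).pow 2).mul (hB.pow 2)).integrable
    (((hI1.add hI2).add hI3).add hI4).integrable fun ω => (by
      have h2 := mul_le_mul_of_nonneg_right (certWeight_sq_le m ha hu (X ω))
        (sq_nonneg ⟪b, X ω⟫_ℝ)
      refine h2.trans (le_of_eq ?_)
      simp only [← mul_assoc, ← Finset.sum_mul]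
      ring :
      certWeight m a u (X ω) ^ 2 * ⟪b, X ω⟫_ℝ ^ 2 ≤ _)
  refine h1.trans ?_
  rw [integral_add ((hI1.add hI2).add hI3).integrable hI4.integrable,
    integral_add (hI1.add hI2).integrable hI3.integrable,
    integral_add hI1.integrable hI2.integrable, integral_const_mul, integral_const_mul,
    integral_const_mul, integral_const_mul, integral_finsetSum _ fun l _ => (hl l).integrable]
  have h3 := h.integral_pow_four_mul_sq_le hc ha hb
  have h4 := h.integral_pow_four_mul_sq_le hc hu hb
  have h5 : ∑ l, ∫ ω, |a l * u l| * (X ω l ^ 4 * ⟪b, X ω⟫_ℝ ^ 2) ∂P ≤ 1536 * (c : ℝ) ^ 3 := by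
    calc ∑ l, ∫ ω, |a l * u l| * (X ω l ^ 4 * ⟪b, X ω⟫_ℝ ^ 2) ∂P
        ≤ ∑ l, |a l * u l| * (1536 * (c : ℝ) ^ 3) := by
          refine Finset.sum_le_sum fun l _ => ?_
          rw [integral_const_mul]
          refine mul_le_mul_of_nonneg_left ?_ (abs_nonneg _)
          simp only [apply_eq_inner_single (X _) l]
          exact h.integral_pow_four_mul_sq_le hc (by simp) hb
      _ = (∑ l, |a l * u l|) * (1536 * (c : ℝ) ^ 3) := by rw [Finset.sum_mul]
      _ ≤ _ := mul_le_of_le_one_left (by positivity) (sum_abs_mul_le_one ha hu)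
  have h6 : ∫ ω, ⟪b, X ω⟫_ℝ ^ 2 ∂P ≤ 1 := by
    simp only [pow_two]
    rw [h.integral_inner_mul_inner, real_inner_self_eq_norm_sq]
    exact pow_le_one₀ (norm_nonneg _) hb
  have h7 := mul_le_mul_of_nonneg_left h5 (by positivity : 0 ≤ 4 * ρ ^ 2)
  have h8 := mul_le_mul_of_nonneg_left h6 (by positivity : 0 ≤ 1 + 4 * ρ ^ 2)
  linarith

/-- The unclipped weight hits the target exactly, so only the clipping bias remains, and it is a
second moment of the weight divided by `τ`. -/
lemma abs_integral_clippedWeight_mul_sub_le (h : IsSubGaussianRow X c m P) (hc : 0 < c)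
    (hm : 1 < m) {τ : ℝ} (hτ : 0 < τ) {a u b d : EuclideanSpace ℝ (Fin p)} (ha : ‖a‖ ≤ 1)
    (hu : ‖u‖ ≤ 1) (hb : ‖b‖ ≤ 1) (hd : ‖d‖ ≤ 1) :
    |∫ ω, clippedWeight m τ a u (X ω) * (⟪b, X ω⟫_ℝ * ⟪d, X ω⟫_ℝ) ∂P -
      1 / 2 * (⟪a, b⟫_ℝ * ⟪u, d⟫_ℝ + ⟪u, b⟫_ℝ * ⟪a, d⟫_ℝ)| ≤ certBound c m / τ := by
  have hB := h.hasMoments_inner b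
  have hD := h.hasMoments_inner d
  have hW := h.hasMoments_certWeight a u
  have hcl : Integrable (fun ω => clippedWeight m τ a u (X ω) * (⟪b, X ω⟫_ℝ * ⟪d, X ω⟫_ℝ)) P := by
    refine (hB.mul hD).integrable.bdd_mul (c := τ)
      ((measurable_clippedWeight m τ a u).comp h.measurable).aestronglyMeasurable
      (ae_of_all _ fun ω => ?_)
    rw [Real.norm_eq_abs]
    exact abs_clippedWeight_le hτ.le a u (X ω)
  rw [← h.integral_certWeight_mul hm, ← integral_sub hcl (hW.mul (hB.mul hD)).integrable]
  refine abs_integral_le_integral_abs.trans ?_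
  have hI := ((((hW.pow 2).mul (hB.pow 2)).add ((hW.pow 2).mul (hD.pow 2))).const_mul (1 / (2 * τ)))
  refine (integral_mono_of_nonneg (ae_of_all _ fun ω => abs_nonneg _) hI.integrable
    (ae_of_all _ fun ω => ?_)).trans ?_
  · have h1 := abs_clippedWeight_sub_le (m := m) hτ a u (X ω)
    have h2 : |⟪b, X ω⟫_ℝ * ⟪d, X ω⟫_ℝ| ≤ (⟪b, X ω⟫_ℝ ^ 2 + ⟪d, X ω⟫_ℝ ^ 2) / 2 := by
      rw [abs_le]
      constructor <;> nlinarith [sq_nonneg (⟪b, X ω⟫_ℝ + ⟪d, X ω⟫_ℝ),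
        sq_nonneg (⟪b, X ω⟫_ℝ - ⟪d, X ω⟫_ℝ)]
    change |_ - _| ≤ _
    rw [← sub_mul, abs_mul]
    refine (mul_le_mul h1 h2 (abs_nonneg _) (by positivity)).trans (le_of_eq ?_)
    field_simp
  · rw [integral_const_mul, integral_add ((hW.pow 2).mul (hB.pow 2)).integrable
      ((hW.pow 2).mul (hD.pow 2)).integrable]
    have h3 := h.integral_certWeight_sq_mul_sq_le hc ha hu hb
    have h4 := h.integral_certWeight_sq_mul_sq_le hc ha hu hd
    rw [div_mul_eq_mul_div, one_mul, div_le_div_iff₀ (by positivity) hτ]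
    nlinarith

/-- A common exponential moment bound for products of two linear forms with bounded weights. -/
lemma exp_abs_le (h : IsSubGaussianRow X c m P) (hc : 0 < c) {τ : ℝ} (hτ : 0 < τ)
    {b d : EuclideanSpace ℝ (Fin p)} (hb : ‖b‖ ≤ 1) (hd : ‖d‖ ≤ 1) {W : Ω → ℝ}
    (hW : Measurable W) (hle : ∀ᵐ ω ∂P, |W ω| ≤ τ * |⟪b, X ω⟫_ℝ * ⟪d, X ω⟫_ℝ|) :
    Integrable (fun ω => Real.exp (1 / (4 * c * τ) * |W ω|)) P ∧
      ∫ ω, Real.exp (1 / (4 * c * τ) * |W ω|) ∂P ≤ 4 := by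
  have hc' : (0 : ℝ) < c := hc
  have h1 := h.exp_inner_sq hc hb
  have h2 := h.exp_inner_sq hc hd
  refine integrable_and_integral_le_of_le (by fun_prop) (fun _ => (Real.exp_pos _).le) ?_
    (h1.1.add h2.1) (by rw [integral_add' h1.1 h2.1]; linarith [h1.2, h2.2])
  -- The exponential of a maximum is at most the sum of the exponentials, each of mean at most 2;
  -- hence the bound 4 that enters `certRate`.
  filter_upwards [hle] with ω hω
  have h3 : 1 / (4 * c * τ) * |W ω| ≤ 1 / (4 * c) * max (⟪b, X ω⟫_ℝ ^ 2) (⟪d, X ω⟫_ℝ ^ 2) := by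
    have h4 : |⟪b, X ω⟫_ℝ * ⟪d, X ω⟫_ℝ| ≤ max (⟪b, X ω⟫_ℝ ^ 2) (⟪d, X ω⟫_ℝ ^ 2) := by
      have h5 := le_max_left (⟪b, X ω⟫_ℝ ^ 2) (⟪d, X ω⟫_ℝ ^ 2)
      have h6 := le_max_right (⟪b, X ω⟫_ℝ ^ 2) (⟪d, X ω⟫_ℝ ^ 2)
      rw [abs_le]
      constructor <;> nlinarith [sq_nonneg (⟪b, X ω⟫_ℝ + ⟪d, X ω⟫_ℝ),
        sq_nonneg (⟪b, X ω⟫_ℝ - ⟪d, X ω⟫_ℝ)]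
    calc 1 / (4 * c * τ) * |W ω| ≤ 1 / (4 * c * τ) * (τ * |⟪b, X ω⟫_ℝ * ⟪d, X ω⟫_ℝ|) :=
          mul_le_mul_of_nonneg_left hω (by positivity)
      _ = 1 / (4 * c) * |⟪b, X ω⟫_ℝ * ⟪d, X ω⟫_ℝ| := by field_simp
      _ ≤ _ := mul_le_mul_of_nonneg_left h4 (by positivity)
  rw [Pi.add_apply]
  rcases max_choice (⟪b, X ω⟫_ℝ ^ 2) (⟪d, X ω⟫_ℝ ^ 2) with h7 | h7 <;> rw [h7] at h3
  · linarith [Real.exp_le_exp.2 h3, Real.exp_pos (1 / (4 * c) * ⟪d, X ω⟫_ℝ ^ 2)]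
  · linarith [Real.exp_le_exp.2 h3, Real.exp_pos (1 / (4 * c) * ⟪b, X ω⟫_ℝ ^ 2)]

end IsSubGaussianRow

end Certificate

/-! ### Independence -/

section Independence

variable {Ω : Type*} [MeasurableSpace Ω] {P : Measure Ω}

/-- The joint law on `ι × κ` is a product measure, and currying turns it into a product of the row
laws. -/
lemma iIndepFun_rows [IsProbabilityMeasure P] {ι κ 𝓧 : Type*} [MeasurableSpace 𝓧]
    {X : ι → κ → Ω → 𝓧} (mX : ∀ i j, Measurable (X i j))
    (h : iIndepFun (fun (q : ι × κ) ω => X q.1 q.2 ω) P) :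
    iIndepFun (fun i ω => (fun j => X i j ω)) P := by
  have : ∀ i j, IsProbabilityMeasure (P.map (X i j)) :=
    fun i j => Measure.isProbabilityMeasure_map (mX i j).aemeasurable
  have hrow : ∀ i, P.map (fun ω j => X i j ω) = Measure.infinitePi fun j => P.map (X i j) :=
    fun i => (iIndepFun_iff_map_fun_eq_infinitePi_map (mX i)).1
      (h.precomp (g := fun j => (i, j)) fun _ _ hj => (Prod.mk.inj hj).2)
  rw [iIndepFun_iff_map_fun_eq_infinitePi_map fun i => measurable_pi_iff.2 (mX i)]
  simp only [hrow]
  rw [← Measure.infinitePi_map_curry (fun i j => P.map (X i j)),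
    ← (iIndepFun_iff_map_fun_eq_infinitePi_map fun q : ι × κ => mX q.1 q.2).1 h,
    Measure.map_map (by fun_prop) (by fun_prop)]
  rfl

/-- Two independent families of independent variables form a family of independent pairs. -/
lemma iIndepFun_prodMk [IsProbabilityMeasure P] {n : ℕ} {α β : Type*} [MeasurableSpace α]
    [MeasurableSpace β] {X : Fin n → Ω → α} {Y : Fin n → Ω → β} (hX : ∀ i, Measurable (X i))
    (hY : ∀ i, Measurable (Y i)) (hXi : iIndepFun X P) (hYi : iIndepFun Y P)
    (h : IndepFun (fun ω i => X i ω) (fun ω i => Y i ω) P) :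
    iIndepFun (fun i ω => (X i ω, Y i ω)) P := by
  have : ∀ i, IsProbabilityMeasure (P.map (X i)) :=
    fun i => Measure.isProbabilityMeasure_map (hX i).aemeasurable
  have : ∀ i, IsProbabilityMeasure (P.map (Y i)) :=
    fun i => Measure.isProbabilityMeasure_map (hY i).aemeasurable
  have hpair : ∀ i, P.map (fun ω => (X i ω, Y i ω)) = (P.map (X i)).prod (P.map (Y i)) := fun i =>
    (h.comp (measurable_pi_apply i) (measurable_pi_apply i)).map_prod_eq_prod_map_map
      (hX i).aemeasurable (hY i).aemeasurable
  rw [iIndepFun_iff_map_fun_eq_pi_map fun i => ((hX i).prodMk (hY i)).aemeasurable]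
  simp only [hpair]
  have hmp := measurePreserving_arrowProdEquivProdArrow α β (Fin n) (fun i => P.map (X i))
    (fun i => P.map (Y i))
  rw [← (MeasurableEquiv.arrowProdEquivProdArrow α β (Fin n)).map_measurableEquiv_injective.eq_iff,
    hmp.map_eq, Measure.map_map (by fun_prop) (by fun_prop),
    ← hXi.map_fun_eq_pi_map fun i => (hX i).aemeasurable,
    ← hYi.map_fun_eq_pi_map fun i => (hY i).aemeasurable,
    ← h.map_prod_eq_prod_map_map (by fun_prop) (by fun_prop)]
  rfl

namespace IsRademacherFamily

variable {n : ℕ} {ε : Fin n → Ω → ℝ} [IsProbabilityMeasure P]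

lemma map_apply (h : IsRademacherFamily ε P) (i : Fin n) :
    P.map (ε i) = (1 / 2 : ℝ≥0∞) • (Measure.dirac 1 + Measure.dirac (-1)) := by
  have : IsProbabilityMeasure (P.map (ε i)) :=
    Measure.isProbabilityMeasure_map (h.measurable i).aemeasurable
  have h1 : P.map (ε i) {1} = 1 / 2 := by
    rw [Measure.map_apply (h.measurable i) (measurableSet_singleton _)]
    exact h.prob_one i
  have h2 : P.map (ε i) {-1} = 1 / 2 := by
    rw [Measure.map_apply (h.measurable i) (measurableSet_singleton _)]
    exact h.prob_neg_one i
  have h3 : P.map (ε i) {1, -1}ᶜ = 0 := by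
    rw [prob_compl_eq_zero_iff (Set.toFinite _).measurableSet, Set.insert_eq,
      measure_union (by norm_num) (measurableSet_singleton _), h1, h2, ENNReal.add_halves]
  have h4 : P.map (ε i) = (P.map (ε i)).restrict {1, -1} :=
    (Measure.restrict_eq_self_of_ae_mem (mem_ae_iff.2 h3)).symm
  rw [h4, Set.insert_eq, Measure.restrict_union (by norm_num) (measurableSet_singleton _),
    Measure.restrict_singleton, Measure.restrict_singleton, h1, h2, smul_add]

lemma ae_sq_eq_one (h : IsRademacherFamily ε P) (i : Fin n) : ∀ᵐ ω ∂P, ε i ω ^ 2 = 1 := by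
  have h1 : ∀ᵐ t ∂(P.map (ε i)), t ^ 2 = (1 : ℝ) := by
    rw [h.map_apply i]
    refine Measure.ae_smul_measure (ae_add_measure_iff.2 ⟨?_, ?_⟩) _ <;>
      simp [ae_dirac_eq]
  exact ae_of_ae_map (h.measurable i).aemeasurable h1

lemma integral_eq_zero (h : IsRademacherFamily ε P) (i : Fin n) : ∫ ω, ε i ω ∂P = 0 := by
  have h1 := integral_map (μ := P) (h.measurable i).aemeasurable
    (f := fun t : ℝ => t) measurable_id.aestronglyMeasurable
  rw [← h1, h.map_apply, integral_smul_measure, integral_add_measure (integrable_dirac (by simp))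
    (integrable_dirac (by simp)), integral_dirac, integral_dirac]
  simp

/-- Signs that are determined by independent data do not change the joint law of a Rademacher
family and the data. -/
lemma map_prodMk_mul (h : IsRademacherFamily ε P) {𝓩 : Type*} [MeasurableSpace 𝓩] {Z : Ω → 𝓩}
    (hZ : Measurable Z) (hind : IndepFun (fun ω i => ε i ω) Z P) {σ : Fin n → 𝓩 → ℝ}
    (hσ : ∀ i, Measurable (σ i)) (hσ1 : ∀ i z, σ i z = 1 ∨ σ i z = -1) :
    P.map (fun ω => (Z ω, fun i => ε i ω * σ i (Z ω))) =
      (P.map Z).prod (Measure.pi fun i => P.map (ε i)) := by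
  have : ∀ i, IsProbabilityMeasure (P.map (ε i)) :=
    fun i => Measure.isProbabilityMeasure_map (h.measurable i).aemeasurable
  have : IsProbabilityMeasure (P.map Z) := Measure.isProbabilityMeasure_map hZ.aemeasurable
  have hε : Measurable fun ω i => ε i ω := measurable_pi_iff.2 h.measurable
  -- For a frozen value of `Z` each sign flip preserves the symmetric law of `ε i`, so the map is a
  -- measure-preserving skew product over the law of `Z`.
  have hflip : ∀ i z, MeasurePreserving (fun t => t * σ i z) (P.map (ε i)) (P.map (ε i)) := by
    intro i z
    have hm : Measurable fun t : ℝ => t * σ i z := measurable_id.mul_const _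
    refine ⟨hm, ?_⟩
    rw [h.map_apply, Measure.map_smul, Measure.map_add _ _ hm, Measure.map_dirac' hm,
      Measure.map_dirac' hm]
    rcases hσ1 i z with h1 | h1 <;> simp [h1, add_comm]
  have hg : Measurable (Function.uncurry fun (z : 𝓩) (s : Fin n → ℝ) i => s i * σ i z) :=
    measurable_pi_iff.2 fun i =>
      ((measurable_pi_apply i).comp measurable_snd).mul ((hσ i).comp measurable_fst)
  have hskew := (MeasurePreserving.id (P.map Z)).skew_product
    (μc := Measure.pi fun i => P.map (ε i)) (μd := Measure.pi fun i => P.map (ε i)) hg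
    (ae_of_all _ fun z => (measurePreserving_pi _ _ fun i => hflip i z).map_eq)
  rw [← hskew.map_eq, ← h.indep.map_fun_eq_pi_map fun i => (h.measurable i).aemeasurable,
    ← hind.symm.map_prod_eq_prod_map_map hZ.aemeasurable hε.aemeasurable,
    Measure.map_map hskew.measurable (hZ.prodMk hε)]
  rfl

variable {𝓩 : Type*} [MeasurableSpace 𝓩] {Z : Ω → 𝓩} {σ : Fin n → 𝓩 → ℝ}

/-- Reads off the marginals of the joint law. It makes the effective signs independent of the design
even when the noise is a function of it. -/
lemma mul_signs (h : IsRademacherFamily ε P) (hZ : Measurable Z)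
    (hind : IndepFun (fun ω i => ε i ω) Z P) (hσ : ∀ i, Measurable (σ i))
    (hσ1 : ∀ i z, σ i z = 1 ∨ σ i z = -1) :
    IsRademacherFamily (fun i ω => ε i ω * σ i (Z ω)) P ∧
      IndepFun Z (fun ω i => ε i ω * σ i (Z ω)) P := by
  have : ∀ i, IsProbabilityMeasure (P.map (ε i)) :=
    fun i => Measure.isProbabilityMeasure_map (h.measurable i).aemeasurable
  have : IsProbabilityMeasure (P.map Z) := Measure.isProbabilityMeasure_map hZ.aemeasurable
  have hmeas : ∀ i, Measurable fun ω => ε i ω * σ i (Z ω) :=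
    fun i => (h.measurable i).mul ((hσ i).comp hZ)
  have hmeas' : Measurable fun ω i => ε i ω * σ i (Z ω) := measurable_pi_iff.2 hmeas
  have hmap := h.map_prodMk_mul hZ hind hσ hσ1
  have hlaw : P.map (fun ω i => ε i ω * σ i (Z ω)) = Measure.pi fun i => P.map (ε i) := by
    have h1 := congrArg (Measure.map Prod.snd) hmap
    rw [Measure.map_map measurable_snd (hZ.prodMk hmeas'), Measure.map_snd_prod, measure_univ,
      one_smul] at h1
    exact h1
  have hmarg : ∀ i, P.map (fun ω => ε i ω * σ i (Z ω)) = P.map (ε i) := by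
    intro i
    have h1 := congrArg (Measure.map fun s : Fin n → ℝ => s i) hlaw
    rw [Measure.map_map (measurable_pi_apply i) hmeas',
      (measurePreserving_eval (fun i => P.map (ε i)) i).map_eq] at h1
    exact h1
  have hprob : ∀ i (t : ℝ), P {ω | ε i ω * σ i (Z ω) = t} = P {ω | ε i ω = t} := by
    intro i t
    have h1 := congrArg (fun ν : Measure ℝ => ν {t}) (hmarg i)
    simp only [Measure.map_apply (hmeas i) (measurableSet_singleton t),
      Measure.map_apply (h.measurable i) (measurableSet_singleton t)] at h1
    exact h1
  refine ⟨⟨hmeas, ?_, fun i => (hprob i 1).trans (h.prob_one i),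
    fun i => (hprob i (-1)).trans (h.prob_neg_one i)⟩, ?_⟩
  · rw [iIndepFun_iff_map_fun_eq_pi_map fun i => (hmeas i).aemeasurable, hlaw]
    simp only [hmarg]
  · rw [indepFun_iff_map_prod_eq_prod_map_map hZ.aemeasurable hmeas'.aemeasurable, hmap, hlaw]

end IsRademacherFamily

end Independence

/-! ### The certificate event -/

section Event

variable {Ω : Type*} [MeasurableSpace Ω] {P : Measure Ω} {n p : ℕ} {m τ : ℝ} {c : ℝ≥0}
  {X : Fin n → Ω → EuclideanSpace ℝ (Fin p)} {s : Fin n → Ω → ℝ}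

/-- Independent sub-Gaussian rows with independent Rademacher labels. -/
structure IsSignedSample (X : Fin n → Ω → EuclideanSpace ℝ (Fin p)) (s : Fin n → Ω → ℝ)
    (c : ℝ≥0) (m : ℝ) (P : Measure Ω) : Prop where
  row : ∀ i, IsSubGaussianRow (X i) c m P
  signs : IsRademacherFamily s P
  indep : iIndepFun (fun i ω => (X i ω, s i ω)) P
  indepFun : ∀ i, IndepFun (X i) (s i) P

/-- The rank-one bilinear form `(b, d) ↦ ⟪a, b⟫ ⟪u, d⟫`. -/
noncomputable def rankOneForm (a u : EuclideanSpace ℝ (Fin p)) :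
    EuclideanSpace ℝ (Fin p) →ₗ[ℝ] EuclideanSpace ℝ (Fin p) →ₗ[ℝ] ℝ :=
  (innerₗ _ a).smulRight (innerₗ _ u)

lemma rankOneForm_apply (a u b d : EuclideanSpace ℝ (Fin p)) :
    rankOneForm a u b d = ⟪a, b⟫_ℝ * ⟪u, d⟫_ℝ := by
  simp [rankOneForm]

/-- The rate at which the certificate event fails. -/
noncomputable def certRate (c : ℝ≥0) (τ : ℝ) : ℝ :=
  concentrationRate (1 / (4 * c * τ)) 4 (1 / 256)

lemma certRate_pos (hc : 0 < c) (hτ : 0 < τ) : 0 < certRate c τ := by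
  have hc' : (0 : ℝ) < c := hc
  exact concentrationRate_pos (by positivity) (by norm_num) (by norm_num)

lemma abs_sum_sub_le_of_net {N : Finset (EuclideanSpace ℝ (Fin p))}
    (hN : ∀ v : EuclideanSpace ℝ (Fin p), ‖v‖ ≤ 1 → ∃ a ∈ N, ‖v - a‖ ≤ 1 / 2)
    (x : Fin n → EuclideanSpace ℝ (Fin p)) (φ : Fin n → ℝ)
    (B : EuclideanSpace ℝ (Fin p) →ₗ[ℝ] EuclideanSpace ℝ (Fin p) →ₗ[ℝ] ℝ)
    (h : ∀ b ∈ N, ∀ d ∈ N,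
      |∑ i, φ i * (⟪b, x i⟫_ℝ * ⟪d, x i⟫_ℝ) - n * B b d| ≤ n * (1 / 128))
    (b d : EuclideanSpace ℝ (Fin p)) :
    |∑ i, φ i * (⟪x i, b⟫_ℝ * ⟪x i, d⟫_ℝ) - n * B b d| ≤ n / 32 * (‖b‖ * ‖d‖) := by
  have hQ : ∀ b d, (∑ i, φ i • rankOneForm (x i) (x i) - (n : ℝ) • B) b d =
      ∑ i, φ i * (⟪x i, b⟫_ℝ * ⟪x i, d⟫_ℝ) - n * B b d := fun b d => by
    simp [rankOneForm_apply]
  have h1 := abs_bilin_le_of_abs_le_on_net hN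
    (∑ i, φ i • rankOneForm (x i) (x i) - (n : ℝ) • B) (δ := n * (1 / 128)) (fun b hb d hd => by
      rw [hQ]
      simpa only [real_inner_comm] using h b hb d hd) b d
  rw [hQ] at h1
  exact h1.trans (le_of_eq (by ring))

namespace IsSignedSample

variable [IsProbabilityMeasure P]

/-- The tolerance `1 / 128` is split evenly: half for the bias of the mean, half for the Bernstein
deviation. -/
lemma measure_gt_le (h : IsSignedSample X s c m P) (hc : 0 < c) (hτ : 0 < τ)
    {w : EuclideanSpace ℝ (Fin p) × ℝ → ℝ} (hw : Measurable w)
    (hwτ : ∀ i, ∀ᵐ ω ∂P, |w (X i ω, s i ω)| ≤ τ) {b d : EuclideanSpace ℝ (Fin p)} (hb : ‖b‖ ≤ 1)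
    (hd : ‖d‖ ≤ 1) {μ₀ : ℝ}
    (hmean : ∀ i, |∫ ω, w (X i ω, s i ω) * (⟪b, X i ω⟫_ℝ * ⟪d, X i ω⟫_ℝ) ∂P - μ₀| ≤ 1 / 256) :
    P.real {ω | n * (1 / 128 : ℝ) <
        |∑ i, w (X i ω, s i ω) * (⟪b, X i ω⟫_ℝ * ⟪d, X i ω⟫_ℝ) - n * μ₀|} ≤
      2 * Real.exp (-(certRate c τ * n)) := by
  have hc' : (0 : ℝ) < c := hc
  set G : EuclideanSpace ℝ (Fin p) × ℝ → ℝ := fun q => w q * (⟪b, q.1⟫_ℝ * ⟪d, q.1⟫_ℝ)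
  have hG : Measurable G := hw.mul
    (((continuous_const.inner continuous_fst).mul (continuous_const.inner continuous_fst)).measurable)
  set W : Fin n → Ω → ℝ := fun i ω => G (X i ω, s i ω)
  have hW : ∀ i, Measurable (W i) := fun i =>
    hG.comp ((h.row i).measurable.prodMk (h.signs.measurable i))
  have hexp := fun i => (h.row i).exp_abs_le hc hτ hb hd (hW i) (by
    filter_upwards [hwτ i] with ω hω
    exact (abs_mul _ _).le.trans (mul_le_mul_of_nonneg_right hω (abs_nonneg _)))
  refine le_trans (measureReal_mono ?_) (measure_abs_sum_sub_gt_le (ε := 1 / 256) hW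
    (h.indep.comp (fun _ => G) fun _ => hG) (by positivity) (by norm_num) (by norm_num)
    (fun i => (hexp i).1) fun i => (hexp i).2)
  intro ω hω
  change n * (1 / 128 : ℝ) < |∑ i, W i ω - n * μ₀| at hω
  change n * (1 / 256 : ℝ) < |∑ i, W i ω - ∑ i, ∫ ω', W i ω' ∂P|
  have h1 : |∑ i, ∫ ω', W i ω' ∂P - n * μ₀| ≤ n * (1 / 256) := by
    have h2 : ∑ i, ∫ ω', W i ω' ∂P - n * μ₀ = ∑ i, (∫ ω', W i ω' ∂P - μ₀) := by
      simp [Finset.sum_sub_distrib]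
    rw [h2]
    refine (Finset.abs_sum_le_sum_abs _ _).trans
      ((Finset.sum_le_sum fun i _ => hmean i).trans (le_of_eq ?_))
    simp
  have h3 := abs_sub_le (∑ i, W i ω) (∑ i, ∫ ω', W i ω' ∂P) (n * μ₀)
  linarith

/-- Weighted covariance matrices concentrate in operator norm. -/
lemma exists_bilinear_event (h : IsSignedSample X s c m P) (hc : 0 < c) (hτ : 0 < τ)
    {N : Finset (EuclideanSpace ℝ (Fin p))} (hN1 : ∀ a ∈ N, ‖a‖ ≤ 1)
    (hN : ∀ v : EuclideanSpace ℝ (Fin p), ‖v‖ ≤ 1 → ∃ a ∈ N, ‖v - a‖ ≤ 1 / 2)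
    {w : EuclideanSpace ℝ (Fin p) × ℝ → ℝ} (hw : Measurable w)
    (hwτ : ∀ i, ∀ᵐ ω ∂P, |w (X i ω, s i ω)| ≤ τ)
    (B : EuclideanSpace ℝ (Fin p) →ₗ[ℝ] EuclideanSpace ℝ (Fin p) →ₗ[ℝ] ℝ)
    (hmean : ∀ i b d, ‖b‖ ≤ 1 → ‖d‖ ≤ 1 →
      |∫ ω, w (X i ω, s i ω) * (⟪b, X i ω⟫_ℝ * ⟪d, X i ω⟫_ℝ) ∂P - B b d| ≤ 1 / 256) :
    ∃ F : Set Ω, MeasurableSet F ∧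
      P.real F ≤ (N.card : ℝ) ^ 2 * (2 * Real.exp (-(certRate c τ * n))) ∧
      ∀ ω ∉ F, ∀ b d, |∑ i, w (X i ω, s i ω) * (⟪X i ω, b⟫_ℝ * ⟪X i ω, d⟫_ℝ) - n * B b d| ≤
        n / 32 * (‖b‖ * ‖d‖) := by
  refine ⟨⋃ q ∈ N ×ˢ N, {ω | n * (1 / 128 : ℝ) <
    |∑ i, w (X i ω, s i ω) * (⟪q.1, X i ω⟫_ℝ * ⟪q.2, X i ω⟫_ℝ) - n * B q.1 q.2|}, ?_, ?_, ?_⟩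
  · refine Finset.measurableSet_biUnion _ fun q _ => measurableSet_lt measurable_const ?_
    exact ((Finset.measurable_fun_sum _ fun i _ =>
      (hw.comp ((h.row i).measurable.prodMk (h.signs.measurable i))).mul
        (((h.row i).measurable_inner _).mul ((h.row i).measurable_inner _))).sub_const _).abs
  · refine (measureReal_biUnion_finset_le _ _).trans
      ((Finset.sum_le_card_nsmul _ _ (2 * Real.exp (-(certRate c τ * n))) fun q hq => ?_).trans
        (le_of_eq ?_))
    · rw [Finset.mem_product] at hq
      exact h.measure_gt_le hc hτ hw hwτ (hN1 _ hq.1) (hN1 _ hq.2)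
        fun i => hmean i _ _ (hN1 _ hq.1) (hN1 _ hq.2)
    · rw [Finset.card_product, nsmul_eq_mul]
      push_cast
      ring
  · intro ω hω
    simp only [Set.mem_iUnion, Set.mem_ofPred_eq, not_exists, not_lt, Finset.mem_product] at hω
    exact abs_sum_sub_le_of_net hN _ _ B fun b hb d hd => hω (b, d) ⟨hb, hd⟩

lemma integral_sign_mul (h : IsSignedSample X s c m P) (i : Fin n)
    {f : EuclideanSpace ℝ (Fin p) → ℝ} (hf : Measurable f) :
    ∫ ω, s i ω * f (X i ω) ∂P = 0 := by
  have h1 := ((h.indepFun i).symm.comp measurable_id hf).integral_fun_mul_eq_mul_integral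
    (h.signs.measurable i).aestronglyMeasurable
    (hf.comp (h.row i).measurable).aestronglyMeasurable
  simp only [Function.comp_def, id] at h1
  rw [h1, h.signs.integral_eq_zero, zero_mul]

/-- Although a certificate is required for every direction, the vector `a` can be taken from the
finite net, so a union bound over `a`, `b` and `d` suffices. This produces `5³ = 125` per dimension.
-/
lemma exists_isCertified (h : IsSignedSample X s c m P) (hc : 0 < c) (hm : 1 < m) (hτ1 : 1 ≤ τ)
    (hτ : 256 * certBound c m ≤ τ) {u : EuclideanSpace ℝ (Fin p)} (hu : ‖u‖ ≤ 1) :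
    ∃ F : Set Ω, MeasurableSet F ∧
      P.real F ≤ 6 * 125 ^ p * Real.exp (-(certRate c τ * n)) ∧
      ∀ ω ∉ F, (∀ i, s i ω ^ 2 = 1) → IsCertified (fun i => X i ω) (fun i => s i ω) u τ := by
  have hτ0 : 0 < τ := by linarith
  obtain ⟨N, hcard, hN1, hN⟩ := exists_net (E := EuclideanSpace ℝ (Fin p))
  rw [finrank_euclideanSpace_fin] at hcard
  -- The constant weight 1, admissible because `1 ≤ τ`, gives the Gram bound.
  obtain ⟨F, hF, hPF, hFω⟩ := h.exists_bilinear_event hc hτ0 hN1 hN (w := fun _ => 1)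
    measurable_const (fun i => ae_of_all _ fun ω => by simpa using hτ1) (innerₗ _)
    (fun i b d _ _ => by
      simp only [one_mul, innerₗ_apply_apply]
      rw [(h.row i).integral_inner_mul_inner]
      norm_num)
  have hcert : ∀ a : EuclideanSpace ℝ (Fin p), ‖a‖ ≤ 1 → ∃ F : Set Ω, MeasurableSet F ∧
      P.real F ≤ (N.card : ℝ) ^ 2 * (2 * Real.exp (-(certRate c τ * n))) ∧
      ∀ ω ∉ F, ∀ b d, |∑ i, clippedWeight m τ a u (X i ω) * (⟪X i ω, b⟫_ℝ * ⟪X i ω, d⟫_ℝ) -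
        n / 2 * (⟪a, b⟫_ℝ * ⟪u, d⟫_ℝ + ⟪u, b⟫_ℝ * ⟪a, d⟫_ℝ)| ≤ n / 32 * (‖b‖ * ‖d‖) := by
    intro a ha
    have hB : ∀ b d, ((1 / 2 : ℝ) • (rankOneForm a u + rankOneForm u a)) b d =
        1 / 2 * (⟪a, b⟫_ℝ * ⟪u, d⟫_ℝ + ⟪u, b⟫_ℝ * ⟪a, d⟫_ℝ) := fun b d => by
      simp [rankOneForm_apply, mul_add]
    obtain ⟨F, hF, hPF, hFω⟩ := h.exists_bilinear_event hc hτ0 hN1 hN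
      (w := fun q => clippedWeight m τ a u q.1)
      ((measurable_clippedWeight m τ a u).comp measurable_fst)
      (fun i => ae_of_all _ fun ω => abs_clippedWeight_le hτ0.le a u (X i ω))
      ((1 / 2 : ℝ) • (rankOneForm a u + rankOneForm u a))
      (fun i b d hb hd => by
        rw [hB]
        refine ((h.row i).abs_integral_clippedWeight_mul_sub_le hc hm hτ0 ha hu hb hd).trans ?_
        rw [div_le_div_iff₀ hτ0 (by norm_num)]
        linarith)
    refine ⟨F, hF, hPF, fun ω hω b d => le_of_eq_of_le ?_ (hFω ω hω b d)⟩
    rw [hB]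
    ring_nf
  have hsgn : ∀ a : EuclideanSpace ℝ (Fin p), ∃ F : Set Ω, MeasurableSet F ∧
      P.real F ≤ (N.card : ℝ) ^ 2 * (2 * Real.exp (-(certRate c τ * n))) ∧
      ∀ ω ∉ F, ∀ b d, |∑ i, s i ω * clippedWeight m τ a u (X i ω) *
        (⟪X i ω, b⟫_ℝ * ⟪X i ω, d⟫_ℝ)| ≤ n / 32 * (‖b‖ * ‖d‖) := by
    intro a
    obtain ⟨F, hF, hPF, hFω⟩ := h.exists_bilinear_event hc hτ0 hN1 hN
      (w := fun q => q.2 * clippedWeight m τ a u q.1)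
      (measurable_snd.mul ((measurable_clippedWeight m τ a u).comp measurable_fst))
      (fun i => by
        filter_upwards [h.signs.ae_sq_eq_one i] with ω hω
        rw [abs_mul, show |s i ω| = 1 by
          rw [← pow_eq_one_iff_of_nonneg (abs_nonneg _) two_ne_zero, sq_abs, hω], one_mul]
        exact abs_clippedWeight_le hτ0.le a u (X i ω)) 0
      (fun i b d hb hd => by
        have h1 := h.integral_sign_mul i (f := fun x => clippedWeight m τ a u x *
          (⟪b, x⟫_ℝ * ⟪d, x⟫_ℝ)) ((measurable_clippedWeight m τ a u).mul
            ((continuous_const.inner continuous_id).mul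
              (continuous_const.inner continuous_id)).measurable)
        simp only [mul_assoc, h1]
        norm_num)
    exact ⟨F, hF, hPF, fun ω hω b d => by simpa using hFω ω hω b d⟩
  choose! F₁ hF₁ hPF₁ hFω₁ using hcert
  choose F₂ hF₂ hPF₂ hFω₂ using hsgn
  set r := (N.card : ℝ) ^ 2 * (2 * Real.exp (-(certRate c τ * n))) with hr
  refine ⟨F ∪ ⋃ a ∈ N, (F₁ a ∪ F₂ a), hF.union (Finset.measurableSet_biUnion _ fun a ha =>
    (hF₁ a (hN1 a ha)).union (hF₂ a)), ?_, ?_⟩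
  · have h1 : P.real (⋃ a ∈ N, (F₁ a ∪ F₂ a)) ≤ N.card * (2 * r) := by
      refine (measureReal_biUnion_finset_le _ _).trans
        ((Finset.sum_le_card_nsmul _ _ (2 * r) fun a ha => ?_).trans (nsmul_eq_mul _ _).le)
      exact (measureReal_union_le _ _).trans (by linarith [hPF₁ a (hN1 a ha), hPF₂ a])
    have h2 : (N.card : ℝ) ≤ 5 ^ p := by exact_mod_cast hcard
    have h3 : (1 : ℝ) ≤ 5 ^ p := one_le_pow₀ (by norm_num)
    have h4 : r ≤ (5 ^ p) ^ 2 * (2 * Real.exp (-(certRate c τ * n))) := by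
      rw [hr]; gcongr
    have h5 : (125 : ℝ) ^ p = 5 ^ p * (5 ^ p) ^ 2 := by
      rw [← pow_mul, ← pow_add, show p + p * 2 = 3 * p by ring, pow_mul]; norm_num
    have hr0 : 0 ≤ r := by positivity
    calc P.real (F ∪ ⋃ a ∈ N, (F₁ a ∪ F₂ a)) ≤ r + N.card * (2 * r) :=
          (measureReal_union_le _ _).trans (add_le_add hPF h1)
      _ ≤ 3 * (5 ^ p * r) := by nlinarith
      _ ≤ 3 * (5 ^ p * ((5 ^ p) ^ 2 * (2 * Real.exp (-(certRate c τ * n))))) := by gcongr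
      _ = _ := by rw [h5]; ring
  · intro ω hω hsq
    simp only [Set.mem_union, Set.mem_iUnion, not_or, not_exists] at hω
    refine ⟨hsq, fun v => ?_, fun v => ?_⟩
    · have h1 := hFω ω hω.1 v v
      simp only [one_mul, innerₗ_apply_apply, real_inner_self_eq_norm_sq] at h1
      have h2 := (abs_le.1 h1).2
      simp only [← pow_two] at h2
      have h3 : 0 ≤ (n : ℝ) * ‖v‖ ^ 2 := by positivity
      linarith
    · obtain ⟨a, ha, hav⟩ := exists_mem_net_half_norm_le hN v
      have ha' := hω.2 a ha
      exact ⟨a, fun i => clippedWeight m τ a u (X i ω), hav, hN1 a ha,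
        fun i => abs_clippedWeight_le hτ0.le a u (X i ω), hFω₁ a (hN1 a ha) ω ha'.1,
        hFω₂ a ω ha'.2⟩

end IsSignedSample

/-- Half of the exponent beats `125 ^ p`, since `125 ≤ exp 5` and `10 p ≤ k n`. The other half beats
`6 n²` through `t³ / 6 ≤ exp t` at `t = k n / 2`, which needs `288 ≤ k³ n`. -/
lemma failure_bound {k : ℝ} (hk : 0 < k) (hp : 0 < p)
    (hn : (10 / k + 288 / k ^ 3) * (p : ℝ) ≤ n) :
    6 * 125 ^ p * Real.exp (-(k * n)) ≤ 1 / (n : ℝ) ^ 2 := by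
  have hp1 : (1 : ℝ) ≤ p := by exact_mod_cast hp
  have h1 : 10 / k * p ≤ n := le_trans (by
    have : 0 ≤ 288 / k ^ 3 * (p : ℝ) := by positivity
    linarith) hn
  have h2 : 288 / k ^ 3 ≤ n := le_trans (by
    have h3 : 0 ≤ 10 / k * (p : ℝ) := by positivity
    have h4 : 288 / k ^ 3 ≤ 288 / k ^ 3 * (p : ℝ) := le_mul_of_one_le_right (by positivity) hp1
    linarith) hn
  have hn0 : (0 : ℝ) < n := lt_of_lt_of_le (by positivity) h2
  rw [div_mul_eq_mul_div, div_le_iff₀ hk] at h1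
  rw [div_le_iff₀ (by positivity)] at h2
  have h125 : (125 : ℝ) ^ p ≤ Real.exp (k * n / 2) := by
    have h3 : (125 : ℝ) ≤ Real.exp 5 := by
      have h4 := Real.exp_one_gt_d9
      have h5 : Real.exp 5 = Real.exp 1 ^ 5 := by rw [← Real.exp_nat_mul]; norm_num
      rw [h5]
      calc (125 : ℝ) ≤ 2.7 ^ 5 := by norm_num
        _ ≤ _ := by gcongr; linarith
    calc (125 : ℝ) ^ p ≤ Real.exp 5 ^ p := by gcongr
      _ = Real.exp (p * 5) := (Real.exp_nat_mul _ _).symm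
      _ ≤ _ := Real.exp_le_exp.2 (by linarith)
  have hexp : (k * n / 2) ^ 3 / 6 ≤ Real.exp (k * n / 2) := by
    have := Real.pow_div_factorial_le_exp (k * n / 2) (by positivity) 3
    norm_num [Nat.factorial] at this ⊢
    exact this
  have hsplit : Real.exp (-(k * n)) = (Real.exp (k * n / 2) * Real.exp (k * n / 2))⁻¹ := by
    rw [← Real.exp_add, ← Real.exp_neg]; ring_nf
  set T := Real.exp (k * n / 2) with hT
  have hT0 : 0 < T := Real.exp_pos _
  rw [hsplit, ← div_eq_mul_inv, div_le_div_iff₀ (by positivity) (by positivity)]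
  have h6 : 6 * (n : ℝ) ^ 2 ≤ T := by
    refine le_trans ?_ hexp
    rw [le_div_iff₀ (by norm_num)]
    nlinarith [mul_le_mul_of_nonneg_right h2 (sq_nonneg (n : ℝ))]
  calc 6 * 125 ^ p * (n : ℝ) ^ 2 = 125 ^ p * (6 * (n : ℝ) ^ 2) := by ring
    _ ≤ T * T := by gcongr
    _ = _ := (one_mul _).symm

end Event

/-! ### From the design to a signed sample -/

section Design

variable {Ω : Type*} [MeasurableSpace Ω] {P : Measure Ω} {n p : ℕ} {m : ℝ} {κ : ℝ≥0}

namespace IsSubGaussianDesign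

variable {x : Fin n → Ω → EuclideanSpace ℝ (Fin p)}

lemma measurable_apply (h : IsSubGaussianDesign x κ m P) (i : Fin n) (l : Fin p) :
    Measurable fun ω => x i ω l :=
  (EuclideanSpace.proj (𝕜 := ℝ) l).continuous.measurable.comp (h.measurable i)

lemma isSubGaussianRow (h : IsSubGaussianDesign x κ m P) {c : ℝ≥0}
    (hc : ∀ X : Ω → ℝ, Measurable X → ∫ ω, X ω ∂P = 0 →
      ∫⁻ ω, ENNReal.ofReal (Real.exp (X ω ^ 2 / ((κ : ℝ) + 1) ^ 2)) ∂P ≤ 2 →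
      HasSubgaussianMGF X c P) (i : Fin n) : IsSubGaussianRow (x i) c m P := by
  have hsub : ∀ l, HasSubgaussianMGF (fun ω => x i ω l) c P := fun l =>
    hc _ (h.measurable_apply i l) (h.mean i l)
      (lintegral_exp_sq_le_two_of_psi2Norm_le (h.psi2Norm_le i l))
  exact ⟨h.measurable i, ⟨h.indep.precomp (g := fun l => (i, l)) fun _ _ hl => (Prod.mk.inj hl).2,
    fun l => hasMoments_of_hasSubgaussianMGF (h.measurable_apply i l) (hsub l), h.mean i,
    h.second_moment i, h.fourth_moment i⟩, hsub⟩

lemma iIndepFun_rows [IsProbabilityMeasure P] (h : IsSubGaussianDesign x κ m P) : iIndepFun x P := by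
  have h1 := PhaseRetrieval.iIndepFun_rows (X := fun i l ω => x i ω l) h.measurable_apply h.indep
  exact h1.comp (fun _ v => (WithLp.toLp 2 v : EuclideanSpace ℝ (Fin p)))
    fun _ => by fun_prop

end IsSubGaussianDesign

end Design

/-! ### The recovery theorem -/

section Recovery

variable {Ω : Type*} [MeasurableSpace Ω] {P : Measure Ω} {n p : ℕ}

/-- An event of large probability on which almost sure properties hold. -/
lemma exists_event_of_ae [IsProbabilityMeasure P] {F : Set Ω} (hF : MeasurableSet F) {δ : ℝ} (hPF : P.real F ≤ δ)
    {q : Ω → Prop} (hq : ∀ᵐ ω ∂P, q ω) :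
    ∃ E : Set Ω, MeasurableSet E ∧ 1 - δ ≤ P.real E ∧ ∀ ω ∈ E, ω ∉ F ∧ q ω := by
  refine ⟨(F ∪ toMeasurable P {ω | ¬q ω})ᶜ, (hF.union (measurableSet_toMeasurable _ _)).compl,
    ?_, fun ω hω => ?_⟩
  · have h1 : P.real (toMeasurable P {ω | ¬q ω}) = 0 := by
      rw [measureReal_def, measure_toMeasurable, ae_iff.1 hq, ENNReal.toReal_zero]
    rw [probReal_compl_eq_one_sub (hF.union (measurableSet_toMeasurable _ _))]
    linarith [measureReal_union_le (μ := P) F (toMeasurable P {ω | ¬q ω})]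
  · simp only [Set.mem_compl_iff, Set.mem_union, not_or] at hω
    exact ⟨hω.1, not_not.1 fun h => hω.2 (subset_toMeasurable P _ h)⟩

/-- The sign of the noisy linear observation. -/
noncomputable def observationSign (β : EuclideanSpace ℝ (Fin p)) (i : Fin n)
    (z : (Fin n → EuclideanSpace ℝ (Fin p)) × EuclideanSpace ℝ (Fin n)) : ℝ :=
  if 0 ≤ ⟪z.1 i, β⟫_ℝ + z.2 i then 1 else -1

lemma observationSign_eq_or (β : EuclideanSpace ℝ (Fin p)) (i : Fin n)
    (z : (Fin n → EuclideanSpace ℝ (Fin p)) × EuclideanSpace ℝ (Fin n)) :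
    observationSign β i z = 1 ∨ observationSign β i z = -1 := by
  unfold observationSign
  split_ifs <;> simp

lemma measurable_observationSign (β : EuclideanSpace ℝ (Fin p)) (i : Fin n) :
    Measurable (observationSign β i) := by
  refine Measurable.ite (measurableSet_le measurable_const ?_) measurable_const measurable_const
  have h1 : Measurable fun v : EuclideanSpace ℝ (Fin p) => ⟪v, β⟫_ℝ :=
    (continuous_id.inner continuous_const).measurable
  have h2 : Measurable fun v : EuclideanSpace ℝ (Fin n) => v i :=
    (EuclideanSpace.proj (𝕜 := ℝ) i).continuous.measurable
  exact (h1.comp ((measurable_pi_apply i).comp measurable_fst)).add (h2.comp measurable_snd)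

lemma noisyPhase_eq_observationSign_mul (x : Fin n → EuclideanSpace ℝ (Fin p))
    (β : EuclideanSpace ℝ (Fin p)) (e : EuclideanSpace ℝ (Fin n)) (i : Fin n) :
    noisyPhase x β e i = observationSign β i (x, e) * (⟪x i, β⟫_ℝ + e i) := by
  unfold noisyPhase observationSign
  split_ifs with h
  · rw [abs_of_nonneg h, one_mul]
  · rw [abs_of_neg (not_le.1 h), neg_one_mul]

end Recovery

end PhaseRetrieval

open PhaseRetrieval in
theorem corollary2 (κ : ℝ≥0) (m : ℝ) (hm : 1 < m) :
    ∃ c₃ > (0 : ℝ), ∃ c₄ > (0 : ℝ), ∃ c₅ > (0 : ℝ), ∀ c₄' : ℝ, c₄ ≤ c₄' → ∃ c₆ > (0 : ℝ),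
      ∀ (n p : ℕ), 0 < p → c₃ * (p : ℝ) ≤ (n : ℝ) →
      ∀ {Ω : Type*} [MeasurableSpace Ω] (P : Measure Ω) [IsProbabilityMeasure P]
        (x : Fin n → Ω → EuclideanSpace ℝ (Fin p)) (e : Ω → EuclideanSpace ℝ (Fin n))
        (ε : Fin n → Ω → ℝ) (β : EuclideanSpace ℝ (Fin p)) (η : Ω → ℝ),
        PhaseRetrieval.IsSubGaussianDesign x κ m P →
        Measurable e →
        PhaseRetrieval.IsRademacherFamily ε P →
        IndepFun (fun ω i => ε i ω) (fun ω => ((fun i => x i ω), e ω)) P →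
        (∀ᵐ ω ∂P, ‖e ω‖ ≤ c₅ * (√(n : ℝ) * ‖β‖)) →
        (∀ᵐ ω ∂P, c₄ * (√(n : ℝ) * ‖e ω‖ * ‖β‖) ≤ η ω ∧
          η ω ≤ c₄' * (√(n : ℝ) * ‖e ω‖ * ‖β‖)) →
        ∃ E : Set Ω, MeasurableSet E ∧ 1 - 1 / (n : ℝ) ^ 2 ≤ P.real E ∧
          ∀ ω ∈ E,
            let xs : Fin n → EuclideanSpace ℝ (Fin p) := fun i => x i ω
            let y : Fin n → ℝ := fun i => ε i ω * PhaseRetrieval.noisyPhase xs β (e ω) i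
            (∃ b₁ b₂, PhaseRetrieval.IsOutput xs y (η ω) b₁ b₂) ∧
            ∀ b₁ b₂, PhaseRetrieval.IsOutput xs y (η ω) b₁ b₂ →
              min ‖b₁ - β‖ ‖b₂ - β‖ ≤ c₆ * (‖e ω‖ / √(n : ℝ)) := by
  obtain ⟨c, hc, hsub⟩ := exists_hasSubgaussianMGF ((κ : ℝ) + 1) (by positivity)
  set τ : ℝ := max 1 (256 * certBound c m) with hτ
  have hτ1 : 1 ≤ τ := le_max_left _ _
  have hτ0 : 0 < τ := by linarith
  have hk := certRate_pos hc hτ0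
  set k := certRate c τ with hk_def
  -- The first constant is the threshold of `failure_bound` and 5 makes the truth feasible. In the
  -- noise level, 1 bounds `‖e‖²` by the cross term and `1 / (64 τ)` allows the absorption in
  -- `IsCertified.error_le`.
  refine ⟨10 / k + 288 / k ^ 3, by positivity, 5, by norm_num, min 1 (1 / (64 * τ)),
    by positivity, fun c' hc' => ?_⟩
  have hC : 0 < 16 * τ * (c' + 5) := by
    have : 0 < c' + 5 := by linarith
    positivity
  refine ⟨41 * (16 * τ * (c' + 5)) + 10 * (16 * τ * (c' + 5)) ^ 2, by positivity, ?_⟩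
  intro n p hp hn Ω _ P _ x e ε β η hx he hε hind hnoise hη
  have hnp : 0 < n := by
    have h1 : (0 : ℝ) < p := by exact_mod_cast hp
    have h2 : (0 : ℝ) < n := lt_of_lt_of_le (by positivity) hn
    exact_mod_cast h2
  -- For `β = 0` the direction `u` is undefined, but the hypotheses then force zero noise, zero data
  -- and `η = 0`.
  rcases eq_or_ne β 0 with rfl | hβ
  · obtain ⟨E, hE, hPE, hEω⟩ := exists_event_of_ae (P := P) (F := ∅) (δ := 1 / (n : ℝ) ^ 2)
      MeasurableSet.empty (by simp) (hnoise.and hη)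
    refine ⟨E, hE, hPE, fun ω hω => ?_⟩
    obtain ⟨-, h1, h2⟩ := hEω ω hω
    simp only [norm_zero, mul_zero] at h1 h2
    have he0 : e ω = 0 := norm_le_zero_iff.1 h1
    have hη0 : η ω = 0 := le_antisymm h2.2 h2.1
    have hy : (fun i => ε i ω * noisyPhase (fun i => x i ω) 0 0 i) = 0 := by
      funext i
      simp [noisyPhase]
    have hout := output_of_zero (x := fun i => x i ω) hp
    simp only [hη0, he0, hy, sub_zero, norm_zero, zero_div, mul_zero]
    exact hout
  -- The observation `ε i |r|`, with `r` the noisy linear response, equals `(ε i σ i) r`, and the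
  -- products `ε i σ i` are the effective Rademacher labels.
  · set σ := observationSign (n := n) β
    set Z : Ω → (Fin n → EuclideanSpace ℝ (Fin p)) × EuclideanSpace ℝ (Fin n) :=
      fun ω => (fun i => x i ω, e ω)
    have hZ : Measurable Z := (measurable_pi_iff.2 hx.measurable).prodMk he
    obtain ⟨hs, hZs⟩ := hε.mul_signs hZ hind (measurable_observationSign β)
      (observationSign_eq_or β)
    have hXs : IndepFun (fun ω i => x i ω) (fun ω i => ε i ω * σ i (Z ω)) P :=
      hZs.comp measurable_fst measurable_id
    have hsample : IsSignedSample x (fun i ω => ε i ω * σ i (Z ω)) c m P :=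
      ⟨hx.isSubGaussianRow (hsub P), hs,
        iIndepFun_prodMk hx.measurable hs.measurable hx.iIndepFun_rows hs.indep hXs,
        fun i => hXs.comp (measurable_pi_apply i) (measurable_pi_apply i)⟩
    obtain ⟨F, hF, hPF, hFω⟩ := hsample.exists_isCertified hc hm hτ1 (le_max_right _ _)
      (norm_normalize hβ).le
    obtain ⟨E, hE, hPE, hEω⟩ := exists_event_of_ae hF (hPF.trans (failure_bound hk hp hn))
      ((ae_all_iff.2 hs.ae_sq_eq_one).and (hnoise.and hη))
    refine ⟨E, hE, hPE, fun ω hω => ?_⟩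
    obtain ⟨hωF, hsq, h1, h2, h3⟩ := hEω ω hω
    have hy : (fun i => ε i ω * noisyPhase (fun i => x i ω) β (e ω) i) =
        signedObservation (fun i => x i ω) β (e ω) fun i => ε i ω * σ i (Z ω) := by
      funext i
      rw [noisyPhase_eq_observationSign_mul, ← mul_assoc]
      rfl
    have hB : 0 ≤ √(n : ℝ) * ‖β‖ := by positivity
    have h4 : ‖e ω‖ ≤ √(n : ℝ) * ‖β‖ :=
      h1.trans (mul_le_of_le_one_left hB (min_le_left _ _))
    have h5 : 64 * τ * ‖e ω‖ ≤ √(n : ℝ) * ‖β‖ := by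
      have h6 := h1.trans (mul_le_mul_of_nonneg_right (min_le_right _ _) hB)
      rw [div_mul_eq_mul_div, one_mul, le_div_iff₀ (by positivity)] at h6
      linarith
    have hout := (hFω ω hωF hsq).output hβ hnp hp (by linarith : 0 ≤ c') hτ0.le h4 h5 h2 h3
    rw [← hy] at hout
    exact hout
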